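/- **Setting.** Let $L\ge3$ be odd, $a>0$, $\mathfrak q\ge4$ even, $N\ge1$, and let $L_{\rm tp}\in L^{2N}\mathbb N$, $L_{\rm sp}\in L^{N}\mathbb N$ be positive. For integers $j\ge-1$ and $0\le k\le N$ put $$\mathcal X_j^{(k)}=\big(L^{-2j}\mathbb Z/L^{-2(j+k)}L_{\rm tp}\mathbb Z\big)\times\big(L^{-j}\mathbb Z^3/L^{-(j+k)}L_{\rm sp}\mathbb Z^3\big),\quad \mathcal H_j^{(k)}=\mathbb C^{\mathcal X_j^{(k)}},\quad \langle f,g\rangle_j=\int fg:=L^{-5j}\sum_{u}f(u)g(u),$$ $\mathcal X_n=\mathcal X_n^{(0)}$, $\mathcal H_n=\mathcal H_n^{(0)}$; $*$ on an operator denotes the transpose for these bilinear forms. Let $\mathbb L(u_0,\mathbf u)=(L^2u_0,L\mathbf u)$, $\mathbb L_*\alpha=\alpha\circ\mathbb L^{-1}$ and $(\mathbb S\alpha)(u)=L^{3/2}\alpha(\mathbb Lu)$. Let $q=L^{-5\mathfrak q}\,1_\square*\cdots*1_\square$ ($\mathfrak q$ factors), $\square=[-\frac{L^2-1}2,\frac{L^2-1}2]\times[-\frac{L-1}2,\frac{L-1}2]^3\subset\mathbb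 Z\times\mathbb Z^3$, and $$Q:\mathcal H_0^{(n)}\to\mathcal H_{-1}^{(n+1)},\quad (Q\psi)(y)=\sum_{x\in\mathbb Z\times\mathbb Z^3}q(x)\psi(y+[x]),\qquad Q^{(j)}=\mathbb L_*^{-j}Q\,\mathbb L_*^{j},\qquad Q_n=Q^{(1)}\cdots Q^{(n)}:\mathcal H_n\to\mathcal H_0^{(n)},$$ $\mathfrak Q_n=a\big(1+\sum_{j=1}^{n-1}L^{-2j}Q_jQ_j^*\big)^{-1}$. Let $h_0$ be the periodization of a translation invariant operator $\mathbf h_0$ on $L^2(\mathbb Z^3)$ with real summable kernel, invariant under coordinate reflections, whose Fourier transform is $\ge0$ and vanishes exactly on $2\pi\mathbb Z^3$. Let $\partial_0$ be the forward time derivative and $$D_0=1-e^{-h_0}-e^{-h_0}\partial_0,\qquad D_n=L^{2n}\mathbb L_*^{-n}D_0\mathbb L_*^{n},\qquad S_n(\mu)=(D_n+Q_n^*\mathfrak Q_nQ_n-\mu)^{-1},\quad S_n=S_n(0).$$ A quartic monomial on $\mathcal X_n$ is $\mathcal V(\phi_*,\phi)=\frac12\int_{\mathcal X_n^4}V(u_1,u_2,u_3,u_4)\phi_*(u_1)\phi(u_2)\phi_*(u_3)\phi(u_4)\,du_1\cdots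 du_4$ with a complex kernel invariant under $u_1\leftrightarrow u_3$ and under $u_2\leftrightarrow u_4$; $(\mathbb S\mathcal V)(\phi_*,\phi)=\mathcal V(\mathbb S^{-1}\phi_*,\mathbb S^{-1}\phi)$. For a mass $\mathfrak m\ge0$, $$\|\mathcal V\|_{\mathfrak m}=\max_{i}\max_{u_i}\int\prod_{l\ne i}du_l\,|V(u_1,\dots,u_4)|e^{\mathfrak m\tau(u_1,\dots,u_4)},\qquad \|A\|_{\mathfrak m}=\max\Big\{\max_u\int du'|A(u,u')|e^{\mathfrak m|u-u'|},\ \max_{u'}\int du\,|A(u,u')|e^{\mathfrak m|u-u'|}\Big\},$$ with $|u-u'|$ the Euclidean distance on the torus and $\tau$ the minimal length of a tree in $\mathcal X_n$ having $u_1,\dots,u_4$ among its vertices. Put $$A_n(\psi_*,\psi,\phi_*,\phi,\mu,\mathcal V)=\langle\psi_*-Q_n\phi_*,\mathfrak Q_n(\psi-Q_n\phi)\rangle_0+\langle\phi_*,D_n\phi\rangle_n+\mathcal V(\phi_*,\phi)-\mu\langle\phi_*,\phi\rangle_n\quad(n\ge1),$$ $A_0(\psi_*,\psi,\mu,\mathcal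 V)=\langle\psi_*,D_0\psi\rangle_0+\mathcal V(\psi_*,\psi)-\mu\langle\psi_*,\psi\rangle_0$, and $\check A_n(\theta_*,\theta,\phi_*,\phi,\mu,\mathcal V)=A_n(\mathbb S\theta_*,\mathbb S\theta,\mathbb S\phi_*,\mathbb S\phi,L^2\mu,\mathbb S\mathcal V)$. For $n\ge1$ the *background fields* $\phi_{(*)n}(\psi_*,\psi,\mu,\mathcal V)\in\mathcal H_n$ are the maps, analytic on a polydisc $\{|\psi_*(x)|,|\psi(x)|<r\}\subset\mathcal H_0^{(n)}\times\mathcal H_0^{(n)}$, that solve $\partial A_n/\partial\phi_*=\partial A_n/\partial\phi=0$ and satisfy $\phi_{*n}=S_n(\mu)^*Q_n^*\mathfrak Q_n\psi_*+\cdots$, $\phi_n=S_n(\mu)Q_n^*\mathfrak Q_n\psi+\cdots$ up to terms of degree at least three in $(\psi_*,\psi)$; they are considered on all such polydiscs on which they exist. For $n\ge1$ set $\check\phi_{(*)n}(\theta_*,\theta,\mu,\mathcal V)=\mathbb S^{-1}\big[\phi_{(*)n}(\mathbb S\theta_*,\mathbb S\theta,L^2\mu,\mathbb S\mathcal V)\big]$,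 $\theta_{(*)}\in\mathcal H_{-1}^{(n)}$. Define $\psi_{(*)0}=\check\phi_{(*)1}$ and, for $n\ge1$ and $\theta_{(*)}\in\mathcal H_{-1}^{(n+1)}$, $$\psi_{(*)n}(\theta_*,\theta,\mu,\mathcal V)=\Big(\tfrac a{L^2}Q^*Q+\mathfrak Q_n\Big)^{-1}\Big\{\tfrac a{L^2}Q^*\theta_{(*)}+\mathfrak Q_nQ_n\check\phi_{(*)n+1}(\theta_*,\theta,\mu,\mathcal V)\Big\}.$$ Finally let $0<v_0<1$, $\epsilon>0$, let $0<\delta<1$ (the difference $\mu_0-\mu_*$ of the initial and the critical chemical potential) satisfy $\frac34+8\epsilon<\frac{\log v_0}{\log\delta}<\frac98-\epsilon$, and put $\kappa(n)=L^{\eta n}/v_0^{1/3-\epsilon}$, $\eta=\frac12+\frac13\frac{\log v_0}{\log\delta}$. **Proposition.** There are functions $\rho(L,a,\Gamma)>0$ and $L_0(a,\Gamma)$ such that the following holds for all data as above, all masses $m\ge0$, all $0\le n<N$, all $\mu\in\mathbb C$ and all quartic monomials $\mathcal V$ on $\mathcal X_n$ with $$\|\mathcal V\|_{2m}\,\kappa(n+1)^2+|\mu|\le\rho(L,a,\Gamma),\qquad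 \Gamma=\max\{\|S_n\|_{2m},\|S_{n+1}\|_{2m}\}.$$ The background fields $\phi_{(*)n}(\cdot,\cdot,\mu,\mathcal V)$ (if $n\ge1$) and $\phi_{(*)n+1}(\cdot,\cdot,L^2\mu,\mathbb S\mathcal V)$ exist on the polydiscs of radius $\kappa(n)$ and $\kappa(n+1)$, respectively, and, with $\phi_{(*)n}=\phi_{(*)n}(\psi_*,\psi,\mu,\mathcal V)$: (a) The $\psi_{(*)n}(\theta_*,\theta,\mu,\mathcal V)$ are analytic on the set of all $(\theta_*,\theta)$ with $|\theta_*(y)|,|\theta(y)|<\kappa(n+1)/L^{3/2}$ for all $y$, and for all such $(\theta_*,\theta)$ they solve the critical field equations $$\nabla_{\psi_*}\mathcal F=\nabla_{\psi}\mathcal F=0,\qquad \mathcal F=\tfrac a{L^2}\langle\theta_*-Q\psi_*,\theta-Q\psi\rangle_{-1}+\begin{cases}A_n(\psi_*,\psi,\phi_{*n},\phi_n,\mu,\mathcal V)&n\ge1\\A_0(\psi_*,\psi,\mu,\mathcal V)&n=0.\end{cases}$$ If $n\ge1$, then $(\psi_{*n},\psi_n)$ lies in the domain of the background fields $\phi_{(*)n}$,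 and even in the polydisc $|\psi_{*n}(x)|,|\psi_n(x)|<\kappa(n)$ if $L\ge L_0(a,\Gamma)$. (b) If $n\ge1$, then for the same $(\theta_*,\theta)$: $\ \check\phi_{(*)n+1}(\theta_*,\theta,\mu,\mathcal V)=\phi_{(*)n}\big(\psi_{*n}(\theta_*,\theta,\mu,\mathcal V),\psi_n(\theta_*,\theta,\mu,\mathcal V),\mu,\mathcal V\big)$. (c) If $n\ge1$, then for the same $(\theta_*,\theta)$, all fields being taken at $(\theta_*,\theta,\mu,\mathcal V)$: $$\check A_{n+1}(\theta_*,\theta,\check\phi_{*n+1},\check\phi_{n+1},\mu,\mathcal V)=\tfrac a{L^2}\langle\theta_*-Q\psi_{*n},\theta-Q\psi_n\rangle_{-1}+A_n(\psi_{*n},\psi_n,\check\phi_{*n+1},\check\phi_{n+1},\mu,\mathcal V).$$ -/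

import Mathlib

open scoped Topology

noncomputable section

namespace BlockSpin

/-! ## Data of the model

All lattices are described by integer coordinates. The lattice `𝒳_j^{(k)}` is
`(L^{-2j} ℤ / L^{-2(j+k)} L_tp ℤ) × (L^{-j} ℤ³ / L^{-(j+k)} L_sp ℤ³)`. The integer vector
`(i₀, i)` stands for the point `(L^{-2j} i₀, L^{-j} i)`. As a set of integer coordinates the
lattice therefore depends on `k` only (`Lat k` below). The index `j` enters through the lattice
spacing, that is, through the distance and the cell volume `L^{-5j}`. The isomorphism
`𝕃 : 𝒳_j^{(k)} → 𝒳_{j-1}^{(k)}`, `(u₀, u) ↦ (L² u₀, L u)`, is the identity in integer coordinates,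
so conjugation with its push-forward does not change a matrix. -/

/-- The kernel `k(x - y)` of a single particle kinetic energy operator `𝐡₀` on `ℤ³`, real and
invariant under the three coordinate reflections. Its Fourier transform is nonnegative and
vanishes precisely on `2πℤ³`. -/
structure Kinetic where
  ker : (Fin 3 → ℤ) → ℝ
  summable_ker : Summable ker
  reflect : ∀ (i : Fin 3) (z : Fin 3 → ℤ), ker (Function.update z i (-z i)) = ker z
  fourier_nonneg : ∀ p : Fin 3 → ℝ, 0 ≤ ∑' z : Fin 3 → ℤ, ker z * Real.cos (∑ i, p i * z i)
  fourier_zero_iff : ∀ p : Fin 3 → ℝ,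
    ∑' z : Fin 3 → ℤ, ker z * Real.cos (∑ i, p i * z i) = 0 ↔
      ∀ i, ∃ m : ℤ, p i = 2 * Real.pi * m

/-- The parameters: the odd block size `L ≥ 3`, the constant `a > 0` of the block spin
transformation, the even exponent `qexp ≥ 4` of the averaging profile, the kinetic energy, and
the volume `L_tp = L^{2 N} T`, `L_sp = L^N S` (so `L^{2N} ∣ L_tp` and `L^N ∣ L_sp`, which makes
room for `N` block spin steps). -/
structure Setup where
  L : ℕ
  a : ℝ
  qexp : ℕ
  N : ℕ
  T : ℕ
  S : ℕ
  kin : Kinetic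
  odd_L : Odd L
  three_le_L : 3 ≤ L
  a_pos : 0 < a
  even_qexp : Even qexp
  four_le_qexp : 4 ≤ qexp
  T_pos : 0 < T
  S_pos : 0 < S

namespace Setup

variable (P : Setup)

/-- number of sites in the time direction after `k` block spin steps, `L_tp / L^{2k}` -/
def nt (k : ℕ) : ℕ := P.L ^ (2 * (P.N - k)) * P.T

/-- number of sites in each spatial direction after `k` block spin steps, `L_sp / L^k` -/
def ns (k : ℕ) : ℕ := P.L ^ (P.N - k) * P.S

instance (k : ℕ) : NeZero (P.nt k) :=
  ⟨(Nat.mul_pos (Nat.pow_pos (by have := P.three_le_L; omega)) P.T_pos).ne'⟩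

instance (k : ℕ) : NeZero (P.ns k) :=
  ⟨(Nat.mul_pos (Nat.pow_pos (by have := P.three_le_L; omega)) P.S_pos).ne'⟩

/-- integer coordinates of the lattices `𝒳_j^{(k)}`, for every `j` -/
abbrev Lat (k : ℕ) : Type := ZMod (P.nt k) × (Fin 3 → ZMod (P.ns k))

/-- the space `ℋ_j^{(k)}` of complex fields on `𝒳_j^{(k)}` -/
abbrev Fld (k : ℕ) : Type := P.Lat k → ℂ

/-- the bilinear form `⟨f, g⟩_j = L^{-5j} ∑ f g` on `ℋ_j^{(k)}` -/
def ip (j : ℤ) {k : ℕ} (f g : P.Fld k) : ℂ := (P.L : ℂ) ^ (-5 * j) * ∑ u, f u * g u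

/-- Transpose of `M : ℋ_j^{(k)} → ℋ_{j'}^{(k')}` with respect to `⟨·,·⟩_j` and `⟨·,·⟩_{j'}`;
see `ip_adj`. -/
def adj (j j' : ℤ) {k k' : ℕ} (M : Matrix (P.Lat k') (P.Lat k) ℂ) :
    Matrix (P.Lat k) (P.Lat k') ℂ := (P.L : ℂ) ^ (5 * (j - j')) • M.transpose

theorem ip_adj (j j' : ℤ) {k k' : ℕ} (M : Matrix (P.Lat k') (P.Lat k) ℂ)
    (f : P.Fld k) (g : P.Fld k') :
    P.ip j' (M.mulVec f) g = P.ip j f ((P.adj j j' M).mulVec g) := by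
  have hL : (P.L : ℂ) ≠ 0 := by
    have := P.three_le_L
    exact_mod_cast (by omega : P.L ≠ 0)
  have h1 : ∑ u, (M.mulVec f) u * g u = ∑ u, f u * (M.transpose.mulVec g) u := by
    have h := Matrix.dotProduct_mulVec f M.transpose g
    rw [Matrix.vecMul_transpose] at h
    simpa [dotProduct] using h.symm
  have h2 : ∑ u, f u * ((P.adj j j' M).mulVec g) u
      = (P.L : ℂ) ^ (5 * (j - j')) * ∑ u, f u * (M.transpose.mulVec g) u := by
    rw [Finset.mul_sum]
    refine Finset.sum_congr rfl fun u _ => ?_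
    simp only [adj, Matrix.smul_mulVec, Pi.smul_apply, smul_eq_mul]
    ring
  simp only [ip]
  rw [h1, h2, ← mul_assoc, ← zpow_add₀ hL]
  congr 2
  ring

/-- The scaling `𝕊 : ℋ_{j-1}^{(k)} → ℋ_j^{(k)}`, `(𝕊 α)(u) = L^{3/2} α(𝕃 u)`. -/
def scl {k : ℕ} (f : P.Fld k) : P.Fld k := (((P.L : ℝ) ^ (3 / 2 : ℝ) : ℝ) : ℂ) • f

/-- `𝕊⁻¹ : ℋ_j^{(k)} → ℋ_{j-1}^{(k)}`, `(𝕊⁻¹ β)(v) = L^{-3/2} β(𝕃⁻¹ v)`. -/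
def unscl {k : ℕ} (f : P.Fld k) : P.Fld k := (((P.L : ℝ) ^ (-(3 / 2) : ℝ) : ℝ) : ℂ) • f

/-! ## Block averaging -/

/-- the rectangle `[-(L²-1)/2, (L²-1)/2] × [-(L-1)/2, (L-1)/2]³` in `ℤ × ℤ³` -/
def box : Finset (ℤ × (Fin 3 → ℤ)) :=
  Finset.Icc (-(((P.L : ℤ) ^ 2 - 1) / 2)) (((P.L : ℤ) ^ 2 - 1) / 2) ×ˢ
    Fintype.piFinset fun _ => Finset.Icc (-(((P.L : ℤ) - 1) / 2)) (((P.L : ℤ) - 1) / 2)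

/-- the `r`-fold convolution of the indicator function of `box` with itself
(the unit point mass at `0` for `r = 0`) -/
def boxConv : ℕ → ℤ × (Fin 3 → ℤ) → ℝ
  | 0 => fun x => if x = 0 then 1 else 0
  | r + 1 => fun x => ∑ y ∈ P.box, boxConv r (x - y)

/-- the averaging profile `q = L^{-5 qexp} 1_□ * ⋯ * 1_□` -/
def prof (x : ℤ × (Fin 3 → ℤ)) : ℝ := ((P.L : ℝ) ^ (5 * P.qexp))⁻¹ * P.boxConv P.qexp x

/-- the class `[x]` of `x ∈ ℤ × ℤ³` in the unit lattice `𝒳_0^{(k)}` -/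
def cls (k : ℕ) (x : ℤ × (Fin 3 → ℤ)) : P.Lat k :=
  ((x.1 : ZMod (P.nt k)), fun i => (x.2 i : ZMod (P.ns k)))

/-- The inclusion `𝒳_{-1}^{(k+1)} ⊂ 𝒳_0^{(k)}`: the point of `𝒳_{-1}^{(k+1)}` with integer
coordinates `(i₀, i)` is the point `(L² i₀, L i)` of the unit lattice `𝒳_0^{(k)}`.
Used with `k' = k + 1 ≤ N`. -/
def incl (k' k : ℕ) (y : P.Lat k') : P.Lat k :=
  P.cls k (((P.L ^ 2 * y.1.val : ℕ) : ℤ), fun i => ((P.L * (y.2 i).val : ℕ) : ℤ))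

/-- The averaging operator `Q : ℋ_0^{(k)} → ℋ_{-1}^{(k+1)}`,
`(Qψ)(y) = ∑_{x ∈ ℤ × ℤ³} q(x) ψ(y + [x])`, as a matrix (`k' = k + 1`). In integer coordinates
it is also the matrix of `Q^{(j)} = 𝕃_*^{-j} Q 𝕃_*^j : ℋ_j^{(k)} → ℋ_{j-1}^{(k+1)}`. -/
def avg (k' k : ℕ) : Matrix (P.Lat k') (P.Lat k) ℂ := fun y u =>
  ∑' x : ℤ × (Fin 3 → ℤ), if P.incl k' k y + P.cls k x = u then (P.prof x : ℂ) else 0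

/-- `Q_n = Q^{(1)} ∘ ⋯ ∘ Q^{(n)} : ℋ_n → ℋ_0^{(n)}` -/
def Qn : (n : ℕ) → Matrix (P.Lat n) (P.Lat 0) ℂ
  | 0 => 1
  | n + 1 => P.avg (n + 1) n * Qn n

/-- `Q_j = Q^{(1)} ∘ ⋯ ∘ Q^{(j)} : ℋ_j^{(n-j)} → ℋ_0^{(n)}`, for `j ≤ n` -/
def Qsub (n : ℕ) : (j : ℕ) → Matrix (P.Lat n) (P.Lat (n - j)) ℂ
  | 0 => (1 : Matrix (P.Lat n) (P.Lat n) ℂ)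
  | j + 1 => Qsub n j * P.avg (n - j) (n - (j + 1))

/-- `𝔔_n = a (1 + ∑_{j=1}^{n-1} L^{-2j} Q_j Q_j^*)⁻¹` on `ℋ_0^{(n)}` -/
def fQ (n : ℕ) : Matrix (P.Lat n) (P.Lat n) ℂ :=
  (P.a : ℂ) • (1 + ∑ j ∈ Finset.Ico 1 n,
    ((P.L : ℂ) ^ (2 * j))⁻¹ • (P.Qsub n j * P.adj j 0 (P.Qsub n j)))⁻¹

/-! ## Differential operators and Green functions -/

/-- the periodization `h₀` of the kinetic energy, acting on the spatial variables of fields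
on `𝒳_0` -/
def hMat : Matrix (P.Lat 0) (P.Lat 0) ℂ := fun x y =>
  if x.1 = y.1 then
    ∑' z : Fin 3 → ℤ, if (fun i => (z i : ZMod (P.ns 0))) = x.2 - y.2 then (P.kin.ker z : ℂ) else 0
  else 0

/-- the forward time derivative on the unit lattice `𝒳_0` -/
def dt : Matrix (P.Lat 0) (P.Lat 0) ℂ := fun x y =>
  (if y = (x.1 + 1, x.2) then 1 else 0) - (if y = x then 1 else 0)

/-- `D_0 = 1 - e^{-h₀} - e^{-h₀} ∂₀` -/
def D0 : Matrix (P.Lat 0) (P.Lat 0) ℂ :=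
  1 - NormedSpace.exp (-P.hMat) - NormedSpace.exp (-P.hMat) * P.dt

/-- `D_n = L^{2n} 𝕃_*^{-n} D_0 𝕃_*^n` on `ℋ_n` -/
def D (n : ℕ) : Matrix (P.Lat 0) (P.Lat 0) ℂ := (P.L : ℂ) ^ (2 * n) • P.D0

/-- `S_n(μ) = (D_n + Q_n^* 𝔔_n Q_n - μ)⁻¹` on `ℋ_n` -/
def green (n : ℕ) (μ : ℂ) : Matrix (P.Lat 0) (P.Lat 0) ℂ :=
  (P.D n + P.adj n 0 (P.Qn n) * P.fQ n * P.Qn n - μ • (1 : Matrix (P.Lat 0) (P.Lat 0) ℂ))⁻¹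

/-! ## Distances and norms -/

/-- the Euclidean distance on the torus `𝒳_j^{(k)}`, with lattice spacing `L^{-2j}` in the time
direction and `L^{-j}` in the spatial directions -/
def dist (j : ℤ) {k : ℕ} (x y : P.Lat k) : ℝ :=
  √(((P.L : ℝ) ^ (-2 * j) * ((x.1 - y.1).valMinAbs.natAbs : ℝ)) ^ 2 +
    ∑ i, ((P.L : ℝ) ^ (-j) * ((x.2 i - y.2 i).valMinAbs.natAbs : ℝ)) ^ 2)

theorem dist_comm (j : ℤ) {k : ℕ} (x y : P.Lat k) : P.dist j x y = P.dist j y x := by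
  have h1 : (x.1 - y.1).valMinAbs.natAbs = (y.1 - x.1).valMinAbs.natAbs := by
    rw [← ZMod.natAbs_valMinAbs_neg, neg_sub]
  have h2 : ∀ i, (x.2 i - y.2 i).valMinAbs.natAbs = (y.2 i - x.2 i).valMinAbs.natAbs := by
    intro i
    rw [← ZMod.natAbs_valMinAbs_neg, neg_sub]
  simp only [dist, h1, h2]

/-- the length of an edge -/
def edgeLen (j : ℤ) {k : ℕ} : Sym2 (P.Lat k) → ℝ :=
  Sym2.lift ⟨fun x y => P.dist j x y, fun x y => P.dist_comm j x y⟩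

/-- the tree length: the minimal length of a tree in `𝒳_j^{(k)}` that has all the points `u i`
among its vertices -/
def treeLen (j : ℤ) {k r : ℕ} (u : Fin r → P.Lat k) : ℝ :=
  sInf {ℓ : ℝ | ∃ G : (⊤ : SimpleGraph (P.Lat k)).Subgraph,
    G.coe.IsTree ∧ (∀ i, u i ∈ G.verts) ∧ ℓ = ∑ᶠ e ∈ G.edgeSet, P.edgeLen j e}

/-- the norm with mass `m` of a kernel on `(𝒳_j^{(k)})^r`: the largest value, over `i` and `x`, of
`∫ |f(u)| e^{m τ(u)}` over all `u_l`, `l ≠ i`, with `u_i = x` fixed -/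
def kerNorm (j : ℤ) (m : ℝ) {k r : ℕ} (f : (Fin r → P.Lat k) → ℂ) : ℝ :=
  ⨆ i : Fin r, ⨆ x : P.Lat k, ((P.L : ℝ) ^ (-5 * j)) ^ (r - 1) *
    ∑ u : Fin r → P.Lat k, if u i = x then ‖f u‖ * Real.exp (m * P.treeLen j u) else 0

/-- the norm `‖A‖_m` with mass `m` of an operator on `ℋ_j^{(k)}`. The matrix entry `A x y` is
(cell volume) × (kernel of the operator at `(x, y)`). -/
def opNorm (j : ℤ) (m : ℝ) {k : ℕ} (A : Matrix (P.Lat k) (P.Lat k) ℂ) : ℝ :=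
  max (⨆ x, ∑ y, Real.exp (m * P.dist j x y) * ‖A x y‖)
    (⨆ y, ∑ x, Real.exp (m * P.dist j x y) * ‖A x y‖)

/-! ## Quartic monomials and the action -/

/-- the kernel of a quartic monomial on `𝒳_j = 𝒳_j^{(0)}` -/
structure Quartic where
  ker : P.Lat 0 → P.Lat 0 → P.Lat 0 → P.Lat 0 → ℂ
  symm13 : ∀ u₁ u₂ u₃ u₄, ker u₃ u₂ u₁ u₄ = ker u₁ u₂ u₃ u₄
  symm24 : ∀ u₁ u₂ u₃ u₄, ker u₁ u₄ u₃ u₂ = ker u₁ u₂ u₃ u₄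

variable {P}

namespace Quartic

/-- `½ ∫_{𝒳_j^4} du₁ ⋯ du₄ V(u₁,u₂,u₃,u₄) φ_*(u₁) φ(u₂) φ_*(u₃) φ(u₄)` -/
def eval (V : P.Quartic) (j : ℤ) (φs φ : P.Fld 0) : ℂ :=
  1 / 2 * ((P.L : ℂ) ^ (-5 * j)) ^ 4 *
    ∑ u₁, ∑ u₂, ∑ u₃, ∑ u₄, V.ker u₁ u₂ u₃ u₄ * φs u₁ * φ u₂ * φs u₃ * φ u₄

/-- the norm `‖𝒱‖_m` of the kernel of a quartic monomial on `𝒳_j` -/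
def norm (V : P.Quartic) (j : ℤ) (m : ℝ) : ℝ :=
  P.kerNorm j m fun u : Fin 4 → P.Lat 0 => V.ker (u 0) (u 1) (u 2) (u 3)

/-- the scaled monomial `𝕊𝒱` on `𝒳_{j+1}`, with kernel `L^{14} V(𝕃u₁, …, 𝕃u₄)`; it is characterized
by `(𝕊𝒱)(𝕊φ_*, 𝕊φ) = 𝒱(φ_*, φ)`, see `scale_eval` -/
def scale (V : P.Quartic) : P.Quartic where
  ker u₁ u₂ u₃ u₄ := (P.L : ℂ) ^ 14 * V.ker u₁ u₂ u₃ u₄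
  symm13 u₁ u₂ u₃ u₄ := by rw [V.symm13]
  symm24 u₁ u₂ u₃ u₄ := by rw [V.symm24]

theorem scale_eval (V : P.Quartic) (j : ℤ) (φs φ : P.Fld 0) :
    V.scale.eval (j + 1) (P.scl φs) (P.scl φ) = V.eval j φs φ := by
  have hL : (P.L : ℂ) ≠ 0 := by
    have := P.three_le_L
    exact_mod_cast (by omega : P.L ≠ 0)
  have hc : (((P.L : ℝ) ^ (3 / 2 : ℝ) : ℝ) : ℂ) ^ 4 = (P.L : ℂ) ^ 6 := by
    have h : ((P.L : ℝ) ^ (3 / 2 : ℝ)) ^ 4 = (P.L : ℝ) ^ 6 := by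
      rw [← Real.rpow_natCast, ← Real.rpow_mul (by positivity), ← Real.rpow_natCast]
      norm_num
    exact_mod_cast congrArg (fun x : ℝ => (x : ℂ)) h
  have hs : ((P.L : ℂ) ^ (-5 * (j + 1))) ^ 4 * ((P.L : ℂ) ^ 14 * (P.L : ℂ) ^ 6)
      = ((P.L : ℂ) ^ (-5 * j)) ^ 4 := by
    rw [← zpow_natCast, ← zpow_natCast, ← zpow_natCast, ← zpow_natCast, ← zpow_mul, ← zpow_mul,
      ← zpow_add₀ hL, ← zpow_add₀ hL]
    congr 1
    push_cast
    ring
  unfold eval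
  rw [← hs, ← hc, mul_assoc, mul_assoc, mul_assoc (((P.L : ℂ) ^ (-5 * (j + 1))) ^ 4)]
  congr 2
  simp only [Finset.mul_sum]
  refine Finset.sum_congr rfl fun u₁ _ => Finset.sum_congr rfl fun u₂ _ =>
    Finset.sum_congr rfl fun u₃ _ => Finset.sum_congr rfl fun u₄ _ => ?_
  simp only [scale, scl, Pi.smul_apply, smul_eq_mul]
  ring

end Quartic

variable (P)

/-- the dominant part of the action, for `n ≥ 1`: `A_n(ψ_*, ψ, φ_*, φ, μ, 𝒱) =
⟨ψ_* - Q_n φ_*, 𝔔_n (ψ - Q_n φ)⟩_0 + ⟨φ_*, D_n φ⟩_n + 𝒱(φ_*, φ) - μ ⟨φ_*, φ⟩_n` -/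
def act (n : ℕ) (μ : ℂ) (V : P.Quartic) (ψs ψ : P.Fld n) (φs φ : P.Fld 0) : ℂ :=
  P.ip 0 (ψs - (P.Qn n).mulVec φs) ((P.fQ n).mulVec (ψ - (P.Qn n).mulVec φ))
    + P.ip n φs ((P.D n).mulVec φ) + V.eval n φs φ - μ * P.ip n φs φ

/-- `A_0(ψ_*, ψ, μ, 𝒱) = ⟨ψ_*, D_0 ψ⟩_0 + 𝒱(ψ_*, ψ) - μ ⟨ψ_*, ψ⟩_0` -/
def act0 (μ : ℂ) (V : P.Quartic) (ψs ψ : P.Fld 0) : ℂ :=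
  P.ip 0 ψs (P.D0.mulVec ψ) + V.eval 0 ψs ψ - μ * P.ip 0 ψs ψ

/-- the scaled action `Ǎ_n(θ_*, θ, φ̌_*, φ̌, μ, 𝒱) = A_n(𝕊θ_*, 𝕊θ, 𝕊φ̌_*, 𝕊φ̌, L²μ, 𝕊𝒱)`, for
`θ_(*) ∈ ℋ_{-1}^{(n)}`, `φ̌_(*) ∈ ℋ_{n-1}` and `𝒱` a quartic monomial on `𝒳_{n-1}` -/
def actCheck (n : ℕ) (μ : ℂ) (V : P.Quartic) (θs θ : P.Fld n) (φs φ : P.Fld 0) : ℂ :=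
  P.act n ((P.L : ℂ) ^ 2 * μ) V.scale (P.scl θs) (P.scl θ) (P.scl φs) (P.scl φ)

/-! ## Background fields -/

/-- the set of pairs of fields with `|ψ_*(x)|, |ψ(x)| < r` for all `x` -/
def polydisc (k : ℕ) (r : ℝ) : Set (P.Fld k × P.Fld k) :=
  {p | (∀ x, ‖p.1 x‖ < r) ∧ ∀ x, ‖p.2 x‖ < r}

/-- both gradients of `f(φ_*, φ)` vanish at the point `p` -/
def IsCritical {k : ℕ} (f : P.Fld k → P.Fld k → ℂ) (p : P.Fld k × P.Fld k) : Prop :=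
  HasFDerivAt (fun φs => f φs p.2) (0 : P.Fld k →L[ℂ] ℂ) p.1 ∧
  HasFDerivAt (fun φ => f p.1 φ) (0 : P.Fld k →L[ℂ] ℂ) p.2

/-- the linear part `(S_n(μ)^* Q_n^* 𝔔_n ψ_*, S_n(μ) Q_n^* 𝔔_n ψ)` of the background fields -/
def bgLin (n : ℕ) (μ : ℂ) (p : P.Fld n × P.Fld n) : P.Fld 0 × P.Fld 0 :=
  ((P.adj n n (P.green n μ) * P.adj n 0 (P.Qn n) * P.fQ n).mulVec p.1,
    (P.green n μ * P.adj n 0 (P.Qn n) * P.fQ n).mulVec p.2)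

/-- `F = (φ_{*n}, φ_n)` is the pair of background fields on the polydisc of radius `r`: it is
analytic there, solves the background field equations
`∂A_n/∂φ_* = ∂A_n/∂φ = 0`, and equals its prescribed linear part up to terms of degree at least
three in `(ψ_*, ψ)`. -/
structure IsBackground (n : ℕ) (μ : ℂ) (V : P.Quartic) (r : ℝ)
    (F : P.Fld n × P.Fld n → P.Fld 0 × P.Fld 0) : Prop where
  analytic : AnalyticOnNhd ℂ F (P.polydisc n r)
  critical : ∀ p ∈ P.polydisc n r, P.IsCritical (P.act n μ V p.1 p.2) (F p)
  expansion : (fun p => F p - P.bgLin n μ p) =O[𝓝 0] fun p => ‖p‖ ^ 3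

/-- the set of all `(ψ_*, ψ)` at which the background fields are defined, that is, which lie in
some polydisc (centred at zero) on which there are background fields -/
def bgDomain (n : ℕ) (μ : ℂ) (V : P.Quartic) : Set (P.Fld n × P.Fld n) :=
  {p | ∃ r F, P.IsBackground n μ V r F ∧ p ∈ P.polydisc n r}

open Classical in
/-- the background fields `(ψ_*, ψ) ↦ (φ_{*n}, φ_n)(ψ_*, ψ, μ, 𝒱)` (zero off `bgDomain`) -/
def bg (n : ℕ) (μ : ℂ) (V : P.Quartic) (p : P.Fld n × P.Fld n) : P.Fld 0 × P.Fld 0 :=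
  if h : ∃ F r, P.IsBackground n μ V r F ∧ p ∈ P.polydisc n r then h.choose p else 0

/-- the scaled background fields
`φ̌_{(*)n}(θ_*, θ, μ, 𝒱) = 𝕊⁻¹[φ_{(*)n}(𝕊θ_*, 𝕊θ, L²μ, 𝕊𝒱)]`, for `θ_(*) ∈ ℋ_{-1}^{(n)}` and `𝒱` a
quartic monomial on `𝒳_{n-1}` -/
def bgCheck (n : ℕ) (μ : ℂ) (V : P.Quartic) (θ : P.Fld n × P.Fld n) : P.Fld 0 × P.Fld 0 :=
  (P.unscl (P.bg n ((P.L : ℂ) ^ 2 * μ) V.scale (P.scl θ.1, P.scl θ.2)).1,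
    P.unscl (P.bg n ((P.L : ℂ) ^ 2 * μ) V.scale (P.scl θ.1, P.scl θ.2)).2)

/-! ## Critical fields -/

/-- `Q : ℋ_0^{(n)} → ℋ_{-1}^{(n+1)}` -/
def Q (n : ℕ) : Matrix (P.Lat (n + 1)) (P.Lat n) ℂ := P.avg (n + 1) n

/-- `Q^* : ℋ_{-1}^{(n+1)} → ℋ_0^{(n)}` -/
def Qadj (n : ℕ) : Matrix (P.Lat n) (P.Lat (n + 1)) ℂ := P.adj 0 (-1) (P.Q n)

/-- the constant `a / L²` -/
def b : ℂ := (P.a : ℂ) / (P.L : ℂ) ^ 2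

/-- `(a/L² Q^* Q + 𝔔_n)⁻¹ {a/L² Q^* θ + 𝔔_n Q_n φ}` -/
def critOf (n : ℕ) (θ : P.Fld (n + 1)) (φ : P.Fld 0) : P.Fld n :=
  ((P.b • (P.Qadj n * P.Q n) + P.fQ n)⁻¹).mulVec
    (P.b • (P.Qadj n).mulVec θ + (P.fQ n).mulVec ((P.Qn n).mulVec φ))

/-- the fields `(ψ_{*n}, ψ_n)(θ_*, θ, μ, 𝒱)`, for `θ_(*) ∈ ℋ_{-1}^{(n+1)}` and `𝒱` a quartic
monomial on `𝒳_n` -/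
def crit : (n : ℕ) → (μ : ℂ) → (V : P.Quartic) → P.Fld (n + 1) × P.Fld (n + 1) →
    P.Fld n × P.Fld n
  | 0, μ, V, θ => P.bgCheck 1 μ V θ
  | n + 1, μ, V, θ =>
    (P.critOf (n + 1) θ.1 (P.bgCheck (n + 2) μ V θ).1,
      P.critOf (n + 1) θ.2 (P.bgCheck (n + 2) μ V θ).2)

/-- the block spin term `a/L² ⟨θ_* - Qψ_*, θ - Qψ⟩_{-1}` -/
def blockTerm (n : ℕ) (θ : P.Fld (n + 1) × P.Fld (n + 1)) (ψs ψ : P.Fld n) : ℂ :=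
  P.b * P.ip (-1) (θ.1 - (P.Q n).mulVec ψs) (θ.2 - (P.Q n).mulVec ψ)

/-- the function of `(ψ_*, ψ)` whose gradients are set to zero in the critical field equations:
`a/L² ⟨θ_* - Qψ_*, θ - Qψ⟩_{-1} + A_n(ψ_*, ψ, φ_{*n}(ψ_*,ψ,μ,𝒱), φ_n(ψ_*,ψ,μ,𝒱), μ, 𝒱)` if
`n ≥ 1`, and `a/L² ⟨θ_* - Qψ_*, θ - Qψ⟩_{-1} + A_0(ψ_*, ψ, μ, 𝒱)` if `n = 0` -/
def effAct : (n : ℕ) → (μ : ℂ) → (V : P.Quartic) → P.Fld (n + 1) × P.Fld (n + 1) →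
    P.Fld n → P.Fld n → ℂ
  | 0, μ, V, θ, ψs, ψ => P.blockTerm 0 θ ψs ψ + P.act0 μ V ψs ψ
  | n + 1, μ, V, θ, ψs, ψ => P.blockTerm (n + 1) θ ψs ψ +
      P.act (n + 1) μ V ψs ψ (P.bg (n + 1) μ V (ψs, ψ)).1 (P.bg (n + 1) μ V (ψs, ψ)).2

/-! ## Field radii -/

/-- the exponent `η = 1/2 + (1/3) log v₀ / log δ`, with `δ = μ₀ - μ_*` -/
def eta (v δ : ℝ) : ℝ := 1 / 2 + 1 / 3 * (Real.log v / Real.log δ)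

/-- the radius `κ(n) = L^{η n} / v₀^{1/3 - ε}` -/
def kappa (v ε δ : ℝ) (n : ℕ) : ℝ := (P.L : ℝ) ^ (eta v δ * n) / v ^ (1 / 3 - ε)

/-- the size `max {‖S_n‖_{2m}, ‖S_{n+1}‖_{2m}}` of the Green functions at scales `n` and `n+1` -/
def greenSize (m : ℝ) (n : ℕ) : ℝ :=
  max (P.opNorm n (2 * m) (P.green n 0)) (P.opNorm (n + 1) (2 * m) (P.green (n + 1) 0))

end Setup

end BlockSpin

end

open BlockSpin

/-!
The background fields solve a fixed point equation. The equations `∂A_n/∂φ_* = ∂A_n/∂φ = 0` read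
`φ = S_n(μ) (Q_n^* 𝔔_n ψ - 𝒱'(φ_*, φ))`, together with the transposed equation for `φ_*`. The cubic
term is a contraction on a ball of radius proportional to `κ(n+1)` once `‖𝒱‖ κ(n+1)² + |μ|` is
small, so that there is exactly one solution in the ball (`CubicLipschitz.unique`), and it is
analytic by the inverse function theorem (`CubicLipschitz.exists_analytic_solution`). Any two
background fields agree by the identity theorem (`Setup.SmallData.background_unique`). All estimates
are made in the supremum norm; a mass only increases the norms of the hypothesis. They are uniform
in the volume and in the averaging profile because `Q_n` and its transpose preserve constants
(`Setup.isAveraging_avg`), which gives `‖Q_n‖, ‖Q_n^*‖ ≤ 1` and, by a Neumann series,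
`‖𝔔_n‖ ≤ 2a`. That `D_n + Q_n^* 𝔔_n Q_n` is invertible at all (`Setup.isUnit_invGreen`) follows by
Fourier analysis: the real part of `D_n` is nonnegative with only the constants in its kernel, and
`Q_n^* 𝔔_n Q_n` is positive on the constants.

The relations between the scales rest on `a 𝔔_{n+1}⁻¹ = 1 + L^{-2} Q (a 𝔔_n⁻¹) Q^*`
(`Setup.invfQ_succ`). Let `ψ` be the critical field built from `θ` and `φ`. Then
`b Q^*(θ - Qψ) = 𝔔_n (ψ - Q_n φ)` with `b = a/L²`, by definition, and the recursion gives
`𝔔_{n+1} (θ - Q_{n+1} φ) = a (θ - Qψ)` (`Setup.fQ_succ_sub`). So a critical point of the rescaled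
action at scale `n + 1` is a critical point of the action at scale `n` with external fields `ψ`,
which is the composition rule in view of uniqueness; the same two identities, inserted into the quadratic
forms, are the recursion for the action. The critical field equations follow by the chain rule: the
gradient of the action in the background fields vanishes, and the explicit gradient in `ψ` is the
equation that defines `ψ`. For `n = 0` they are the background field equations at scale one.
-/

/-! ### A cubic fixed point equation -/

namespace BlockSpin

section CubicFixedPoint

variable {E : Type*} [NormedAddCommGroup E] {f : E → E} {K R : ℝ}

/-- `f` satisfies the Lipschitz estimate of a homogeneous polynomial of degree three:
its Lipschitz constant on the ball of radius `M` is at most `K M²`. -/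
def CubicLipschitz (f : E → E) (K : ℝ) : Prop :=
  ∀ M x y, ‖x‖ ≤ M → ‖y‖ ≤ M → ‖f x - f y‖ ≤ K * M ^ 2 * ‖x - y‖

theorem CubicLipschitz.norm_le (hf : CubicLipschitz f K) (hf0 : f 0 = 0) (x : E) :
    ‖f x‖ ≤ K * ‖x‖ ^ 3 := by
  have h := hf ‖x‖ x 0 le_rfl (by simp)
  simp only [hf0, sub_zero] at h
  linarith [h, show K * ‖x‖ ^ 2 * ‖x‖ = K * ‖x‖ ^ 3 by ring]

theorem CubicLipschitz.half (hf : CubicLipschitz f K) (hKR : K * R ^ 2 ≤ 1 / 2) {x y : E}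
    (hx : ‖x‖ ≤ R) (hy : ‖y‖ ≤ R) : ‖f x - f y‖ ≤ 1 / 2 * ‖x - y‖ :=
  (hf R x y hx hy).trans (mul_le_mul_of_nonneg_right hKR (norm_nonneg _))

theorem CubicLipschitz.unique (hf : CubicLipschitz f K) (hKR : K * R ^ 2 ≤ 1 / 2) {b x y : E}
    (hx : ‖x‖ ≤ R) (hy : ‖y‖ ≤ R) (hxe : x = b + f x) (hye : y = b + f y) : x = y := by
  have h := hf.half hKR hx hy
  have h2 : x - y = f x - f y := by
    conv_lhs => rw [hxe, hye]
    abel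
  rw [← h2] at h
  have : ‖x - y‖ ≤ 0 := by linarith [norm_nonneg (x - y)]
  exact sub_eq_zero.1 (norm_le_zero_iff.1 this)

/-- The map `x ↦ b + f x` is a contraction of the ball of radius `2‖b‖` into itself. -/
theorem CubicLipschitz.exists_solution [CompleteSpace E] (hf : CubicLipschitz f K) (hf0 : f 0 = 0)
    (hK : 0 ≤ K) (hKR : K * R ^ 2 ≤ 1 / 2) {b : E} (hb : 2 * ‖b‖ ≤ R) :
    ∃ x, ‖x‖ ≤ 2 * ‖b‖ ∧ x = b + f x := by
  have hb0 := norm_nonneg b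
  have hKb : K * (2 * ‖b‖) ^ 2 ≤ 1 / 2 :=
    (mul_le_mul_of_nonneg_left (pow_le_pow_left₀ (by positivity) hb 2) hK).trans hKR
  have hmaps : Set.MapsTo (fun x => b + f x) (Metric.closedBall (0 : E) (2 * ‖b‖))
      (Metric.closedBall (0 : E) (2 * ‖b‖)) := by
    intro x hx
    rw [mem_closedBall_zero_iff] at hx ⊢
    have h := hf.half hKb hx (y := 0) (by simp)
    simp only [hf0, sub_zero] at h
    calc ‖b + f x‖ ≤ ‖b‖ + ‖f x‖ := norm_add_le _ _
      _ ≤ 2 * ‖b‖ := by linarith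
  have hcon : ContractingWith (1 / 2) (hmaps.restrict _ _ _) := by
    refine ⟨by norm_num, LipschitzWith.of_dist_le_mul fun x y => ?_⟩
    have hx := mem_closedBall_zero_iff.1 x.2
    have hy := mem_closedBall_zero_iff.1 y.2
    have h := hf.half hKb hx hy
    simpa [Subtype.dist_eq, dist_eq_norm] using h
  obtain ⟨y, hy, hfix, -⟩ := hcon.exists_fixedPoint' Metric.isClosed_closedBall.isComplete hmaps
    (x := 0) (by simp) (edist_ne_top _ _)
  exact ⟨y, mem_closedBall_zero_iff.1 hy, hfix.symm⟩

variable [NormedSpace ℂ E] [CompleteSpace E]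

/-- The small solution of `x = b + f x` depends analytically on `b`, because near each solution it
is given by the local inverse of `x ↦ x - f x`, whose derivative is invertible. -/
theorem CubicLipschitz.exists_analytic_solution (hf : CubicLipschitz f K) (hf0 : f 0 = 0)
    (hfa : AnalyticOnNhd ℂ f Set.univ) (hK : 0 ≤ K) (hKR : K * R ^ 2 ≤ 1 / 2) :
    ∃ G : E → E, AnalyticOnNhd ℂ G (Metric.ball 0 (R / 2)) ∧
      ∀ b ∈ Metric.ball (0 : E) (R / 2), ‖G b‖ ≤ 2 * ‖b‖ ∧ G b = b + f (G b) := by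
  choose! G hG using fun (b : E) (hb : 2 * ‖b‖ ≤ R) => hf.exists_solution hf0 hK hKR hb
  have hG' : ∀ b ∈ Metric.ball (0 : E) (R / 2), ‖G b‖ ≤ 2 * ‖b‖ ∧ G b = b + f (G b) := fun b hb =>
    hG b (by rw [mem_ball_zero_iff] at hb; linarith)
  refine ⟨G, fun b hb => ?_, hG'⟩
  obtain ⟨hx0, hxe⟩ := hG' b hb
  set x := G b with hx
  have hbn := mem_ball_zero_iff.1 hb
  have hxR : ‖x‖ < R := by linarith
  have hmem : Metric.ball (0 : E) R ∈ 𝓝 x := Metric.isOpen_ball.mem_nhds (mem_ball_zero_iff.2 hxR)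
  have hfx : HasFDerivAt f (fderiv ℂ f x) x := (hfa x trivial).differentiableAt.hasFDerivAt
  have hder : ‖fderiv ℂ f x‖ < 1 := by
    refine lt_of_le_of_lt (norm_fderiv_le_of_lip' ℂ (C := 1 / 2) (by norm_num) ?_) (by norm_num)
    filter_upwards [hmem] with y hy
    exact hf.half hKR (mem_ball_zero_iff.1 hy).le hxR.le
  let e : E ≃L[ℂ] E := ContinuousLinearEquiv.unitsEquiv ℂ E (Units.oneSub _ hder)
  have he : (e : E →L[ℂ] E) = ContinuousLinearMap.id ℂ E - fderiv ℂ f x := rfl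
  let g : E → E := fun y => y - f y
  have hga : ContDiffAt ℂ ⊤ g x := (analyticAt_id.sub (hfa x trivial)).contDiffAt
  have hg' : HasFDerivAt g (e : E →L[ℂ] E) x := by
    rw [he]
    exact (hasFDerivAt_id x).sub hfx
  have hgx : g x = b := by
    change x - f x = b
    nth_rewrite 1 [hxe]
    abel
  have htop : (⊤ : WithTop ℕ∞) ≠ 0 := by simp
  have hinv := hga.to_localInverse hg' htop
  have hinvx := hga.localInverse_apply_image hg' htop
  have hright : ∀ᶠ y in 𝓝 (g x), g (hga.localInverse hg' htop y) = y :=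
    (hga.toOpenPartialHomeomorph g hg' htop).eventually_right_inverse
      (hga.image_mem_toOpenPartialHomeomorph_target hg' htop)
  have hcont : ∀ᶠ y in 𝓝 (g x), hga.localInverse hg' htop y ∈ Metric.ball (0 : E) R := by
    refine hinv.continuousAt.eventually_mem ?_
    rwa [hinvx]
  rw [hgx] at hinv hright hcont
  have hana : AnalyticAt ℂ (hga.localInverse hg' htop) b := by
    have h := hinv.analyticAt
    exact h
  refine hana.congr ?_
  filter_upwards [hright, hcont, Metric.isOpen_ball.mem_nhds hb] with y hy hyR hyb
  obtain ⟨h1, h2⟩ := hG' y hyb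
  have hyn := mem_ball_zero_iff.1 hyb
  refine hf.unique hKR (mem_ball_zero_iff.1 hyR).le (by linarith) (b := y) ?_ h2
  have : hga.localInverse hg' htop y - f (hga.localInverse hg' htop y) = y := hy
  exact sub_eq_iff_eq_add.1 this

end CubicFixedPoint

end BlockSpin

/-! ### Block averaging preserves constants and the integral -/

namespace BlockSpin

open scoped ComplexOrder

/-- A matrix with nonnegative entries, row sums `1` and column sums `c`: as an operator it fixes
the constants, and it multiplies the sum of a field by `c`. -/
structure IsAveraging {α β : Type*} [Fintype α] [Fintype β] (c : ℝ) (M : Matrix α β ℂ) : Prop where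
  nonneg : ∀ i j, 0 ≤ M i j
  row : ∀ i, ∑ j, M i j = 1
  col : ∀ j, ∑ i, M i j = c

namespace IsAveraging

variable {α β γ : Type*} [Fintype α] [Fintype β] [Fintype γ] {c d : ℝ}

theorem one [DecidableEq α] : IsAveraging 1 (1 : Matrix α α ℂ) where
  nonneg i j := by
    rw [Matrix.one_apply]
    split_ifs <;> simp
  row i := by simp [Matrix.one_apply]
  col j := by simp [Matrix.one_apply]

theorem mul {M : Matrix α β ℂ} {M' : Matrix β γ ℂ} (h : IsAveraging c M) (h' : IsAveraging d M') :
    IsAveraging (c * d) (M * M') where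
  nonneg i j := Finset.sum_nonneg fun k _ => mul_nonneg (h.nonneg i k) (h'.nonneg k j)
  row i := by
    simp only [Matrix.mul_apply]
    rw [Finset.sum_comm]
    simp only [← Finset.mul_sum, h'.row, mul_one, h.row]
  col j := by
    simp only [Matrix.mul_apply]
    rw [Finset.sum_comm]
    simp only [← Finset.sum_mul, h.col]
    rw [← Finset.mul_sum, h'.col]
    push_cast
    ring

theorem norm_row {M : Matrix α β ℂ} (h : IsAveraging c M) (i : α) : ∑ j, ‖M i j‖ = 1 := by
  have h1 : ((∑ j, ‖M i j‖ : ℝ) : ℂ) = 1 := by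
    rw [← h.row i]
    push_cast
    exact Finset.sum_congr rfl fun j _ => Complex.eq_coe_norm_of_nonneg (h.nonneg i j) |>.symm
  exact_mod_cast h1

theorem norm_col {M : Matrix α β ℂ} (h : IsAveraging c M) (j : β) : ∑ i, ‖M i j‖ = c := by
  have h1 : ((∑ i, ‖M i j‖ : ℝ) : ℂ) = c := by
    rw [← h.col j]
    push_cast
    exact Finset.sum_congr rfl fun i _ => Complex.eq_coe_norm_of_nonneg (h.nonneg i j) |>.symm
  exact_mod_cast h1

theorem conjTranspose {M : Matrix α β ℂ} (h : IsAveraging c M) : M.conjTranspose = M.transpose := by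
  ext i j
  have := (Complex.nonneg_iff.1 (h.nonneg j i)).2
  simp only [Matrix.conjTranspose_apply, Matrix.transpose_apply]
  exact Complex.conj_eq_iff_im.2 this.symm

theorem mulVec_const {M : Matrix α β ℂ} (h : IsAveraging c M) (z : ℂ) :
    (M.mulVec fun _ => z) = fun _ => z := by
  ext i
  simp [Matrix.mulVec, dotProduct, ← Finset.sum_mul, h.row]

end IsAveraging

namespace Setup

variable (P : Setup)

theorem boxConv_nonneg (r : ℕ) (x : ℤ × (Fin 3 → ℤ)) : 0 ≤ P.boxConv r x := by
  induction r generalizing x with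
  | zero =>
    simp only [boxConv]
    split_ifs <;> norm_num
  | succ r ih => exact Finset.sum_nonneg fun y _ => ih _

theorem boxConv_support_finite (r : ℕ) : (Function.support (P.boxConv r)).Finite := by
  induction r with
  | zero =>
    refine (Set.finite_singleton (0 : ℤ × (Fin 3 → ℤ))).subset fun x hx => ?_
    by_contra h
    exact hx (if_neg h)
  | succ r ih =>
    refine (P.box.finite_toSet.biUnion fun b _ => ih.image (· + b)).subset fun x hx => ?_
    obtain ⟨b, hb, hne⟩ := Finset.exists_ne_zero_of_sum_ne_zero hx
    exact Set.mem_biUnion hb ⟨x - b, hne, sub_add_cancel x b⟩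

theorem summable_boxConv_mul (r : ℕ) (F : ℤ × (Fin 3 → ℤ) → ℝ) :
    Summable fun x => P.boxConv r x * F x :=
  summable_of_hasFiniteSupport ((P.boxConv_support_finite r).subset fun x hx h => hx (by simp [h]))

theorem tsum_boxConv_succ (r : ℕ) (F : ℤ × (Fin 3 → ℤ) → ℝ) :
    ∑' x, P.boxConv (r + 1) x * F x = ∑' x, P.boxConv r x * ∑ b ∈ P.box, F (x + b) := by
  have hs : ∀ b, ∑' x, P.boxConv r (x - b) * F x = ∑' x, P.boxConv r x * F (x + b) := by
    intro b
    rw [← (Equiv.addRight b).tsum_eq]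
    simp
  have hsum : ∀ b, Summable fun x => P.boxConv r (x - b) * F x := by
    intro b
    rw [← (Equiv.addRight b).summable_iff]
    simpa [Function.comp_def] using P.summable_boxConv_mul r fun x => F (x + b)
  simp only [boxConv, Finset.sum_mul, Finset.mul_sum]
  rw [Summable.tsum_finsetSum fun b _ => hsum b,
    Summable.tsum_finsetSum fun b _ => P.summable_boxConv_mul r fun x => F (x + b)]
  exact Finset.sum_congr rfl fun b _ => hs b

theorem L_pos : 0 < P.L := by
  have := P.three_le_L
  omega

theorem half_box (m : ℕ) (hm : Odd m) : (m : ℤ) = 2 * (((m : ℤ) - 1) / 2) + 1 := by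
  obtain ⟨c, rfl⟩ := hm
  push_cast
  omega

theorem card_box : P.box.card = P.L ^ 5 := by
  have h1 : ∀ m : ℕ, Odd m →
      (Finset.Icc (-(((m : ℤ) - 1) / 2)) (((m : ℤ) - 1) / 2)).card = m := by
    intro m hm
    have := half_box m hm
    rw [Int.card_Icc]
    omega
  have h2 := h1 (P.L ^ 2) P.odd_L.pow
  push_cast at h2
  simp only [box, Finset.card_product, Fintype.card_piFinset, Finset.prod_const, h1 P.L P.odd_L,
    h2, Finset.card_univ, Fintype.card_fin]
  ring

theorem tsum_boxConv (r : ℕ) : ∑' x, P.boxConv r x = ((P.L : ℝ) ^ 5) ^ r := by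
  induction r with
  | zero => simp [boxConv]
  | succ r ih =>
    have h := P.tsum_boxConv_succ r fun _ => 1
    simp only [mul_one, Finset.sum_const, card_box, nsmul_eq_mul, tsum_mul_right, ih] at h
    rw [h]
    push_cast
    ring

theorem prof_nonneg (x : ℤ × (Fin 3 → ℤ)) : 0 ≤ P.prof x :=
  mul_nonneg (by positivity) (P.boxConv_nonneg _ _)

theorem tsum_prof : ∑' x, P.prof x = 1 := by
  have : (P.L : ℝ) ≠ 0 := by exact_mod_cast P.L_pos.ne'
  simp only [prof, tsum_mul_left, tsum_boxConv]
  rw [← pow_mul]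
  field_simp

theorem summable_prof_mul (F : ℤ × (Fin 3 → ℤ) → ℝ) : Summable fun x => P.prof x * F x := by
  simp only [prof, mul_assoc]
  exact (P.summable_boxConv_mul _ F).mul_left _

theorem cls_add (k : ℕ) (x y : ℤ × (Fin 3 → ℤ)) : P.cls k (x + y) = P.cls k x + P.cls k y := by
  ext <;> simp [cls]

theorem nt_succ {k : ℕ} (hk : k + 1 ≤ P.N) : P.nt k = P.L ^ 2 * P.nt (k + 1) := by
  obtain ⟨d, hd⟩ := Nat.exists_eq_add_of_le hk
  have h1 : P.N - k = d + 1 := by omega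
  have h2 : P.N - (k + 1) = d := by omega
  rw [nt, nt, h1, h2]
  ring

theorem ns_succ {k : ℕ} (hk : k + 1 ≤ P.N) : P.ns k = P.L * P.ns (k + 1) := by
  obtain ⟨d, hd⟩ := Nat.exists_eq_add_of_le hk
  have h1 : P.N - k = d + 1 := by omega
  have h2 : P.N - (k + 1) = d := by omega
  rw [ns, ns, h1, h2]
  ring

/-- The block `[-(m-1)/2, (m-1)/2]` meets every residue class modulo the odd number `m`. -/
theorem exists_block_repr {m t M : ℕ} [NeZero t] [NeZero M] (hm : Odd m) (hM : M = m * t)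
    (w : ZMod M) : ∃ y : ZMod t, ∃ b ∈ Finset.Icc (-(((m : ℤ) - 1) / 2)) (((m : ℤ) - 1) / 2),
      (((m * y.val : ℕ) : ℤ) : ZMod M) + (b : ZMod M) = w := by
  have hh := half_box m hm
  set h := ((m : ℤ) - 1) / 2
  have hm0 : (0 : ℤ) < m := by exact_mod_cast hm.pos
  set c : ℤ := ((w.val : ℤ) + h) / m with hc
  have hdiv := Int.mul_ediv_add_emod ((w.val : ℤ) + h) m
  have hlt := Int.emod_lt_of_pos ((w.val : ℤ) + h) hm0
  have hge := Int.emod_nonneg ((w.val : ℤ) + h) hm0.ne'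
  refine ⟨(c : ZMod t), ((w.val : ℤ) + h) % m - h, by rw [Finset.mem_Icc]; omega, ?_⟩
  have hy : (((m * (c : ZMod t).val : ℕ) : ℤ) : ZMod M) = ((m * c : ℤ) : ZMod M) := by
    rw [ZMod.intCast_eq_intCast_iff_dvd_sub, hM]
    have : ((t : ℕ) : ℤ) ∣ c - ((c : ZMod t).val : ℤ) := by
      rw [← ZMod.intCast_eq_intCast_iff_dvd_sub]
      simp
    push_cast
    rw [← mul_sub]
    exact mul_dvd_mul_left _ this
  rw [hy, ← Int.cast_add]
  have : (m : ℤ) * c + (((w.val : ℤ) + h) % m - h) = (w.val : ℤ) := by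
    rw [hc]
    linarith
  rw [this]
  simp

/-- Every site lies in exactly one block: `y + [b]`, with `y` in the coarse lattice and `b` in the
block, runs once through the fine lattice. -/
theorem block_bijective {k : ℕ} (hk : k + 1 ≤ P.N) :
    Function.Bijective fun p : P.Lat (k + 1) × P.box =>
      P.incl (k + 1) k p.1 + P.cls k p.2.1 := by
  rw [Fintype.bijective_iff_surjective_and_card]
  constructor
  · rintro ⟨w0, w⟩
    obtain ⟨y0, b0, hb0, h0⟩ := exists_block_repr (P.odd_L.pow (n := 2)) (P.nt_succ hk) w0
    choose y b hb h using fun i => exists_block_repr P.odd_L (P.ns_succ hk) (w i)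
    refine ⟨((y0, y), ⟨(b0, b), ?_⟩), ?_⟩
    · rw [box, Finset.mem_product, Fintype.mem_piFinset]
      push_cast at hb0
      exact ⟨hb0, hb⟩
    · exact Prod.ext h0 (funext h)
  · have hb : Fintype.card P.box = P.L ^ 5 := by rw [Fintype.card_coe, card_box]
    simp only [Fintype.card_prod, hb, Lat, ZMod.card, Fintype.card_pi, Finset.prod_const,
      Finset.card_univ, Fintype.card_fin]
    rw [P.nt_succ hk, P.ns_succ hk]
    ring

theorem avg_eq_ofReal (k' k : ℕ) (y : P.Lat k') (u : P.Lat k) : P.avg k' k y u =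
    ((∑' x, P.prof x * (if P.incl k' k y + P.cls k x = u then 1 else 0) : ℝ) : ℂ) := by
  rw [avg, Complex.ofReal_tsum]
  refine tsum_congr fun x => ?_
  split_ifs <;> simp

/-- The row sums are the total mass of the profile. For the column sums one box in the convolution
is summed over first: together with the coarse lattice it covers the fine lattice exactly once. -/
theorem isAveraging_avg {k : ℕ} (hk : k + 1 ≤ P.N) :
    IsAveraging ((P.L : ℝ) ^ 5)⁻¹ (P.avg (k + 1) k) where
  nonneg y u := by
    rw [avg_eq_ofReal, Complex.zero_le_real]
    refine tsum_nonneg fun x => mul_nonneg (P.prof_nonneg x) ?_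
    split_ifs <;> norm_num
  row y := by
    simp only [avg_eq_ofReal]
    rw [← Complex.ofReal_sum, ← Summable.tsum_finsetSum fun u _ => P.summable_prof_mul _]
    simp [tsum_prof]
  col u := by
    simp only [avg_eq_ofReal]
    rw [← Complex.ofReal_sum, ← Summable.tsum_finsetSum fun u _ => P.summable_prof_mul _]
    congr 1
    have hL : (P.L : ℝ) ≠ 0 := by exact_mod_cast P.L_pos.ne'
    obtain ⟨r, hr⟩ : ∃ r, P.qexp = r + 1 := ⟨P.qexp - 1, by have := P.four_le_qexp; omega⟩
    have hone : ∀ x, ∑ b ∈ P.box, ∑ y : P.Lat (k + 1),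
        (if P.incl (k + 1) k y + P.cls k (x + b) = u then (1 : ℝ) else 0) = 1 := by
      intro x
      have heq : ∀ (y : P.Lat (k + 1)) (b : ℤ × (Fin 3 → ℤ)),
          P.incl (k + 1) k y + P.cls k (x + b) = u ↔
            P.incl (k + 1) k y + P.cls k b = u - P.cls k x := by
        intro y b
        rw [cls_add, eq_sub_iff_add_eq, add_comm (P.cls k x), add_assoc]
      have h := (P.block_bijective hk).sum_comp fun w => if w = u - P.cls k x then (1 : ℝ) else 0
      rw [Fintype.sum_prod_type_right] at h
      simp only [heq]
      rw [← Finset.sum_coe_sort P.box, h]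
      simp
    simp only [← Finset.mul_sum, prof, mul_assoc, tsum_mul_left]
    rw [hr, tsum_boxConv_succ]
    simp only [hone, mul_one, tsum_boxConv]
    rw [← pow_mul, show 5 * (r + 1) = 5 * r + 5 by ring, pow_add]
    field_simp

theorem isAveraging_Qn {n : ℕ} (hn : n ≤ P.N) : IsAveraging (((P.L : ℝ) ^ 5)⁻¹ ^ n) (P.Qn n) := by
  induction n with
  | zero => simpa [Qn] using IsAveraging.one
  | succ n ih =>
    rw [pow_succ']
    exact (P.isAveraging_avg hn).mul (ih (by omega))

end Setup

end BlockSpin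

/-! ### Supremum norm bounds for matrices -/

namespace BlockSpin

open scoped ComplexOrder

/-- `c` bounds the operator norm of `M` with respect to the supremum norms. -/
def BoundedBy {α β : Type*} [Fintype α] [Fintype β] (M : Matrix α β ℂ) (c : ℝ) : Prop :=
  ∀ v, ‖M.mulVec v‖ ≤ c * ‖v‖

section BoundedBy

variable {α β γ : Type*} [Fintype α] [Fintype β] [Fintype γ] {c d : ℝ}

theorem BoundedBy.of_rows {M : Matrix α β ℂ} (hc : 0 ≤ c) (h : ∀ i, ∑ j, ‖M i j‖ ≤ c) :
    BoundedBy M c := fun v => by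
  refine (pi_norm_le_iff_of_nonneg (by positivity)).2 fun i => ?_
  calc ‖M.mulVec v i‖ ≤ ∑ j, ‖M i j * v j‖ := norm_sum_le _ _
    _ ≤ ∑ j, ‖M i j‖ * ‖v‖ := Finset.sum_le_sum fun j _ => by
        rw [norm_mul]
        exact mul_le_mul_of_nonneg_left (norm_le_pi_norm v j) (norm_nonneg _)
    _ ≤ c * ‖v‖ := by
        rw [← Finset.sum_mul]
        exact mul_le_mul_of_nonneg_right (h i) (norm_nonneg _)

theorem BoundedBy.mono {M : Matrix α β ℂ} (h : BoundedBy M c) (hcd : c ≤ d) : BoundedBy M d :=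
  fun v => (h v).trans (mul_le_mul_of_nonneg_right hcd (norm_nonneg _))

theorem BoundedBy.one [DecidableEq α] : BoundedBy (1 : Matrix α α ℂ) 1 := fun v => by simp

theorem BoundedBy.mul {M : Matrix α β ℂ} {M' : Matrix β γ ℂ} (hc : 0 ≤ c) (h : BoundedBy M c)
    (h' : BoundedBy M' d) : BoundedBy (M * M') (c * d) := fun v => by
  rw [← Matrix.mulVec_mulVec, mul_assoc]
  exact (h _).trans (mul_le_mul_of_nonneg_left (h' v) hc)

theorem BoundedBy.add {M M' : Matrix α β ℂ} (h : BoundedBy M c) (h' : BoundedBy M' d) :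
    BoundedBy (M + M') (c + d) := fun v => by
  rw [Matrix.add_mulVec, add_mul]
  exact (norm_add_le _ _).trans (add_le_add (h v) (h' v))

theorem BoundedBy.smul {M : Matrix α β ℂ} (h : BoundedBy M c) (z : ℂ) :
    BoundedBy (z • M) (‖z‖ * c) := fun v => by
  rw [Matrix.smul_mulVec, norm_smul, mul_assoc]
  exact mul_le_mul_of_nonneg_left (h v) (norm_nonneg _)

theorem BoundedBy.sum {ι : Type*} (s : Finset ι) {M : ι → Matrix α β ℂ} {c : ι → ℝ}
    (h : ∀ i ∈ s, BoundedBy (M i) (c i)) : BoundedBy (∑ i ∈ s, M i) (∑ i ∈ s, c i) := fun v => by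
  rw [Matrix.sum_mulVec, Finset.sum_mul]
  exact (norm_sum_le _ _).trans (Finset.sum_le_sum fun i hi => h i hi v)

theorem IsAveraging.boundedBy {M : Matrix α β ℂ} (h : IsAveraging c M) : BoundedBy M 1 :=
  BoundedBy.of_rows zero_le_one fun i => (h.norm_row i).le

theorem IsAveraging.transpose_boundedBy {M : Matrix α β ℂ} (h : IsAveraging c M) (hc : 0 ≤ c) :
    BoundedBy M.transpose c :=
  BoundedBy.of_rows hc fun i => (h.norm_col i).le

variable [DecidableEq α]

/-- A square matrix bounded below is invertible. -/
theorem isUnit_of_le_mulVec {M : Matrix α α ℂ} (h : ∀ v, ‖v‖ ≤ c * ‖M.mulVec v‖) : IsUnit M := by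
  rw [← Matrix.mulVec_injective_iff_isUnit]
  intro v w hvw
  have h1 := h (v - w)
  have h2 : M.mulVec v = M.mulVec w := hvw
  rw [Matrix.mulVec_sub, h2, sub_self, norm_zero, mul_zero] at h1
  exact sub_eq_zero.1 (norm_le_zero_iff.1 h1)

theorem mulVec_inv_mulVec {M : Matrix α α ℂ} (h : IsUnit M) (v : α → ℂ) :
    M.mulVec (M⁻¹.mulVec v) = v := by
  rw [Matrix.mulVec_mulVec, Matrix.mul_nonsing_inv _ ((Matrix.isUnit_iff_isUnit_det _).1 h),
    Matrix.one_mulVec]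

theorem inv_mulVec_mulVec {M : Matrix α α ℂ} (h : IsUnit M) (v : α → ℂ) :
    M⁻¹.mulVec (M.mulVec v) = v := by
  rw [Matrix.mulVec_mulVec, Matrix.nonsing_inv_mul _ ((Matrix.isUnit_iff_isUnit_det _).1 h),
    Matrix.one_mulVec]

theorem BoundedBy.inv_of_le_mulVec {M : Matrix α α ℂ} (h : ∀ v, ‖v‖ ≤ c * ‖M.mulVec v‖) :
    BoundedBy M⁻¹ c := fun v => by
  have := h (M⁻¹.mulVec v)
  rwa [mulVec_inv_mulVec (isUnit_of_le_mulVec h)] at this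

/-- The resolvent bound: subtracting a scalar `μ` with `|μ| ‖A⁻¹‖ ≤ 1/2` at most doubles the
norm of the inverse. -/
theorem norm_le_mulVec_sub_smul {A : Matrix α α ℂ} (hA : IsUnit A) (hAc : BoundedBy A⁻¹ c)
    (hc : 0 ≤ c) {μ : ℂ} (hμ : ‖μ‖ * c ≤ 1 / 2) (v : α → ℂ) :
    ‖v‖ ≤ 2 * c * ‖(A - μ • (1 : Matrix α α ℂ)).mulVec v‖ := by
  have h1 := hAc (A.mulVec v)
  rw [inv_mulVec_mulVec hA] at h1
  set w := (A - μ • (1 : Matrix α α ℂ)).mulVec v with hw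
  have h2 : A.mulVec v = w + μ • v := by
    rw [hw, Matrix.sub_mulVec, Matrix.smul_mulVec, Matrix.one_mulVec]
    abel
  have h3 : ‖A.mulVec v‖ ≤ ‖w‖ + ‖μ‖ * ‖v‖ := by
    rw [h2, ← norm_smul]
    exact norm_add_le _ _
  have h4 := mul_le_mul_of_nonneg_left h3 hc
  have h5 := mul_le_mul_of_nonneg_right hμ (norm_nonneg v)
  nlinarith

end BoundedBy

/-! ### The operators `𝔔_n` -/

namespace Setup

variable (P : Setup)

theorem L_ne_zero : (P.L : ℂ) ≠ 0 := by exact_mod_cast P.L_pos.ne'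

theorem norm_L_zpow (k : ℤ) : ‖(P.L : ℂ) ^ k‖ = (P.L : ℝ) ^ k := by simp

theorem adj_mul (j j' j'' : ℤ) {k k' k'' : ℕ} (M : Matrix (P.Lat k'') (P.Lat k') ℂ)
    (M' : Matrix (P.Lat k') (P.Lat k) ℂ) :
    P.adj j j'' (M * M') = P.adj j j' M' * P.adj j' j'' M := by
  simp only [adj, Matrix.transpose_mul, Matrix.smul_mul, Matrix.mul_smul, smul_smul]
  rw [← zpow_add₀ P.L_ne_zero]
  congr 2
  ring

theorem boundedBy_adj (j j' : ℤ) {k k' : ℕ} {M : Matrix (P.Lat k') (P.Lat k) ℂ} {c : ℝ}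
    (h : IsAveraging c M) (hc : 0 ≤ c) (hcj : (P.L : ℝ) ^ (5 * (j - j')) * c ≤ 1) :
    BoundedBy (P.adj j j' M) 1 := by
  have := (h.transpose_boundedBy hc).smul ((P.L : ℂ) ^ (5 * (j - j')))
  rw [norm_L_zpow] at this
  exact this.mono hcj

theorem zpow_mul_inv_pow (j : ℕ) : (P.L : ℝ) ^ (5 * ((j : ℤ) - 0)) * ((P.L : ℝ) ^ 5)⁻¹ ^ j = 1 := by
  have hL : (P.L : ℝ) ≠ 0 := by exact_mod_cast P.L_pos.ne'
  have h : (P.L : ℝ) ^ (5 * ((j : ℤ) - 0)) = ((P.L : ℝ) ^ 5) ^ j := by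
    rw [sub_zero, ← pow_mul]
    exact_mod_cast rfl
  rw [h, ← mul_pow, mul_inv_cancel₀ (pow_ne_zero _ hL), one_pow]

theorem isAveraging_avg' {k k' : ℕ} (h : k' = k + 1) (hk : k' ≤ P.N) :
    IsAveraging ((P.L : ℝ) ^ 5)⁻¹ (P.avg k' k) := by
  subst h
  exact P.isAveraging_avg hk

theorem isAveraging_Qsub {n : ℕ} (hn : n ≤ P.N) (j : ℕ) (hj : j ≤ n) :
    IsAveraging (((P.L : ℝ) ^ 5)⁻¹ ^ j) (P.Qsub n j) := by
  induction j with
  | zero => simpa [Qsub] using IsAveraging.one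
  | succ j ih =>
    rw [pow_succ]
    exact (ih (by omega)).mul (P.isAveraging_avg' (by omega) (by omega))

theorem boundedBy_Qn {n : ℕ} (hn : n ≤ P.N) : BoundedBy (P.Qn n) 1 :=
  (P.isAveraging_Qn hn).boundedBy

theorem boundedBy_adj_Qn {n : ℕ} (hn : n ≤ P.N) : BoundedBy (P.adj n 0 (P.Qn n)) 1 :=
  P.boundedBy_adj _ _ (P.isAveraging_Qn hn) (by positivity) (P.zpow_mul_inv_pow n).le

theorem boundedBy_Q {n : ℕ} (hn : n + 1 ≤ P.N) : BoundedBy (P.Q n) 1 :=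
  (P.isAveraging_avg hn).boundedBy

theorem boundedBy_Qadj {n : ℕ} (hn : n + 1 ≤ P.N) : BoundedBy (P.Qadj n) 1 := by
  refine P.boundedBy_adj _ _ (P.isAveraging_avg hn) (by positivity) (le_of_eq ?_)
  simpa using P.zpow_mul_inv_pow 1

/-- `Q_j Q_j^*` on `ℋ_0^{(n)}` -/
noncomputable def QsubSq (n j : ℕ) : Matrix (P.Lat n) (P.Lat n) ℂ :=
  P.Qsub n j * P.adj j 0 (P.Qsub n j)

/-- `a 𝔔_n⁻¹ = 1 + ∑_{j=1}^{n-1} L^{-2j} Q_j Q_j^*` -/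
noncomputable def invfQ (n : ℕ) : Matrix (P.Lat n) (P.Lat n) ℂ :=
  1 + ∑ j ∈ Finset.Ico 1 n, ((P.L : ℂ) ^ (2 * j))⁻¹ • P.QsubSq n j

theorem fQ_eq (n : ℕ) : P.fQ n = (P.a : ℂ) • (P.invfQ n)⁻¹ := rfl

theorem boundedBy_QsubSq {n : ℕ} (hn : n ≤ P.N) {j : ℕ} (hj : j ≤ n) :
    BoundedBy (P.QsubSq n j) 1 := by
  have h := P.isAveraging_Qsub hn j hj
  simpa [QsubSq] using h.boundedBy.mul zero_le_one
    (P.boundedBy_adj j 0 h (by positivity) (P.zpow_mul_inv_pow j).le)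

theorem three_le_L_real : (3 : ℝ) ≤ P.L := by exact_mod_cast P.three_le_L

theorem inv_L_sq_le : ((P.L : ℝ) ^ 2)⁻¹ ≤ 1 / 9 := by
  have := P.three_le_L_real
  rw [one_div]
  exact inv_anti₀ (by norm_num) (by nlinarith)

/-- Since `L² ≥ 9`, the sum is bounded by a geometric series: `∑_{j ≥ 1} 9^{-j} = 1/8`. -/
theorem boundedBy_invfQ_sub_one {n : ℕ} (hn : n ≤ P.N) : BoundedBy (P.invfQ n - 1) (1 / 8) := by
  have h1 : BoundedBy (P.invfQ n - 1) (∑ j ∈ Finset.Ico 1 n, (1 / 9 : ℝ) ^ j) := by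
    rw [invfQ, add_sub_cancel_left]
    refine BoundedBy.sum _ fun j hj => ?_
    refine ((P.boundedBy_QsubSq hn (Finset.mem_Ico.1 hj).2.le).smul _).mono ?_
    rw [mul_one, norm_inv, norm_pow, Complex.norm_natCast, pow_mul, ← inv_pow]
    exact pow_le_pow_left₀ (by positivity) P.inv_L_sq_le j
  refine h1.mono ?_
  have h2 : ∀ m : ℕ, ∑ j ∈ Finset.Ico 1 (m + 1), (1 / 9 : ℝ) ^ j = 1 / 8 * (1 - (1 / 9) ^ m) := by
    intro m
    induction m with
    | zero => simp
    | succ m ih =>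
      rw [Finset.sum_Ico_succ_top (by omega), ih]
      ring
  cases n with
  | zero => simp
  | succ m =>
    rw [h2]
    have : (0 : ℝ) ≤ (1 / 9) ^ m := by positivity
    linarith

theorem boundedBy_invfQ {n : ℕ} (hn : n ≤ P.N) : BoundedBy (P.invfQ n) (9 / 8) := by
  have := BoundedBy.one.add (P.boundedBy_invfQ_sub_one hn)
  rw [add_sub_cancel] at this
  exact this.mono (by norm_num)

theorem norm_le_invfQ {n : ℕ} (hn : n ≤ P.N) (v : P.Fld n) :
    ‖v‖ ≤ 2 * ‖(P.invfQ n).mulVec v‖ := by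
  have h1 := P.boundedBy_invfQ_sub_one hn v
  have h2 : v = (P.invfQ n).mulVec v - (P.invfQ n - 1).mulVec v := by
    rw [Matrix.sub_mulVec, Matrix.one_mulVec]
    abel
  have h3 := norm_sub_le ((P.invfQ n).mulVec v) ((P.invfQ n - 1).mulVec v)
  rw [← h2] at h3
  linarith [norm_nonneg v]

theorem isUnit_invfQ {n : ℕ} (hn : n ≤ P.N) : IsUnit (P.invfQ n) :=
  isUnit_of_le_mulVec (P.norm_le_invfQ hn)

theorem boundedBy_fQ {n : ℕ} (hn : n ≤ P.N) : BoundedBy (P.fQ n) (2 * P.a) := by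
  have := (BoundedBy.inv_of_le_mulVec (P.norm_le_invfQ hn)).smul (P.a : ℂ)
  rw [Complex.norm_real, Real.norm_eq_abs, abs_of_pos P.a_pos, mul_comm] at this
  exact this

theorem invfQ_mulVec_fQ_mulVec {n : ℕ} (hn : n ≤ P.N) (v : P.Fld n) :
    (P.invfQ n).mulVec ((P.fQ n).mulVec v) = (P.a : ℂ) • v := by
  rw [fQ_eq, Matrix.smul_mulVec, Matrix.mulVec_smul, mulVec_inv_mulVec (P.isUnit_invfQ hn)]

theorem transpose_invfQ (n : ℕ) : (P.invfQ n).transpose = P.invfQ n := by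
  simp [invfQ, QsubSq, adj, Matrix.transpose_sum, Matrix.transpose_mul]

theorem transpose_fQ (n : ℕ) : (P.fQ n).transpose = P.fQ n := by
  rw [fQ_eq, Matrix.transpose_smul, Matrix.transpose_nonsing_inv, transpose_invfQ]

theorem posDef_fQ {n : ℕ} (hn : n ≤ P.N) : (P.fQ n).PosDef := by
  have ha : (0 : ℂ) < (P.a : ℂ) := by exact_mod_cast P.a_pos
  rw [fQ_eq]
  refine Matrix.PosDef.smul (Matrix.PosDef.inv ?_) ha
  refine Matrix.PosDef.one.add_posSemidef (Matrix.posSemidef_sum _ fun j hj => ?_)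
  have hL : (0 : ℂ) ≤ (P.L : ℂ) := by exact_mod_cast P.L_pos.le
  have hav := P.isAveraging_Qsub hn j (Finset.mem_Ico.1 hj).2.le
  rw [QsubSq, adj, ← hav.conjTranspose, Matrix.mul_smul]
  refine ((Matrix.posSemidef_self_mul_conjTranspose _).smul ?_).smul ?_
  · have : (0 : ℝ) ≤ (P.L : ℝ) ^ (5 * ((j : ℤ) - 0)) := by positivity
    simpa using Complex.zero_le_real.2 this
  · simp

/-- `Q_j`, with the index `k = n - j` of its source as a variable -/
noncomputable def Qto (n j k : ℕ) (h : n - j = k) : Matrix (P.Lat n) (P.Lat k) ℂ := h ▸ P.Qsub n j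

theorem Qto_succ_right {n j k k' : ℕ} (h : n - (j + 1) = k) (h' : n - j = k') :
    P.Qto n (j + 1) k h = P.Qto n j k' h' * P.avg k' k := by
  subst h h'
  rfl

theorem Qto_succ_left (n j k : ℕ) (h : n + 1 - (j + 1) = k) (h' : n - j = k) :
    P.Qto (n + 1) (j + 1) k h = P.Q n * P.Qto n j k h' := by
  induction j generalizing k with
  | zero =>
    obtain rfl : n = k := by omega
    have h1 : P.Qto n 0 n h' = 1 := rfl
    have h2 : P.Qto (n + 1) 0 (n + 1) rfl = 1 := rfl
    rw [P.Qto_succ_right (k' := n + 1) h rfl, h1, h2, Matrix.one_mul, Matrix.mul_one]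
    rfl
  | succ j ih =>
    rw [P.Qto_succ_right (k' := n - j) h (by omega), ih (n - j) (by omega) rfl,
      P.Qto_succ_right _ rfl, Matrix.mul_assoc]

theorem QsubSq_eq_Qto {n j k : ℕ} (h : n - j = k) :
    P.QsubSq n j = P.Qto n j k h * P.adj j 0 (P.Qto n j k h) := by
  subst h
  rfl

theorem QsubSq_succ (n j : ℕ) : P.QsubSq (n + 1) (j + 1) = P.Q n * P.QsubSq n j * P.Qadj n := by
  rw [P.QsubSq_eq_Qto (k := n - j) (by omega), P.QsubSq_eq_Qto (n := n) rfl,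
    P.Qto_succ_left n j _ _ rfl, P.adj_mul _ 1 _]
  have h : P.adj ((j + 1 : ℕ) : ℤ) 1 (P.Qto n j (n - j) rfl)
      = P.adj (j : ℤ) 0 (P.Qto n j (n - j) rfl) := by
    simp [adj]
  have h' : P.adj 1 0 (P.Q n) = P.Qadj n := rfl
  rw [h, h']
  simp only [Matrix.mul_assoc]

/-- The recursion for `𝔔_n` that integrating out one block spin step produces:
`a 𝔔_{n+1}⁻¹ = 1 + L^{-2} Q (a 𝔔_n⁻¹) Q^*`. -/
theorem invfQ_succ {n : ℕ} (hn : 1 ≤ n) :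
    P.invfQ (n + 1) = 1 + ((P.L : ℂ) ^ 2)⁻¹ • (P.Q n * P.invfQ n * P.Qadj n) := by
  have h0 : P.QsubSq n 0 = 1 := by simp [QsubSq, Qsub, adj]
  have h1 : P.invfQ n = ∑ j ∈ Finset.range n, ((P.L : ℂ) ^ (2 * j))⁻¹ • P.QsubSq n j := by
    rw [Finset.range_eq_Ico, Finset.sum_eq_sum_Ico_succ_bot (by omega), h0, invfQ]
    simp
  rw [h1, invfQ, Finset.sum_Ico_eq_sum_range, Nat.add_sub_cancel, Matrix.mul_sum, Matrix.sum_mul,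
    Finset.smul_sum]
  congr 1
  refine Finset.sum_congr rfl fun j _ => ?_
  rw [add_comm 1 j, QsubSq_succ, Matrix.mul_smul, Matrix.smul_mul, smul_smul, ← mul_inv, ← pow_add]
  congr 3
  ring

end Setup

end BlockSpin

/-! ### Invertibility of `D_n + Q_n^* 𝔔_n Q_n` -/

namespace BlockSpin

open scoped ComplexOrder

section Exponential

attribute [local instance] Matrix.linftyOpNormedRing Matrix.linftyOpNormedAlgebra

theorem exp_mulVec_of_mulVec_eq_smul {α : Type*} [Fintype α] [DecidableEq α] {A : Matrix α α ℂ}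
    {v : α → ℂ} {z : ℂ} (h : A.mulVec v = z • v) :
    (NormedSpace.exp A).mulVec v = Complex.exp z • v := by
  have hpow : ∀ n : ℕ, (A ^ n).mulVec v = z ^ n • v := by
    intro n
    induction n with
    | zero => simp
    | succ n ih => rw [pow_succ, ← Matrix.mulVec_mulVec, h, Matrix.mulVec_smul, ih, smul_smul,
        pow_succ, mul_comm]
  have h1 := (NormedSpace.exp_series_hasSum_exp' (𝕂 := ℂ) A).map (Matrix.mulVec.addMonoidHomLeft v)
    (by
      change Continuous fun M : Matrix α α ℂ => M.mulVec v
      fun_prop)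
  have h2 := (NormedSpace.exp_series_hasSum_exp' (𝕂 := ℂ) z).smul_const v
  rw [← Complex.exp_eq_exp_ℂ] at h2
  refine h1.unique ?_
  convert h2 using 2 with n
  simp [Matrix.mulVec.addMonoidHomLeft, Matrix.smul_mulVec, hpow, smul_smul]

end Exponential

theorem Kinetic.ker_neg (κ : Kinetic) (z : Fin 3 → ℤ) : κ.ker (-z) = κ.ker z := by
  rw [← κ.reflect 0 z, ← κ.reflect 1 (Function.update z 0 (-z 0)),
    ← κ.reflect 2 (Function.update (Function.update z 0 (-z 0)) 1 _)]
  congr 1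
  ext i
  fin_cases i <;> simp [Function.update]

namespace Setup

variable (P : Setup)

/-- The phases `p_i` with `χ(0, e_i) = e^{i p_i}`: the spatial momentum of a character. -/
noncomputable def momentum (χ : AddChar (P.Lat 0) ℂ) (i : Fin 3) : ℝ :=
  (χ (0, Pi.single i 1)).arg

/-- the eigenvalue of `h₀` on the character `χ` -/
noncomputable def kinEig (χ : AddChar (P.Lat 0) ℂ) : ℝ :=
  ∑' z : Fin 3 → ℤ, P.kin.ker z * Real.cos (∑ i, P.momentum χ i * z i)

theorem char_space (χ : AddChar (P.Lat 0) ℂ) (z : Fin 3 → ℤ) :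
    χ (0, fun i => (z i : ZMod (P.ns 0))) =
      Complex.exp (((∑ i, P.momentum χ i * z i : ℝ) : ℂ) * Complex.I) := by
  have h1 : ((0, fun i => (z i : ZMod (P.ns 0))) : P.Lat 0) =
      ∑ i, z i • ((0, Pi.single i 1) : P.Lat 0) := by
    refine Prod.ext (by simp [Prod.fst_sum]) ?_
    ext i
    simp [Prod.snd_sum, Finset.sum_apply, Pi.single_apply]
  have h2 : ∀ i, χ (0, Pi.single i 1) = Complex.exp ((P.momentum χ i : ℂ) * Complex.I) := by
    intro i
    have := Complex.norm_mul_exp_arg_mul_I (χ (0, Pi.single i 1))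
    rw [AddChar.norm_apply, Complex.ofReal_one, one_mul] at this
    exact this.symm
  rw [h1, Fin.sum_univ_three, Fin.sum_univ_three]
  simp only [AddChar.map_add_eq_mul, AddChar.map_zsmul_eq_zpow, h2, ← Complex.exp_int_mul,
    ← Complex.exp_add]
  congr 1
  push_cast
  ring

theorem hMat_mulVec_char (χ : AddChar (P.Lat 0) ℂ) :
    P.hMat.mulVec χ = (P.kinEig χ : ℂ) • (χ : P.Fld 0) := by
  have hs : ∀ g : (Fin 3 → ℤ) → ℂ, (∀ z, ‖g z‖ ≤ 1) →
      Summable fun z => (P.kin.ker z : ℂ) * g z := by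
    intro g hg
    refine Summable.of_norm_bounded P.kin.summable_ker.norm fun z => ?_
    rw [norm_mul, Complex.norm_real]
    exact mul_le_of_le_one_right (norm_nonneg _) (hg z)
  set θ : (Fin 3 → ℤ) → ℝ := fun z => ∑ i, P.momentum χ i * z i with hθ
  have hθneg : ∀ z, θ (-z) = -θ z := by
    intro z
    simp [hθ, Finset.sum_neg_distrib]
  -- the kernel is even, so only the cosine part of the exponential survives
  have heig : ∑' z, (P.kin.ker z : ℂ) * Complex.exp (((-θ z : ℝ) : ℂ) * Complex.I)
      = P.kinEig χ := by
    have hexp : ∀ t : ℝ, ‖Complex.exp ((t : ℂ) * Complex.I)‖ ≤ 1 := fun t =>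
      (Complex.norm_exp_ofReal_mul_I t).le
    have h1 := hs _ fun z => hexp (-θ z)
    have h2 := hs _ fun z => hexp (θ z)
    have h3 : ∑' z, (P.kin.ker z : ℂ) * Complex.exp (((-θ z : ℝ) : ℂ) * Complex.I) =
        ∑' z, (P.kin.ker z : ℂ) * Complex.exp ((θ z : ℂ) * Complex.I) := by
      rw [← (Equiv.neg (Fin 3 → ℤ)).tsum_eq]
      simp [hθneg, Kinetic.ker_neg]
    have h4 : (2 : ℂ) * ∑' z, (P.kin.ker z : ℂ) * Complex.exp (((-θ z : ℝ) : ℂ) * Complex.I) =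
        2 * P.kinEig χ := by
      rw [two_mul]
      nth_rewrite 2 [h3]
      rw [← h1.tsum_add h2, kinEig, Complex.ofReal_tsum, ← tsum_mul_left]
      refine tsum_congr fun z => ?_
      change _ = 2 * ((P.kin.ker z * Real.cos (θ z) : ℝ) : ℂ)
      rw [← mul_add, Complex.ofReal_mul, Complex.ofReal_cos, mul_left_comm, Complex.two_cos,
        Complex.ofReal_neg, add_comm]
    exact mul_left_cancel₀ two_ne_zero h4
  ext x
  simp only [Matrix.mulVec, dotProduct, hMat, Pi.smul_apply, smul_eq_mul]
  have hterm : ∀ y : P.Lat 0, (if x.1 = y.1 then ∑' z : Fin 3 → ℤ,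
      if (fun i => (z i : ZMod (P.ns 0))) = x.2 - y.2 then (P.kin.ker z : ℂ) else 0 else 0) * χ y =
      ∑' z : Fin 3 → ℤ, (P.kin.ker z : ℂ) *
        if y = x - (0, fun i => (z i : ZMod (P.ns 0))) then χ y else 0 := by
    intro y
    have hy : ∀ z : Fin 3 → ℤ, y = x - (0, fun i => (z i : ZMod (P.ns 0))) ↔
        x.1 = y.1 ∧ (fun i => (z i : ZMod (P.ns 0))) = x.2 - y.2 := by
      intro z
      rw [Prod.ext_iff, Prod.fst_sub, Prod.snd_sub, sub_zero, eq_comm, eq_sub_iff_add_eq',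
        eq_sub_iff_add_eq]
    split_ifs with h
    · rw [← tsum_mul_right]
      refine tsum_congr fun z => ?_
      simp [hy, h]
    · simp [hy, h]
  simp only [hterm]
  rw [← Summable.tsum_finsetSum fun y _ => hs _ fun z => ?_]
  · rw [← heig, ← tsum_mul_right]
    refine tsum_congr fun z => ?_
    rw [← Finset.mul_sum, Finset.sum_ite_eq' Finset.univ, if_pos (Finset.mem_univ _), mul_assoc]
    congr 1
    have hz := P.char_space χ (-z)
    rw [hθ, ← hθneg z] at *
    rw [sub_eq_add_neg, AddChar.map_add_eq_mul, mul_comm, ← hz]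
    congr 2
    ext <;> simp
  · split_ifs <;> simp

/-- the eigenvalue of `D_0` on the character `χ` -/
noncomputable def D0Eig (χ : AddChar (P.Lat 0) ℂ) : ℂ :=
  1 - Complex.exp (-(P.kinEig χ : ℂ)) * χ (1, 0)

theorem D0_mulVec_char (χ : AddChar (P.Lat 0) ℂ) :
    P.D0.mulVec χ = P.D0Eig χ • (χ : P.Fld 0) := by
  have hexp : (NormedSpace.exp (-P.hMat)).mulVec χ =
      Complex.exp (-(P.kinEig χ : ℂ)) • (χ : P.Fld 0) :=
    exp_mulVec_of_mulVec_eq_smul (by rw [Matrix.neg_mulVec, hMat_mulVec_char, neg_smul])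
  have hdt : P.dt.mulVec χ = (χ (1, 0) - 1) • (χ : P.Fld 0) := by
    ext x
    have : (x.1 + 1, x.2) = x + ((1, 0) : P.Lat 0) := by ext <;> simp
    simp only [Matrix.mulVec, dotProduct, dt, sub_mul, ite_mul, one_mul, zero_mul,
      Finset.sum_sub_distrib, Finset.sum_ite_eq', Finset.mem_univ, if_true, Pi.smul_apply,
      smul_eq_mul, this, AddChar.map_add_eq_mul]
    ring
  rw [D0, Matrix.sub_mulVec, Matrix.sub_mulVec, Matrix.one_mulVec, hexp, ← Matrix.mulVec_mulVec,
    hdt, Matrix.mulVec_smul, hexp, D0Eig]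
  ext x
  simp only [Pi.sub_apply, Pi.smul_apply, smul_eq_mul]
  ring

/-- The eigenvalue is `1 - e^{-λ} e^{i p₀}` with `λ ≥ 0`, so its real part is nonnegative and
vanishes only if `λ = 0` and `e^{i p₀} = 1`, that is, at the trivial character. -/
theorem re_D0Eig_nonneg (χ : AddChar (P.Lat 0) ℂ) : 0 ≤ (P.D0Eig χ).re ∧
    ((P.D0Eig χ).re = 0 → χ = 0) := by
  have hlam : 0 ≤ P.kinEig χ := P.kin.fourier_nonneg _
  have hre : (P.D0Eig χ).re = 1 - Real.exp (-P.kinEig χ) * (χ (1, 0)).re := by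
    rw [D0Eig, ← Complex.ofReal_neg, ← Complex.ofReal_exp, Complex.sub_re, Complex.re_ofReal_mul,
      Complex.one_re]
  have hnorm : ‖χ (1, 0)‖ = 1 := AddChar.norm_apply _ _
  have hle : (χ (1, 0)).re ≤ 1 := (Complex.re_le_norm _).trans hnorm.le
  have hexp : Real.exp (-P.kinEig χ) ≤ 1 := Real.exp_le_one_iff.2 (by linarith)
  have hpos := Real.exp_pos (-P.kinEig χ)
  rw [hre]
  refine ⟨by nlinarith, fun h => ?_⟩
  have hexp1 : Real.exp (-P.kinEig χ) = 1 := by nlinarith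
  have hre1 : (χ (1, 0)).re = 1 := by
    rw [hexp1] at h
    linarith
  have hlam0 : P.kinEig χ = 0 := by
    have := (Real.exp_eq_one_iff _).1 hexp1
    linarith
  have htime : χ (1, 0) = 1 := by
    have him : (χ (1, 0)).im = 0 := by
      have := Complex.sq_norm (χ (1, 0))
      rw [hnorm, Complex.normSq_apply, hre1] at this
      nlinarith
    exact Complex.ext hre1 him
  obtain hp := (P.kin.fourier_zero_iff (P.momentum χ)).1 hlam0
  ext ⟨s, w⟩
  have hs : ((s, w) : P.Lat 0) = s.val • ((1, 0) : P.Lat 0) +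
      (0, fun i => (((w i).val : ℤ) : ZMod (P.ns 0))) := by
    ext <;> simp
  have hspace : χ (0, fun i => (((w i).val : ℤ) : ZMod (P.ns 0))) = 1 := by
    rw [P.char_space χ fun i => ((w i).val : ℤ), Complex.exp_eq_one_iff]
    choose m hm using hp
    refine ⟨∑ i, m i * ((w i).val : ℤ), ?_⟩
    push_cast
    rw [Finset.sum_mul, Finset.sum_mul]
    refine Finset.sum_congr rfl fun i _ => ?_
    rw [hm i]
    push_cast
    ring
  rw [hs, AddChar.map_add_eq_mul, AddChar.map_nsmul_eq_pow, htime, hspace]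
  simp

/-- Parseval's identity for `D_0` in the basis of characters. -/
theorem star_dotProduct_D0 (φ : P.Fld 0) : star φ ⬝ᵥ P.D0.mulVec φ =
    ∑ χ, (Fintype.card (P.Lat 0) : ℂ) *
      ((‖(AddChar.complexBasis (P.Lat 0)).repr φ χ‖ : ℂ) ^ 2 * P.D0Eig χ) := by
  set c := (AddChar.complexBasis (P.Lat 0)).repr φ with hc
  have hφ : φ = ∑ χ, c χ • (χ : P.Fld 0) := by
    conv_lhs => rw [← (AddChar.complexBasis (P.Lat 0)).sum_repr φ]
    simp [AddChar.complexBasis_apply, hc]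
  have horth : ∀ χ χ' : AddChar (P.Lat 0) ℂ, star (χ : P.Fld 0) ⬝ᵥ (χ' : P.Fld 0) =
      if χ = χ' then (Fintype.card (P.Lat 0) : ℂ) else 0 := by
    intro χ χ'
    have : star (χ : P.Fld 0) ⬝ᵥ (χ' : P.Fld 0) = ∑ x, (χ' - χ) x := by
      refine Finset.sum_congr rfl fun x _ => ?_
      rw [AddChar.sub_apply, AddChar.map_neg_eq_conj, mul_comm]
      rfl
    rw [this, AddChar.sum_eq_ite]
    simp only [sub_eq_zero, eq_comm]
  have hD : P.D0.mulVec φ = ∑ χ, (c χ * P.D0Eig χ) • (χ : P.Fld 0) := by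
    conv_lhs => rw [hφ]
    simp only [Matrix.mulVec_sum, Matrix.mulVec_smul, D0_mulVec_char, smul_smul]
  rw [hD]
  conv_lhs => rw [hφ]
  simp only [star_sum, sum_dotProduct, dotProduct_sum, star_smul, smul_dotProduct, dotProduct_smul,
    horth, smul_eq_mul, mul_ite, mul_zero, Finset.sum_ite_eq', Finset.mem_univ, if_true]
  refine Finset.sum_congr rfl fun χ _ => ?_
  rw [← Complex.mul_conj']
  simp only [RCLike.star_def]
  ring

/-- The real part of `D_0` is nonnegative, and it vanishes on the constants only. -/
theorem re_star_dotProduct_D0 (φ : P.Fld 0) : 0 ≤ (star φ ⬝ᵥ P.D0.mulVec φ).re ∧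
    ((star φ ⬝ᵥ P.D0.mulVec φ).re = 0 → ∃ z, φ = fun _ => z) := by
  have hterm : ∀ χ, ((Fintype.card (P.Lat 0) : ℂ) *
      ((‖(AddChar.complexBasis (P.Lat 0)).repr φ χ‖ : ℂ) ^ 2 * P.D0Eig χ)).re =
      Fintype.card (P.Lat 0) *
        (‖(AddChar.complexBasis (P.Lat 0)).repr φ χ‖ ^ 2 * (P.D0Eig χ).re) := by
    intro χ
    rw [← Complex.ofReal_natCast, Complex.re_ofReal_mul, ← Complex.ofReal_pow,
      Complex.re_ofReal_mul]
  rw [star_dotProduct_D0, Complex.re_sum]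
  simp only [hterm]
  have hnn : ∀ χ ∈ Finset.univ, (0 : ℝ) ≤ Fintype.card (P.Lat 0) *
      (‖(AddChar.complexBasis (P.Lat 0)).repr φ χ‖ ^ 2 * (P.D0Eig χ).re) := fun χ _ =>
    mul_nonneg (Nat.cast_nonneg _) (mul_nonneg (sq_nonneg _) (P.re_D0Eig_nonneg χ).1)
  refine ⟨Finset.sum_nonneg hnn, fun h => ?_⟩
  rw [Finset.sum_eq_zero_iff_of_nonneg hnn] at h
  have hc : ∀ χ, χ ≠ 0 → (AddChar.complexBasis (P.Lat 0)).repr φ χ = 0 := by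
    intro χ hχ
    have h1 := h χ (Finset.mem_univ _)
    have hcard : (Fintype.card (P.Lat 0) : ℝ) ≠ 0 := by exact_mod_cast Fintype.card_ne_zero
    have h2 : (P.D0Eig χ).re ≠ 0 := fun h' => hχ ((P.re_D0Eig_nonneg χ).2 h')
    rcases mul_eq_zero.1 ((mul_eq_zero.1 h1).resolve_left hcard) with h3 | h3
    · exact norm_eq_zero.1 (pow_eq_zero_iff two_ne_zero |>.1 h3)
    · exact absurd h3 h2
  refine ⟨(AddChar.complexBasis (P.Lat 0)).repr φ 0, ?_⟩
  conv_lhs => rw [← (AddChar.complexBasis (P.Lat 0)).sum_repr φ]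
  rw [Finset.sum_eq_single 0 (fun χ _ hχ => by rw [hc χ hχ, zero_smul]) (by simp)]
  ext x
  simp [AddChar.complexBasis_apply]

/-- the inverse Green function `D_n + Q_n^* 𝔔_n Q_n` -/
noncomputable def invGreen (n : ℕ) : Matrix (P.Lat 0) (P.Lat 0) ℂ :=
  P.D n + P.adj n 0 (P.Qn n) * P.fQ n * P.Qn n

/-- A field annihilated by `D_n + Q_n^* 𝔔_n Q_n` is constant, because `D_n` and `Q_n^* 𝔔_n Q_n`
both have nonnegative real part, and it is annihilated by `Q_n`, which fixes the constants. -/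
theorem isUnit_invGreen {n : ℕ} (hn : n ≤ P.N) : IsUnit (P.invGreen n) := by
  rw [← Matrix.mulVec_injective_iff_isUnit, ← Matrix.coe_mulVecLin,
    injective_iff_map_eq_zero (P.invGreen n).mulVecLin]
  intro φ hφ
  rw [Matrix.mulVecLin_apply] at hφ
  have hav := P.isAveraging_Qn hn
  set w := (P.Qn n).mulVec φ with hw
  have hLpos : (0 : ℝ) < P.L := by exact_mod_cast P.L_pos
  have h1 : (P.invGreen n).mulVec φ = ((P.L : ℝ) ^ (2 * n) : ℝ) • P.D0.mulVec φ +
      ((P.L : ℝ) ^ (5 * (n : ℤ)) : ℝ) • (P.Qn n).transpose.mulVec ((P.fQ n).mulVec w) := by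
    ext x
    simp [invGreen, D, adj, Matrix.add_mulVec, Matrix.smul_mulVec, hw, Matrix.smul_mul, Matrix.mul_assoc]
  have h2 : star φ ⬝ᵥ (P.Qn n).transpose.mulVec ((P.fQ n).mulVec w) =
      star w ⬝ᵥ (P.fQ n).mulVec w := by
    rw [← hav.conjTranspose, Matrix.dotProduct_mulVec, ← Matrix.star_mulVec]
  have h3 : (P.L : ℝ) ^ (2 * n) * (star φ ⬝ᵥ P.D0.mulVec φ).re +
      (P.L : ℝ) ^ (5 * (n : ℤ)) * (star w ⬝ᵥ (P.fQ n).mulVec w).re = 0 := by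
    have := congrArg (fun v => (star φ ⬝ᵥ v).re) hφ
    rw [h1] at this
    simpa only [dotProduct_add, dotProduct_smul, h2, Complex.add_re, Complex.smul_re, smul_eq_mul,
      dotProduct_zero, Complex.zero_re] using this
  have hpd := P.posDef_fQ hn
  have h4 : 0 ≤ (star w ⬝ᵥ (P.fQ n).mulVec w).re :=
    (Complex.nonneg_iff.1 (hpd.posSemidef.dotProduct_mulVec_nonneg w)).1
  obtain ⟨h5, h6⟩ := P.re_star_dotProduct_D0 φ
  have hp1 : (0 : ℝ) < (P.L : ℝ) ^ (2 * n) := by positivity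
  have hp2 : (0 : ℝ) < (P.L : ℝ) ^ (5 * (n : ℤ)) := by positivity
  have h7 : (star φ ⬝ᵥ P.D0.mulVec φ).re = 0 := by nlinarith [mul_nonneg hp2.le h4]
  have h8 : (star w ⬝ᵥ (P.fQ n).mulVec w).re = 0 := by nlinarith [mul_nonneg hp1.le h5]
  have hw0 : w = 0 := by
    by_contra hne
    have := (Complex.pos_iff.1 (hpd.dotProduct_mulVec_pos hne)).1
    linarith
  obtain ⟨z, rfl⟩ := h6 h7
  rw [hw, hav.mulVec_const z] at hw0
  have hz : z = 0 := congrFun hw0 0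
  rw [hz]
  rfl

end Setup

end BlockSpin

/-! ### Gradients of the action -/

namespace BlockSpin

namespace Setup

variable {P : Setup}

section BilinearForm

variable {k : ℕ} (j : ℤ)

theorem ip_comm (f g : P.Fld k) : P.ip j f g = P.ip j g f := by
  simp only [ip, mul_comm]

theorem ip_add_left (f f' g : P.Fld k) : P.ip j (f + f') g = P.ip j f g + P.ip j f' g := by
  simp only [ip, Pi.add_apply, add_mul, Finset.sum_add_distrib, mul_add]

theorem ip_smul_left (z : ℂ) (f g : P.Fld k) : P.ip j (z • f) g = z * P.ip j f g := by
  simp only [ip, Pi.smul_apply, smul_eq_mul, mul_assoc, ← Finset.mul_sum]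
  ring

theorem ip_neg_left (f g : P.Fld k) : P.ip j (-f) g = -P.ip j f g := by
  simp [ip]

theorem ip_sub_left (f f' g : P.Fld k) : P.ip j (f - f') g = P.ip j f g - P.ip j f' g := by
  rw [sub_eq_add_neg, ip_add_left, ip_neg_left, sub_eq_add_neg]

theorem ip_add_right (f g g' : P.Fld k) : P.ip j f (g + g') = P.ip j f g + P.ip j f g' := by
  rw [ip_comm, ip_add_left, ip_comm j g, ip_comm j g']

theorem ip_smul_right (z : ℂ) (f g : P.Fld k) : P.ip j f (z • g) = z * P.ip j f g := by
  rw [ip_comm, ip_smul_left, ip_comm]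

theorem ip_sub_right (f g g' : P.Fld k) : P.ip j f (g - g') = P.ip j f g - P.ip j f g' := by
  rw [ip_comm, ip_sub_left, ip_comm j g, ip_comm j g']

theorem ip_mulVec_right (M : Matrix (P.Lat k) (P.Lat k) ℂ) (f g : P.Fld k) :
    P.ip j f (M.mulVec g) = P.ip j g (M.transpose.mulVec f) := by
  rw [ip_comm, P.ip_adj j j]
  simp [adj]

theorem eq_zero_of_ip_eq_zero {g : P.Fld k} (h : ∀ f, P.ip j f g = 0) : g = 0 := by
  ext u
  have := h (Pi.single u 1)
  simp only [ip, Pi.single_apply, ite_mul, one_mul, zero_mul, Finset.sum_ite_eq',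
    Finset.mem_univ, if_true] at this
  exact (mul_eq_zero.1 this).resolve_left (zpow_ne_zero _ P.L_ne_zero)

end BilinearForm

namespace Quartic

variable (V : P.Quartic)

/-- the sum of `V(u₁, …, u₄) a(u₁) b(u₂) c(u₃) d(u₄)` -/
noncomputable def form (a b c d : P.Fld 0) : ℂ :=
  ∑ u₁, ∑ u₂, ∑ u₃, ∑ u₄, V.ker u₁ u₂ u₃ u₄ * a u₁ * b u₂ * c u₃ * d u₄

theorem eval_eq_form (j : ℤ) (φs φ : P.Fld 0) :
    V.eval j φs φ = 1 / 2 * ((P.L : ℂ) ^ (-5 * j)) ^ 4 * V.form φs φ φs φ := rfl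

theorem form_swap13 (a b c d : P.Fld 0) : V.form a b c d = V.form c b a d := by
  unfold form
  have h : ∀ u₁, ∑ u₂, ∑ u₃, ∑ u₄, V.ker u₁ u₂ u₃ u₄ * a u₁ * b u₂ * c u₃ * d u₄ =
      ∑ u₃, ∑ u₂, ∑ u₄, V.ker u₁ u₂ u₃ u₄ * a u₁ * b u₂ * c u₃ * d u₄ := fun u₁ =>
    Finset.sum_comm
  simp only [h]
  rw [Finset.sum_comm]
  refine Finset.sum_congr rfl fun u₃ _ => ?_
  rw [Finset.sum_comm]
  refine Finset.sum_congr rfl fun u₂ _ => Finset.sum_congr rfl fun u₁ _ =>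
    Finset.sum_congr rfl fun u₄ _ => ?_
  rw [V.symm13 u₃ u₂ u₁ u₄]
  ring

theorem form_swap24 (a b c d : P.Fld 0) : V.form a b c d = V.form a d c b := by
  unfold form
  refine Finset.sum_congr rfl fun u₁ _ => ?_
  have h : ∀ u₂, ∑ u₃, ∑ u₄, V.ker u₁ u₂ u₃ u₄ * a u₁ * b u₂ * c u₃ * d u₄ =
      ∑ u₄, ∑ u₃, V.ker u₁ u₂ u₃ u₄ * a u₁ * b u₂ * c u₃ * d u₄ := fun u₂ =>
    Finset.sum_comm
  simp only [h]
  rw [Finset.sum_comm]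
  refine Finset.sum_congr rfl fun u₄ _ => ?_
  rw [Finset.sum_comm]
  refine Finset.sum_congr rfl fun u₃ _ => Finset.sum_congr rfl fun u₂ _ => ?_
  rw [V.symm24 u₁ u₄ u₃ u₂]
  ring

theorem form_add_smul₁ (a a' b c d : P.Fld 0) (t : ℂ) :
    V.form (a + t • a') b c d = V.form a b c d + t * V.form a' b c d := by
  simp only [form, Finset.mul_sum, ← Finset.sum_add_distrib]
  refine Finset.sum_congr rfl fun u₁ _ => Finset.sum_congr rfl fun u₂ _ =>
    Finset.sum_congr rfl fun u₃ _ => Finset.sum_congr rfl fun u₄ _ => ?_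
  simp only [Pi.add_apply, Pi.smul_apply, smul_eq_mul]
  ring

theorem form_add_smul₂ (a b b' c d : P.Fld 0) (t : ℂ) :
    V.form a (b + t • b') c d = V.form a b c d + t * V.form a b' c d := by
  simp only [form, Finset.mul_sum, ← Finset.sum_add_distrib]
  refine Finset.sum_congr rfl fun u₁ _ => Finset.sum_congr rfl fun u₂ _ =>
    Finset.sum_congr rfl fun u₃ _ => Finset.sum_congr rfl fun u₄ _ => ?_
  simp only [Pi.add_apply, Pi.smul_apply, smul_eq_mul]
  ring

end Quartic

/-- The trilinear operator with kernel `K` on `𝒳_j`: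
`u ↦ ∫ dx dy dz K(u, x, y, z) a(x) b(y) c(z)`. -/
noncomputable def tri (K : P.Lat 0 → P.Lat 0 → P.Lat 0 → P.Lat 0 → ℂ) (j : ℤ) (a b c : P.Fld 0) :
    P.Fld 0 := fun u =>
  ((P.L : ℂ) ^ (-5 * j)) ^ 3 * ∑ x, ∑ y, ∑ z, K u x y z * a x * b y * c z

/-- the gradient of the quartic monomial with respect to `φ_*` -/
noncomputable def Quartic.gradStar (V : P.Quartic) (j : ℤ) (φs φ : P.Fld 0) : P.Fld 0 :=
  tri V.ker j φ φs φ

/-- the gradient of the quartic monomial with respect to `φ` -/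
noncomputable def Quartic.grad (V : P.Quartic) (j : ℤ) (φs φ : P.Fld 0) : P.Fld 0 :=
  tri (fun u x y z => V.ker x u y z) j φs φs φ

theorem Quartic.ip_gradStar (V : P.Quartic) (j : ℤ) (φs φ h : P.Fld 0) :
    P.ip j h (V.gradStar j φs φ) = ((P.L : ℂ) ^ (-5 * j)) ^ 4 * V.form h φ φs φ := by
  simp only [ip, gradStar, tri, form, Finset.mul_sum]
  refine Finset.sum_congr rfl fun u₁ _ => Finset.sum_congr rfl fun u₂ _ =>
    Finset.sum_congr rfl fun u₃ _ => Finset.sum_congr rfl fun u₄ _ => ?_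
  ring

theorem Quartic.ip_grad (V : P.Quartic) (j : ℤ) (φs φ h : P.Fld 0) :
    P.ip j h (V.grad j φs φ) = ((P.L : ℂ) ^ (-5 * j)) ^ 4 * V.form φs h φs φ := by
  simp only [ip, grad, tri, form, Finset.mul_sum]
  rw [Finset.sum_comm]
  refine Finset.sum_congr rfl fun u₁ _ => Finset.sum_congr rfl fun u₂ _ =>
    Finset.sum_congr rfl fun u₃ _ => Finset.sum_congr rfl fun u₄ _ => ?_
  ring

theorem Quartic.eval_add_smul_left (V : P.Quartic) (j : ℤ) (φs φ h : P.Fld 0) (t : ℂ) :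
    V.eval j (φs + t • h) φ =
      V.eval j φs φ + t * P.ip j h (V.gradStar j φs φ) + t ^ 2 * V.eval j h φ := by
  rw [eval_eq_form, form_add_smul₁, form_swap13, form_add_smul₁,
    form_swap13 _ h φ (φs + t • h), form_add_smul₁,
    form_swap13 _ φs φ h, ip_gradStar, eval_eq_form, eval_eq_form]
  ring

theorem Quartic.eval_add_smul_right (V : P.Quartic) (j : ℤ) (φs φ h : P.Fld 0) (t : ℂ) :
    V.eval j φs (φ + t • h) =
      V.eval j φs φ + t * P.ip j h (V.grad j φs φ) + t ^ 2 * V.eval j φs h := by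
  rw [eval_eq_form, form_add_smul₂, form_swap24, form_add_smul₂, form_swap24 _ φs h φs (φ + t • h),
    form_add_smul₂, form_swap24 _ φs φ φs h, ip_grad, eval_eq_form, eval_eq_form]
  ring

variable (P)

/-- the gradient of the action `A_n` with respect to `φ_*` -/
noncomputable def resid (n : ℕ) (μ : ℂ) (V : P.Quartic) (ψ : P.Fld n) (φs φ : P.Fld 0) : P.Fld 0 :=
  (P.invGreen n - μ • (1 : Matrix (P.Lat 0) (P.Lat 0) ℂ)).mulVec φ
    - (P.adj n 0 (P.Qn n) * P.fQ n).mulVec ψ + V.gradStar n φs φ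

/-- the gradient of the action `A_n` with respect to `φ` -/
noncomputable def residStar (n : ℕ) (μ : ℂ) (V : P.Quartic) (ψs : P.Fld n) (φs φ : P.Fld 0) :
    P.Fld 0 :=
  (P.invGreen n - μ • (1 : Matrix (P.Lat 0) (P.Lat 0) ℂ)).transpose.mulVec φs
    - (P.adj n 0 (P.Qn n) * P.fQ n).mulVec ψs + V.grad n φs φ

variable {P}

theorem ip_Qn_mulVec (n : ℕ) (φ : P.Fld 0) (g : P.Fld n) :
    P.ip 0 ((P.Qn n).mulVec φ) g = P.ip n φ ((P.adj n 0 (P.Qn n)).mulVec g) :=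
  P.ip_adj n 0 (P.Qn n) φ g

theorem ip_fQ_symm (n : ℕ) (j : ℤ) (f g : P.Fld n) :
    P.ip j f ((P.fQ n).mulVec g) = P.ip j g ((P.fQ n).mulVec f) := by
  rw [ip_mulVec_right, transpose_fQ]

/-- The action is quadratic in `φ_*`; the coefficient of `t` exhibits `resid` as its gradient. -/
theorem act_add_smul_left (n : ℕ) (μ : ℂ) (V : P.Quartic) (ψs ψ : P.Fld n) (φs φ h : P.Fld 0)
    (t : ℂ) : P.act n μ V ψs ψ (φs + t • h) φ =
      P.act n μ V ψs ψ φs φ + t * P.ip n h (P.resid n μ V ψ φs φ) + t ^ 2 * V.eval n h φ := by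
  simp only [act, resid, invGreen, V.eval_add_smul_left, Matrix.mulVec_add, Matrix.mulVec_smul,
    Matrix.mulVec_sub, Matrix.sub_mulVec, Matrix.add_mulVec, Matrix.smul_mulVec, Matrix.one_mulVec,
    ← Matrix.mulVec_mulVec, ip_add_left, ip_smul_left, ip_add_right, ip_sub_right, ip_sub_left,
    ip_smul_right, ip_Qn_mulVec]
  ring

theorem transpose_QfQQ (n : ℕ) : (P.adj n 0 (P.Qn n) * P.fQ n * P.Qn n).transpose =
    P.adj n 0 (P.Qn n) * P.fQ n * P.Qn n := by
  simp [adj, Matrix.transpose_mul, transpose_fQ, Matrix.mul_assoc]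

theorem act_add_smul_right (n : ℕ) (μ : ℂ) (V : P.Quartic) (ψs ψ : P.Fld n) (φs φ h : P.Fld 0)
    (t : ℂ) : P.act n μ V ψs ψ φs (φ + t • h) =
      P.act n μ V ψs ψ φs φ + t * P.ip n h (P.residStar n μ V ψs φs φ) +
        t ^ 2 * V.eval n φs h := by
  have h1 : P.ip n φs ((P.D n).mulVec h) = P.ip n h ((P.D n).transpose.mulVec φs) :=
    ip_mulVec_right _ _ _ _
  have h2 : P.ip n φs h = P.ip n h φs := ip_comm _ _ _
  have h3 : ∀ g, P.ip 0 g ((P.fQ n).mulVec ((P.Qn n).mulVec h)) =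
      P.ip n h ((P.adj n 0 (P.Qn n)).mulVec ((P.fQ n).mulVec g)) := by
    intro g
    rw [ip_fQ_symm, ip_Qn_mulVec]
  simp only [act, residStar, invGreen, V.eval_add_smul_right, Matrix.transpose_sub,
    Matrix.transpose_add, Matrix.transpose_smul, Matrix.transpose_one, transpose_QfQQ,
    Matrix.mulVec_add, Matrix.mulVec_smul,
    Matrix.mulVec_sub, Matrix.sub_mulVec, Matrix.add_mulVec, Matrix.smul_mulVec, Matrix.one_mulVec,
    ← Matrix.mulVec_mulVec, ip_add_right, ip_smul_right, ip_sub_right, ip_sub_left, h1, h2, h3]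
  ring

theorem differentiable_act (n : ℕ) (μ : ℂ) (V : P.Quartic) :
    Differentiable ℂ fun p : (P.Fld n × P.Fld n) × P.Fld 0 × P.Fld 0 =>
      P.act n μ V p.1.1 p.1.2 p.2.1 p.2.2 := by
  unfold act ip Quartic.eval Matrix.mulVec dotProduct
  simp only [Pi.sub_apply]
  fun_prop

/-- A directional derivative is the linear coefficient of `F` along a line on which `F` is
quadratic. -/
theorem fderiv_apply_of_line {E : Type*} [NormedAddCommGroup E] [NormedSpace ℂ E] {F : E → ℂ}
    {x v : E} (hF : DifferentiableAt ℂ F x) {l c : ℂ}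
    (h : ∀ t : ℂ, F (x + t • v) = F x + t * l + t ^ 2 * c) : fderiv ℂ F x v = l := by
  have hline : HasDerivAt (fun t : ℂ => x + t • v) v 0 := by
    simpa using ((hasDerivAt_id (0 : ℂ)).smul_const v).const_add x
  have hF' : HasFDerivAt F (fderiv ℂ F x) (x + (0 : ℂ) • v) := by simpa using hF.hasFDerivAt
  have h1 := hF'.comp_hasDerivAt (0 : ℂ) hline
  have h2 : HasDerivAt (fun t : ℂ => F x + t * l + t ^ 2 * c) l 0 := by
    have := (((hasDerivAt_id' (0 : ℂ)).mul_const l).const_add (F x)).fun_add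
      (((hasDerivAt_id' (0 : ℂ)).fun_pow 2).mul_const c)
    simpa using this
  refine h1.unique (h2.congr_of_eventuallyEq (Filter.Eventually.of_forall fun t => ?_))
  exact h t

theorem isCritical_iff {k : ℕ} {f : P.Fld k → P.Fld k → ℂ} {p : P.Fld k × P.Fld k} {j : ℤ}
    {g gs : P.Fld k} (h1 : DifferentiableAt ℂ (fun φs => f φs p.2) p.1)
    (h2 : DifferentiableAt ℂ (fun φ => f p.1 φ) p.2)
    (hg : ∀ h, ∃ c, ∀ t : ℂ, f (p.1 + t • h) p.2 = f p.1 p.2 + t * P.ip j h g + t ^ 2 * c)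
    (hgs : ∀ h, ∃ c, ∀ t : ℂ, f p.1 (p.2 + t • h) = f p.1 p.2 + t * P.ip j h gs + t ^ 2 * c) :
    P.IsCritical f p ↔ gs = 0 ∧ g = 0 := by
  have e1 : ∀ h, fderiv ℂ (fun φs => f φs p.2) p.1 h = P.ip j h g := fun h =>
    fderiv_apply_of_line h1 (hg h).choose_spec
  have e2 : ∀ h, fderiv ℂ (fun φ => f p.1 φ) p.2 h = P.ip j h gs := fun h =>
    fderiv_apply_of_line h2 (hgs h).choose_spec
  have z : ∀ h : P.Fld k, P.ip j h 0 = 0 := fun h => by simp [ip]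
  constructor
  · rintro ⟨c1, c2⟩
    refine ⟨eq_zero_of_ip_eq_zero j fun h => ?_, eq_zero_of_ip_eq_zero j fun h => ?_⟩
    · rw [← e2, c2.fderiv]; rfl
    · rw [← e1, c1.fderiv]; rfl
  · rintro ⟨rfl, rfl⟩
    constructor
    · convert h1.hasFDerivAt
      ext1 h
      rw [e1, z]; rfl
    · convert h2.hasFDerivAt
      ext1 h
      rw [e2, z]; rfl

theorem isCritical_act_iff (n : ℕ) (μ : ℂ) (V : P.Quartic) (ψs ψ : P.Fld n)
    (x : P.Fld 0 × P.Fld 0) : P.IsCritical (P.act n μ V ψs ψ) x ↔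
      P.residStar n μ V ψs x.1 x.2 = 0 ∧ P.resid n μ V ψ x.1 x.2 = 0 := by
  refine isCritical_iff (j := n) ?_ ?_
    (fun h => ⟨_, fun t => act_add_smul_left n μ V ψs ψ x.1 x.2 h t⟩)
    (fun h => ⟨_, fun t => act_add_smul_right n μ V ψs ψ x.1 x.2 h t⟩)
  · exact ((differentiable_act n μ V).comp (g := fun p : (P.Fld n × P.Fld n) × P.Fld 0 × P.Fld 0 =>
      P.act n μ V p.1.1 p.1.2 p.2.1 p.2.2) (f := fun φs : P.Fld 0 => ((ψs, ψ), (φs, x.2)))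
      (by fun_prop)) x.1
  · exact ((differentiable_act n μ V).comp (g := fun p : (P.Fld n × P.Fld n) × P.Fld 0 × P.Fld 0 =>
      P.act n μ V p.1.1 p.1.2 p.2.1 p.2.2) (f := fun φ : P.Fld 0 => ((ψs, ψ), (x.1, φ)))
      (by fun_prop)) x.2

end Setup

end BlockSpin

/-! ### Existence and uniqueness of the background fields -/

namespace BlockSpin

namespace Setup

variable {P : Setup}

section Trilinear

variable {K : P.Lat 0 → P.Lat 0 → P.Lat 0 → P.Lat 0 → ℂ} {j : ℤ} {N : ℝ}

/-- `N` bounds `∫ dx dy dz |K(u, x, y, z)|` on `𝒳_j`, uniformly in `u`. -/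
def RowBound (K : P.Lat 0 → P.Lat 0 → P.Lat 0 → P.Lat 0 → ℂ) (j : ℤ) (N : ℝ) : Prop :=
  ∀ u, ((P.L : ℝ) ^ (-5 * j)) ^ 3 * ∑ x, ∑ y, ∑ z, ‖K u x y z‖ ≤ N

theorem RowBound.nonneg (hK : RowBound K j N) : 0 ≤ N :=
  le_trans (by positivity) (hK 0)

theorem RowBound.norm_tri_le (hK : RowBound K j N) (a b c : P.Fld 0) :
    ‖tri K j a b c‖ ≤ N * (‖a‖ * ‖b‖ * ‖c‖) := by
  have hN := hK.nonneg
  refine (pi_norm_le_iff_of_nonneg (by positivity)).2 fun u => ?_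
  have h1 : ‖∑ x, ∑ y, ∑ z, K u x y z * a x * b y * c z‖ ≤
      (∑ x, ∑ y, ∑ z, ‖K u x y z‖) * (‖a‖ * ‖b‖ * ‖c‖) := by
    simp only [Finset.sum_mul]
    refine (norm_sum_le _ _).trans (Finset.sum_le_sum fun x _ => ?_)
    refine (norm_sum_le _ _).trans (Finset.sum_le_sum fun y _ => ?_)
    refine (norm_sum_le _ _).trans (Finset.sum_le_sum fun z _ => ?_)
    rw [norm_mul, norm_mul, norm_mul, mul_assoc, mul_assoc, mul_assoc]
    have := norm_le_pi_norm a x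
    have := norm_le_pi_norm b y
    have := norm_le_pi_norm c z
    gcongr
  rw [tri, norm_mul, norm_pow, norm_L_zpow]
  calc _ ≤ ((P.L : ℝ) ^ (-5 * j)) ^ 3 *
        ((∑ x, ∑ y, ∑ z, ‖K u x y z‖) * (‖a‖ * ‖b‖ * ‖c‖)) := by gcongr
    _ = (((P.L : ℝ) ^ (-5 * j)) ^ 3 * ∑ x, ∑ y, ∑ z, ‖K u x y z‖) * (‖a‖ * ‖b‖ * ‖c‖) := by ring
    _ ≤ N * (‖a‖ * ‖b‖ * ‖c‖) := mul_le_mul_of_nonneg_right (hK u) (by positivity)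

theorem tri_sub_tri (a b c a' b' c' : P.Fld 0) : tri K j a b c - tri K j a' b' c' =
    tri K j (a - a') b c + tri K j a' (b - b') c + tri K j a' b' (c - c') := by
  ext u
  simp only [tri, Pi.sub_apply, Pi.add_apply, ← mul_sub, ← mul_add, ← Finset.sum_sub_distrib,
    ← Finset.sum_add_distrib]
  congr 1
  refine Finset.sum_congr rfl fun x _ => Finset.sum_congr rfl fun y _ =>
    Finset.sum_congr rfl fun z _ => ?_
  ring

theorem RowBound.norm_tri_sub_le (hK : RowBound K j N) {a b c a' b' c' : P.Fld 0} {M d : ℝ}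
    (hb : ‖b‖ ≤ M) (hc : ‖c‖ ≤ M) (ha' : ‖a'‖ ≤ M) (hb' : ‖b'‖ ≤ M)
    (da : ‖a - a'‖ ≤ d) (db : ‖b - b'‖ ≤ d) (dc : ‖c - c'‖ ≤ d) :
    ‖tri K j a b c - tri K j a' b' c'‖ ≤ 3 * N * M ^ 2 * d := by
  have hN := hK.nonneg
  have hM : 0 ≤ M := (norm_nonneg b).trans hb
  have hd : 0 ≤ d := (norm_nonneg _).trans da
  rw [tri_sub_tri]
  have h1 : ‖tri K j (a - a') b c‖ ≤ N * (d * M * M) :=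
    (hK.norm_tri_le _ _ _).trans (by gcongr)
  have h2 : ‖tri K j a' (b - b') c‖ ≤ N * (M * d * M) :=
    (hK.norm_tri_le _ _ _).trans (by gcongr)
  have h3 : ‖tri K j a' b' (c - c')‖ ≤ N * (M * M * d) :=
    (hK.norm_tri_le _ _ _).trans (by gcongr)
  refine (norm_add₃_le).trans ?_
  linarith

end Trilinear

variable (P)

/-- the nonlinear part of the background field equations, in fixed point form -/
noncomputable def bgNonlin (n : ℕ) (μ : ℂ) (V : P.Quartic) (x : P.Fld 0 × P.Fld 0) :
    P.Fld 0 × P.Fld 0 :=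
  (-(P.green n μ).transpose.mulVec (V.grad n x.1 x.2), -(P.green n μ).mulVec (V.gradStar n x.1 x.2))

/-- The smallness conditions under which the background field equations have exactly one solution
in the ball of radius `R`: `s` bounds the Green function `S_n(μ)` and its transpose, `N` the quartic
kernel. -/
structure SmallData (n : ℕ) (μ : ℂ) (V : P.Quartic) (s N R : ℝ) : Prop where
  le_N : n ≤ P.N
  isUnit : IsUnit (P.invGreen n - μ • (1 : Matrix (P.Lat 0) (P.Lat 0) ℂ))
  s_pos : 0 < s
  green_bound : BoundedBy (P.green n μ) s
  green_bound' : BoundedBy (P.green n μ).transpose s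
  gradStar_bound : RowBound V.ker n N
  grad_bound : RowBound (fun u x y z => V.ker x u y z) n N
  small : s * (3 * N) * R ^ 2 ≤ 1 / 2

variable {P}

section Background

variable {n : ℕ} {μ : ℂ} {V : P.Quartic} {s N R : ℝ}

theorem bgNonlin_zero : P.bgNonlin n μ V 0 = 0 := by
  have : ∀ K : P.Lat 0 → P.Lat 0 → P.Lat 0 → P.Lat 0 → ℂ, tri K n 0 0 0 = 0 := fun K => by
    ext u
    simp [tri]
  simp only [bgNonlin, Quartic.grad, Quartic.gradStar, Prod.fst_zero, Prod.snd_zero, this,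
    Matrix.mulVec_zero, neg_zero]
  rfl

theorem analytic_bgNonlin : AnalyticOnNhd ℂ (P.bgNonlin n μ V) Set.univ := by
  refine contDiff_omega_iff_analyticOnNhd.1 ?_
  unfold bgNonlin Quartic.grad Quartic.gradStar tri Matrix.mulVec dotProduct
  fun_prop

theorem analytic_mulVec {α β : Type*} [Fintype α] [Fintype β] (M : Matrix α β ℂ)
    (s : Set (β → ℂ)) : AnalyticOnNhd ℂ (fun v => M.mulVec v) s := by
  exact (LinearMap.toContinuousLinearMap M.mulVecLin).analyticOnNhd s

theorem SmallData.cubicLipschitz (h : P.SmallData n μ V s N R) :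
    CubicLipschitz (P.bgNonlin n μ V) (s * (3 * N)) := by
  intro M x y hx hy
  have hx1 := (norm_fst_le x).trans hx
  have hx2 := (norm_snd_le x).trans hx
  have hy1 := (norm_fst_le y).trans hy
  have hy2 := (norm_snd_le y).trans hy
  have d1 : ‖x.1 - y.1‖ ≤ ‖x - y‖ := norm_fst_le (x - y)
  have d2 : ‖x.2 - y.2‖ ≤ ‖x - y‖ := norm_snd_le (x - y)
  have hs := h.s_pos.le
  refine norm_prod_le_iff.2 ⟨?_, ?_⟩
  · have e : (P.bgNonlin n μ V x - P.bgNonlin n μ V y).1 = -(P.green n μ).transpose.mulVec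
        (V.grad n x.1 x.2 - V.grad n y.1 y.2) := by
      simp only [bgNonlin, Prod.fst_sub, Matrix.mulVec_sub]
      abel
    rw [e, norm_neg, mul_assoc s, mul_assoc s]
    exact (h.green_bound' _).trans (mul_le_mul_of_nonneg_left
      (h.grad_bound.norm_tri_sub_le hx1 hx2 hy1 hy1 d1 d1 d2) hs)
  · have e : (P.bgNonlin n μ V x - P.bgNonlin n μ V y).2 = -(P.green n μ).mulVec
        (V.gradStar n x.1 x.2 - V.gradStar n y.1 y.2) := by
      simp only [bgNonlin, Prod.snd_sub, Matrix.mulVec_sub]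
      abel
    rw [e, norm_neg, mul_assoc s, mul_assoc s]
    exact (h.green_bound _).trans (mul_le_mul_of_nonneg_left
      (h.gradStar_bound.norm_tri_sub_le hx1 hx2 hy2 hy1 d2 d1 d2) hs)

theorem SmallData.K_nonneg (h : P.SmallData n μ V s N R) : 0 ≤ s * (3 * N) :=
  mul_nonneg h.s_pos.le (mul_nonneg (by norm_num) h.gradStar_bound.nonneg)

theorem bgLin_fst (p : P.Fld n × P.Fld n) : (P.bgLin n μ p).1 =
    (P.green n μ).transpose.mulVec ((P.adj n 0 (P.Qn n) * P.fQ n).mulVec p.1) := by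
  simp [bgLin, adj, Matrix.mul_assoc]

theorem bgLin_snd (p : P.Fld n × P.Fld n) : (P.bgLin n μ p).2 =
    (P.green n μ).mulVec ((P.adj n 0 (P.Qn n) * P.fQ n).mulVec p.2) := by
  simp [bgLin, Matrix.mul_assoc]

/-- The background field equations in fixed point form: both gradients are multiplied by the Green
function. -/
theorem SmallData.isCritical_iff (h : P.SmallData n μ V s N R) (p : P.Fld n × P.Fld n)
    (x : P.Fld 0 × P.Fld 0) : P.IsCritical (P.act n μ V p.1 p.2) x ↔
      x = P.bgLin n μ p + P.bgNonlin n μ V x := by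
  set A := P.invGreen n - μ • (1 : Matrix (P.Lat 0) (P.Lat 0) ℂ) with hA
  have hg : P.green n μ = A⁻¹ := rfl
  have hAt : IsUnit A.transpose := (Matrix.isUnit_transpose A).2 h.isUnit
  have key : ∀ {B : Matrix (P.Lat 0) (P.Lat 0) ℂ}, IsUnit B → ∀ φ b g : P.Fld 0,
      B.mulVec φ - b + g = 0 ↔ φ = B⁻¹.mulVec b + -B⁻¹.mulVec g := by
    intro B hB φ b g
    constructor
    · intro h0
      have h1 : B.mulVec φ = b - g := by
        rw [← sub_eq_zero, ← h0]
        abel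
      rw [← inv_mulVec_mulVec hB φ, h1, Matrix.mulVec_sub, sub_eq_add_neg]
    · intro h0
      have h1 := congrArg B.mulVec h0
      rw [Matrix.mulVec_add, Matrix.mulVec_neg, mulVec_inv_mulVec hB, mulVec_inv_mulVec hB] at h1
      rw [h1]
      abel
  rw [isCritical_act_iff, Prod.ext_iff, Prod.fst_add, Prod.snd_add, bgLin_fst, bgLin_snd]
  simp only [bgNonlin, hg, Matrix.transpose_nonsing_inv]
  exact and_congr (key hAt _ _ _) (key h.isUnit _ _ _)

theorem SmallData.norm_bgLin_le (h : P.SmallData n μ V s N R) (p : P.Fld n × P.Fld n) :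
    ‖P.bgLin n μ p‖ ≤ 2 * P.a * s * ‖p‖ := by
  have hs := h.s_pos.le
  have ha := P.a_pos.le
  have hQ : ∀ ψ : P.Fld n, ‖(P.adj n 0 (P.Qn n) * P.fQ n).mulVec ψ‖ ≤ 2 * P.a * ‖ψ‖ := by
    intro ψ
    simpa using ((P.boundedBy_adj_Qn h.le_N).mul zero_le_one (P.boundedBy_fQ h.le_N)) ψ
  refine norm_prod_le_iff.2 ⟨?_, ?_⟩
  · rw [bgLin_fst]
    calc _ ≤ s * (2 * P.a * ‖p.1‖) :=
          (h.green_bound' _).trans (mul_le_mul_of_nonneg_left (hQ _) hs)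
      _ ≤ s * (2 * P.a * ‖p‖) := by
          have := norm_fst_le p
          gcongr
      _ = _ := by ring
  · rw [bgLin_snd]
    calc _ ≤ s * (2 * P.a * ‖p.2‖) :=
          (h.green_bound _).trans (mul_le_mul_of_nonneg_left (hQ _) hs)
      _ ≤ s * (2 * P.a * ‖p‖) := by
          have := norm_snd_le p
          gcongr
      _ = _ := by ring

/-- Critical points in the ball of radius `R` are unique. -/
theorem SmallData.critical_unique (h : P.SmallData n μ V s N R) {p : P.Fld n × P.Fld n}
    {x y : P.Fld 0 × P.Fld 0} (hx : ‖x‖ ≤ R) (hy : ‖y‖ ≤ R)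
    (hxc : P.IsCritical (P.act n μ V p.1 p.2) x) (hyc : P.IsCritical (P.act n μ V p.1 p.2) y) :
    x = y :=
  h.cubicLipschitz.unique h.small hx hy ((h.isCritical_iff p x).1 hxc) ((h.isCritical_iff p y).1 hyc)

theorem polydisc_eq_ball (k : ℕ) (r : ℝ) : P.polydisc k r = Metric.ball 0 r := by
  ext p
  have hn : ∀ f : P.Fld k, ‖f‖ < r ↔ ∀ x, ‖f x‖ < r := fun f => by
    rcases lt_or_ge 0 r with hr | hr
    · exact pi_norm_lt_iff hr
    · exact iff_of_false (fun h => absurd (norm_nonneg f) (by linarith))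
        fun h => absurd (norm_nonneg (f 0)) (by linarith [h 0])
  rw [mem_ball_zero_iff, Prod.norm_def, max_lt_iff, hn, hn]
  rfl

/-- Background fields exist on the polydisc of radius `r` if the linear part `‖bgLin p‖ ≤ 2as‖p‖`
stays in the ball of radius `R/2`. -/
theorem SmallData.exists_background (h : P.SmallData n μ V s N R) {r : ℝ} (hr : 0 < r)
    (hrR : 4 * P.a * s * r ≤ R) : ∃ F, P.IsBackground n μ V r F ∧
      ∀ p ∈ P.polydisc n r, ‖F p‖ ≤ 4 * P.a * s * ‖p‖ := by
  obtain ⟨G, hGa, hG⟩ := h.cubicLipschitz.exists_analytic_solution bgNonlin_zero analytic_bgNonlin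
    h.K_nonneg h.small
  have has : 0 < P.a * s := mul_pos P.a_pos h.s_pos
  have hmaps : ∀ p ∈ P.polydisc n r, P.bgLin n μ p ∈ Metric.ball (0 : P.Fld 0 × P.Fld 0) (R / 2) := by
    intro p hp
    rw [polydisc_eq_ball, mem_ball_zero_iff] at hp
    rw [mem_ball_zero_iff]
    have := h.norm_bgLin_le p
    nlinarith
  have hbound : ∀ p ∈ P.polydisc n r, ‖G (P.bgLin n μ p)‖ ≤ 4 * P.a * s * ‖p‖ := by
    intro p hp
    have h1 := (hG _ (hmaps p hp)).1
    have h2 := h.norm_bgLin_le p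
    linarith
  refine ⟨fun p => G (P.bgLin n μ p), ⟨?_, fun p hp => ?_, ?_⟩, hbound⟩
  · refine hGa.comp (fun p _ => ?_) hmaps
    unfold bgLin
    exact ((analytic_mulVec _ Set.univ p.1 trivial).comp analyticAt_fst).prod
      ((analytic_mulVec _ Set.univ p.2 trivial).comp analyticAt_snd)
  · exact (h.isCritical_iff p _).2 (hG _ (hmaps p hp)).2
  · refine Asymptotics.IsBigO.of_bound (s * (3 * N) * (4 * P.a * s) ^ 3) ?_
    have hnhds : P.polydisc n r ∈ 𝓝 (0 : P.Fld n × P.Fld n) := by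
      rw [polydisc_eq_ball]
      exact Metric.ball_mem_nhds _ hr
    filter_upwards [hnhds] with p hp
    have h1 : G (P.bgLin n μ p) - P.bgLin n μ p = P.bgNonlin n μ V (G (P.bgLin n μ p)) :=
      sub_eq_iff_eq_add'.2 (hG _ (hmaps p hp)).2
    rw [h1, norm_pow, norm_norm]
    have h2 := h.cubicLipschitz.norm_le bgNonlin_zero (G (P.bgLin n μ p))
    have h3 := pow_le_pow_left₀ (norm_nonneg _) (hbound p hp) 3
    have h4 := mul_le_mul_of_nonneg_left h3 h.K_nonneg
    calc _ ≤ _ := h2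
      _ ≤ _ := h4
      _ = _ := by ring

theorem SmallData.tendsto_zero (h : P.SmallData n μ V s N R) {r : ℝ}
    {F : P.Fld n × P.Fld n → P.Fld 0 × P.Fld 0} (hF : P.IsBackground n μ V r F) :
    Filter.Tendsto F (𝓝 0) (𝓝 0) := by
  have h1 : Filter.Tendsto (fun p : P.Fld n × P.Fld n => ‖p‖ ^ 3) (𝓝 0) (𝓝 0) := by
    have : Continuous fun p : P.Fld n × P.Fld n => ‖p‖ ^ 3 := by fun_prop
    simpa using this.tendsto 0
  have h2 : Filter.Tendsto (P.bgLin n μ) (𝓝 0) (𝓝 0) := by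
    refine squeeze_zero_norm (h.norm_bgLin_le) ?_
    have : Continuous fun p : P.Fld n × P.Fld n => 2 * P.a * s * ‖p‖ := by fun_prop
    simpa using this.tendsto 0
  simpa using (hF.expansion.trans_tendsto h1).add h2

/-- Two background fields agree on the smaller of their polydiscs: close to zero because small
critical points are unique, and then everywhere by the identity theorem. -/
theorem SmallData.background_unique (h : P.SmallData n μ V s N R) (hR : 0 < R) {r r' : ℝ}
    {F F' : P.Fld n × P.Fld n → P.Fld 0 × P.Fld 0} (hF : P.IsBackground n μ V r F)
    (hF' : P.IsBackground n μ V r' F') {p : P.Fld n × P.Fld n} (hp : p ∈ P.polydisc n r)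
    (hp' : p ∈ P.polydisc n r') : F p = F' p := by
  have hsub : ∀ {a b : ℝ}, a ≤ b → Metric.ball (0 : P.Fld n × P.Fld n) a ⊆ P.polydisc n b := by
    intro a b hab
    rw [polydisc_eq_ball]
    exact Metric.ball_subset_ball hab
  have hmem : p ∈ Metric.ball (0 : P.Fld n × P.Fld n) (min r r') := by
    rw [polydisc_eq_ball, mem_ball_zero_iff] at hp hp'
    exact mem_ball_zero_iff.2 (lt_min hp hp')
  have hpos : 0 < min r r' := (norm_nonneg p).trans_lt (mem_ball_zero_iff.1 hmem)
  have hball : Metric.ball (0 : P.Fld 0 × P.Fld 0) R ∈ 𝓝 0 := Metric.ball_mem_nhds _ hR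
  refine AnalyticOnNhd.eqOn_of_preconnected_of_eventuallyEq
    (hF.analytic.mono (hsub (min_le_left _ _))) (hF'.analytic.mono (hsub (min_le_right _ _)))
    (convex_ball 0 _).isPreconnected (Metric.mem_ball_self hpos) ?_ hmem
  filter_upwards [h.tendsto_zero hF hball, h.tendsto_zero hF' hball,
    Metric.ball_mem_nhds (0 : P.Fld n × P.Fld n) hpos] with q hq hq' hqm
  exact h.critical_unique (mem_ball_zero_iff.1 hq).le (mem_ball_zero_iff.1 hq').le
    (hF.critical q (hsub (min_le_left _ _) hqm)) (hF'.critical q (hsub (min_le_right _ _) hqm))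

theorem SmallData.bg_eq (h : P.SmallData n μ V s N R) (hR : 0 < R) {r : ℝ}
    {F : P.Fld n × P.Fld n → P.Fld 0 × P.Fld 0} (hF : P.IsBackground n μ V r F)
    {p : P.Fld n × P.Fld n} (hp : p ∈ P.polydisc n r) : P.bg n μ V p = F p := by
  have hex : ∃ F r, P.IsBackground n μ V r F ∧ p ∈ P.polydisc n r := ⟨F, r, hF, hp⟩
  rw [bg, dif_pos hex]
  obtain ⟨r', hF', hp'⟩ := hex.choose_spec
  exact h.background_unique hR hF' hF hp' hp

theorem SmallData.isBackground_bg (h : P.SmallData n μ V s N R) {r : ℝ} (hr : 0 < r)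
    (hrR : 4 * P.a * s * r ≤ R) : P.IsBackground n μ V r (P.bg n μ V) ∧
      ∀ p ∈ P.polydisc n r, ‖P.bg n μ V p‖ ≤ 4 * P.a * s * ‖p‖ := by
  obtain ⟨F, hF, hb⟩ := h.exists_background hr hrR
  have hR : 0 < R := lt_of_lt_of_le (by have := P.a_pos; have := h.s_pos; positivity) hrR
  have heq : Set.EqOn (P.bg n μ V) F (P.polydisc n r) := fun p hp => h.bg_eq hR hF hp
  have hopen : IsOpen (P.polydisc n r) := by
    rw [polydisc_eq_ball]
    exact Metric.isOpen_ball
  have h0 : (0 : P.Fld n × P.Fld n) ∈ P.polydisc n r := by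
    rw [polydisc_eq_ball]
    exact Metric.mem_ball_self hr
  refine ⟨⟨(analyticOnNhd_congr hopen heq).2 hF.analytic, fun p hp => ?_, ?_⟩, fun p hp => ?_⟩
  · rw [heq hp]
    exact hF.critical p hp
  · refine hF.expansion.congr' ?_ Filter.EventuallyEq.rfl
    filter_upwards [hopen.mem_nhds h0] with p hp
    rw [heq hp]
  · rw [heq hp]
    exact hb p hp

end Background

end Setup

end BlockSpin

/-! ### Scaling and the block spin recursion -/

namespace BlockSpin

namespace Setup

variable {P : Setup}

/-- the factor `L^{3/2}` of the scaling map `𝕊` -/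
noncomputable def sclFactor (P : Setup) : ℂ := (((P.L : ℝ) ^ (3 / 2 : ℝ) : ℝ) : ℂ)

theorem scl_eq {k : ℕ} (f : P.Fld k) : P.scl f = P.sclFactor • f := rfl

theorem L_pow_pos : 0 < (P.L : ℝ) ^ (3 / 2 : ℝ) :=
  Real.rpow_pos_of_pos (by exact_mod_cast P.L_pos) _

theorem sclFactor_ne_zero : P.sclFactor ≠ 0 := by
  rw [sclFactor]
  exact_mod_cast L_pow_pos.ne'

theorem norm_sclFactor : ‖P.sclFactor‖ = (P.L : ℝ) ^ (3 / 2 : ℝ) := by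
  rw [sclFactor, Complex.norm_real, Real.norm_of_nonneg L_pow_pos.le]

theorem sclFactor_sq : P.sclFactor ^ 2 = (P.L : ℂ) ^ 3 := by
  have h : ((P.L : ℝ) ^ (3 / 2 : ℝ)) ^ 2 = (P.L : ℝ) ^ 3 := by
    rw [← Real.rpow_natCast, ← Real.rpow_mul (by positivity), ← Real.rpow_natCast]
    norm_num
  rw [sclFactor]
  exact_mod_cast congrArg (fun x : ℝ => (x : ℂ)) h

theorem unscl_eq {k : ℕ} (f : P.Fld k) : P.unscl f = P.sclFactor⁻¹ • f := by
  rw [unscl, Real.rpow_neg (by positivity), sclFactor, Complex.ofReal_inv]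

theorem scl_unscl {k : ℕ} (f : P.Fld k) : P.scl (P.unscl f) = f := by
  rw [scl_eq, unscl_eq, smul_inv_smul₀ sclFactor_ne_zero]

theorem L_zpow_succ (j : ℤ) : (P.L : ℂ) ^ (-5 * (j + 1)) * (P.L : ℂ) ^ 5 = (P.L : ℂ) ^ (-5 * j) := by
  rw [← zpow_natCast, ← zpow_add₀ P.L_ne_zero]
  congr 1
  push_cast
  ring

theorem tri_scale (K : P.Lat 0 → P.Lat 0 → P.Lat 0 → P.Lat 0 → ℂ) (j : ℤ) (a b c : P.Fld 0) :
    tri (fun u x y z => (P.L : ℂ) ^ 14 * K u x y z) (j + 1) (P.scl a) (P.scl b) (P.scl c) =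
      ((P.L : ℂ) ^ 2 * P.sclFactor) • tri K j a b c := by
  ext u
  have hL := P.L_ne_zero
  simp only [tri, scl_eq, Pi.smul_apply, smul_eq_mul, ← L_zpow_succ j, Finset.mul_sum]
  refine Finset.sum_congr rfl fun x _ => Finset.sum_congr rfl fun y _ =>
    Finset.sum_congr rfl fun z _ => ?_
  have h3 : P.sclFactor ^ 3 = (P.L : ℂ) ^ 3 * P.sclFactor := by rw [← sclFactor_sq]; ring
  calc _ = ((P.L : ℂ) ^ (-5 * (j + 1))) ^ 3 * ((P.L : ℂ) ^ 14 *
        (K u x y z * a x * b y * c z) * P.sclFactor ^ 3) := by ring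
    _ = _ := by rw [h3]; ring

theorem gradStar_scale (V : P.Quartic) (j : ℤ) (φs φ : P.Fld 0) :
    V.scale.gradStar (j + 1) (P.scl φs) (P.scl φ) =
      ((P.L : ℂ) ^ 2 * P.sclFactor) • V.gradStar j φs φ :=
  tri_scale _ _ _ _ _

theorem grad_scale (V : P.Quartic) (j : ℤ) (φs φ : P.Fld 0) :
    V.scale.grad (j + 1) (P.scl φs) (P.scl φ) =
      ((P.L : ℂ) ^ 2 * P.sclFactor) • V.grad j φs φ :=
  tri_scale _ _ _ _ _

theorem D_succ (n : ℕ) : P.D (n + 1) = (P.L : ℂ) ^ 2 • P.D n := by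
  rw [D, D, smul_smul]
  congr 1
  ring

theorem resid_eq (n : ℕ) (μ : ℂ) (V : P.Quartic) (ψ : P.Fld n) (φs φ : P.Fld 0) :
    P.resid n μ V ψ φs φ = (P.D n).mulVec φ - μ • φ -
      (P.adj n 0 (P.Qn n)).mulVec ((P.fQ n).mulVec (ψ - (P.Qn n).mulVec φ)) +
      V.gradStar n φs φ := by
  simp only [resid, invGreen, Matrix.sub_mulVec, Matrix.add_mulVec, Matrix.smul_mulVec,
    Matrix.one_mulVec, ← Matrix.mulVec_mulVec, Matrix.mulVec_sub]
  abel

theorem residStar_eq (n : ℕ) (μ : ℂ) (V : P.Quartic) (ψs : P.Fld n) (φs φ : P.Fld 0) :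
    P.residStar n μ V ψs φs φ = (P.D n).transpose.mulVec φs - μ • φs -
      (P.adj n 0 (P.Qn n)).mulVec ((P.fQ n).mulVec (ψs - (P.Qn n).mulVec φs)) +
      V.grad n φs φ := by
  simp only [residStar, invGreen, Matrix.transpose_sub, Matrix.transpose_add,
    Matrix.transpose_smul, Matrix.transpose_one, transpose_QfQQ, Matrix.sub_mulVec,
    Matrix.add_mulVec, Matrix.smul_mulVec, Matrix.one_mulVec, ← Matrix.mulVec_mulVec,
    Matrix.mulVec_sub]
  abel

theorem adj_Qn_succ (n : ℕ) : P.adj ((n + 1 : ℕ) : ℤ) 0 (P.Qn (n + 1)) =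
    P.adj n 0 (P.Qn n) * P.Qadj n := by
  have h : P.Qn (n + 1) = P.Q n * P.Qn n := rfl
  rw [h, P.adj_mul _ 1 _]
  congr 1
  simp [adj]

theorem Qn_succ_mulVec (n : ℕ) (φ : P.Fld 0) :
    (P.Qn (n + 1)).mulVec φ = (P.Q n).mulVec ((P.Qn n).mulVec φ) := by
  rw [Matrix.mulVec_mulVec]
  rfl

section CriticalField

variable {n : ℕ}

theorem norm_b_le : ‖P.b‖ ≤ P.a / 9 := by
  have ha := P.a_pos
  have hL := P.inv_L_sq_le
  rw [b, norm_div, norm_pow, Complex.norm_natCast, Complex.norm_real, Real.norm_of_nonneg ha.le,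
    div_eq_mul_inv]
  nlinarith

/-- The operator `(a/L²) Q^*Q + 𝔔_n` is bounded below uniformly in `L`, because `a/L² ≤ a/9` makes
its first summand small compared with `𝔔_n`. -/
theorem norm_le_critMatrix (hn : n + 1 ≤ P.N) (v : P.Fld n) :
    ‖v‖ ≤ 2 / P.a * ‖(P.b • (P.Qadj n * P.Q n) + P.fQ n).mulVec v‖ := by
  have ha := P.a_pos
  set w := (P.b • (P.Qadj n * P.Q n) + P.fQ n).mulVec v with hw
  have h1 : (P.a : ℂ) • v =
      (P.invfQ n).mulVec w - (P.invfQ n).mulVec (P.b • (P.Qadj n * P.Q n).mulVec v) := by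
    rw [hw, Matrix.add_mulVec, Matrix.mulVec_add, invfQ_mulVec_fQ_mulVec P (by omega),
      Matrix.smul_mulVec]
    abel
  have hQQ : ‖(P.Qadj n * P.Q n).mulVec v‖ ≤ ‖v‖ := by
    simpa using ((P.boundedBy_Qadj hn).mul zero_le_one (P.boundedBy_Q hn)) v
  have h2 : ‖P.b • (P.Qadj n * P.Q n).mulVec v‖ ≤ P.a / 9 * ‖v‖ := by
    rw [norm_smul]
    exact mul_le_mul norm_b_le hQQ (norm_nonneg _) (by positivity)
  have hM := P.boundedBy_invfQ (n := n) (by omega)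
  have h3 : P.a * ‖v‖ ≤ 9 / 8 * ‖w‖ + 9 / 8 * (P.a / 9 * ‖v‖) := by
    have h4 : ‖(P.a : ℂ) • v‖ = P.a * ‖v‖ := by
      rw [norm_smul, Complex.norm_real, Real.norm_of_nonneg ha.le]
    rw [← h4, h1]
    exact (norm_sub_le _ _).trans (add_le_add (hM _)
      ((hM _).trans (mul_le_mul_of_nonneg_left h2 (by norm_num))))
  rw [div_mul_eq_mul_div, le_div_iff₀ ha]
  nlinarith [norm_nonneg w]

theorem norm_critOf_le (hn : n + 1 ≤ P.N) (θ : P.Fld (n + 1)) (φ : P.Fld 0) :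
    ‖P.critOf n θ φ‖ ≤ 2 * ‖θ‖ + 4 * ‖φ‖ := by
  have ha := P.a_pos
  have h1 : ‖P.b • (P.Qadj n).mulVec θ‖ ≤ P.a * ‖θ‖ := by
    rw [norm_smul]
    have h := P.boundedBy_Qadj hn θ
    rw [one_mul] at h
    have hb : ‖P.b‖ ≤ P.a := norm_b_le.trans (by linarith)
    exact mul_le_mul hb h (norm_nonneg _) ha.le
  have h2 : ‖(P.fQ n).mulVec ((P.Qn n).mulVec φ)‖ ≤ 2 * P.a * ‖φ‖ := by
    have h := P.boundedBy_Qn (n := n) (by omega) φ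
    rw [one_mul] at h
    exact (P.boundedBy_fQ (by omega) _).trans (mul_le_mul_of_nonneg_left h (by positivity))
  have h3 := BoundedBy.inv_of_le_mulVec (norm_le_critMatrix hn)
    (P.b • (P.Qadj n).mulVec θ + (P.fQ n).mulVec ((P.Qn n).mulVec φ))
  calc ‖P.critOf n θ φ‖ ≤ _ := h3
    _ ≤ 2 / P.a * (P.a * ‖θ‖ + 2 * P.a * ‖φ‖) :=
        mul_le_mul_of_nonneg_left ((norm_add_le _ _).trans (add_le_add h1 h2)) (by positivity)
    _ = 2 * ‖θ‖ + 4 * ‖φ‖ := by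
        field_simp
        ring

/-- The equation that defines the critical field: the gradient of the block spin term plus that of
the quadratic form of `𝔔_n` vanishes. -/
theorem fQ_critOf_sub (hn : n + 1 ≤ P.N) (θ : P.Fld (n + 1)) (φ : P.Fld 0) :
    (P.fQ n).mulVec (P.critOf n θ φ - (P.Qn n).mulVec φ) =
      P.b • (P.Qadj n).mulVec (θ - (P.Q n).mulVec (P.critOf n θ φ)) := by
  have h : (P.b • (P.Qadj n * P.Q n) + P.fQ n).mulVec (P.critOf n θ φ) =
      P.b • (P.Qadj n).mulVec θ + (P.fQ n).mulVec ((P.Qn n).mulVec φ) :=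
    mulVec_inv_mulVec (isUnit_of_le_mulVec (norm_le_critMatrix hn)) _
  rw [Matrix.add_mulVec, Matrix.smul_mulVec, ← Matrix.mulVec_mulVec] at h
  rw [Matrix.mulVec_sub, Matrix.mulVec_sub, smul_sub, sub_eq_sub_iff_add_eq_add, add_comm, h]

/-- Integrating out the critical field turns the block spin term and `𝔔_n` into `L^{-2} 𝔔_{n+1}`. -/
theorem fQ_succ_sub (h1 : 1 ≤ n) (hn : n + 1 ≤ P.N) (θ : P.Fld (n + 1)) (φ : P.Fld 0) :
    (P.fQ (n + 1)).mulVec (θ - (P.Qn (n + 1)).mulVec φ) =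
      (P.a : ℂ) • (θ - (P.Q n).mulVec (P.critOf n θ φ)) := by
  set v := θ - (P.Q n).mulVec (P.critOf n θ φ) with hv
  have ha : (P.a : ℂ) ≠ 0 := by exact_mod_cast P.a_pos.ne'
  have hL := P.L_ne_zero
  have hb : P.b ≠ 0 := div_ne_zero ha (pow_ne_zero _ hL)
  have hq : (P.Qadj n).mulVec v =
      P.b⁻¹ • (P.fQ n).mulVec (P.critOf n θ φ - (P.Qn n).mulVec φ) := by
    rw [fQ_critOf_sub hn, ← hv, inv_smul_smul₀ hb]
  have hM : (P.invfQ (n + 1)).mulVec v = θ - (P.Qn (n + 1)).mulVec φ := by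
    rw [P.invfQ_succ h1, Matrix.add_mulVec, Matrix.one_mulVec, Matrix.smul_mulVec,
      ← Matrix.mulVec_mulVec, ← Matrix.mulVec_mulVec, hq, Matrix.mulVec_smul,
      invfQ_mulVec_fQ_mulVec P (by omega), smul_smul, Matrix.mulVec_smul, smul_smul]
    have : ((P.L : ℂ) ^ 2)⁻¹ * (P.b⁻¹ * (P.a : ℂ)) = 1 := by
      rw [b]
      field_simp
    rw [this, one_smul, Matrix.mulVec_sub, hv, Qn_succ_mulVec]
    abel
  rw [← hM, fQ_eq, Matrix.smul_mulVec, inv_mulVec_mulVec (P.isUnit_invfQ hn)]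

theorem a_eq : (P.a : ℂ) = (P.L : ℂ) ^ 2 * P.b := by
  rw [b, mul_div_cancel₀ _ (pow_ne_zero _ P.L_ne_zero)]

/-- The gradient of the action at scale `n + 1` in the scaled fields is a multiple of that at scale
`n`, with the critical field as external field. -/
theorem resid_succ (h1 : 1 ≤ n) (hn : n + 1 ≤ P.N) (μ : ℂ) (V : P.Quartic) (θ : P.Fld (n + 1))
    (φs φ : P.Fld 0) :
    P.resid (n + 1) ((P.L : ℂ) ^ 2 * μ) V.scale (P.scl θ) (P.scl φs) (P.scl φ) =
      ((P.L : ℂ) ^ 2 * P.sclFactor) • P.resid n μ V (P.critOf n θ φ) φs φ := by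
  have hcast : ((n + 1 : ℕ) : ℤ) = (n : ℤ) + 1 := by push_cast; rfl
  have hsub : P.scl θ - (P.Qn (n + 1)).mulVec (P.scl φ) =
      P.sclFactor • (θ - (P.Qn (n + 1)).mulVec φ) := by
    rw [scl_eq, scl_eq, Matrix.mulVec_smul, smul_sub]
  rw [resid_eq, resid_eq, hsub, Matrix.mulVec_smul, fQ_succ_sub h1 hn, fQ_critOf_sub hn,
    adj_Qn_succ, D_succ, hcast, gradStar_scale, scl_eq, a_eq]
  simp only [Matrix.mulVec_smul, Matrix.smul_mulVec, ← Matrix.mulVec_mulVec, smul_sub, smul_add,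
    smul_smul]
  congr 3
  · congr 1
    ring
  · congr 1
    ring
  · rw [← smul_sub, Matrix.mulVec_smul, Matrix.mulVec_smul]
    congr 1
    ring

theorem residStar_succ (h1 : 1 ≤ n) (hn : n + 1 ≤ P.N) (μ : ℂ) (V : P.Quartic)
    (θs : P.Fld (n + 1)) (φs φ : P.Fld 0) :
    P.residStar (n + 1) ((P.L : ℂ) ^ 2 * μ) V.scale (P.scl θs) (P.scl φs) (P.scl φ) =
      ((P.L : ℂ) ^ 2 * P.sclFactor) • P.residStar n μ V (P.critOf n θs φs) φs φ := by
  have hcast : ((n + 1 : ℕ) : ℤ) = (n : ℤ) + 1 := by push_cast; rfl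
  have hsub : P.scl θs - (P.Qn (n + 1)).mulVec (P.scl φs) =
      P.sclFactor • (θs - (P.Qn (n + 1)).mulVec φs) := by
    rw [scl_eq, scl_eq, Matrix.mulVec_smul, smul_sub]
  rw [residStar_eq, residStar_eq, hsub, Matrix.mulVec_smul, fQ_succ_sub h1 hn, fQ_critOf_sub hn,
    adj_Qn_succ, D_succ, hcast, grad_scale, scl_eq, a_eq]
  simp only [Matrix.mulVec_smul, Matrix.transpose_smul, Matrix.smul_mulVec,
    ← Matrix.mulVec_mulVec, smul_sub, smul_add, smul_smul]
  congr 3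
  · congr 1
    ring
  · congr 1
    ring
  · rw [← smul_sub, Matrix.mulVec_smul, Matrix.mulVec_smul]
    congr 1
    ring

/-- A critical point of the action at scale `n + 1` is, after rescaling, a critical point of the
action at scale `n` at the critical fields. -/
theorem isCritical_act_critOf (h1 : 1 ≤ n) (hn : n + 1 ≤ P.N) {μ : ℂ} {V : P.Quartic}
    {θs θ : P.Fld (n + 1)} {x : P.Fld 0 × P.Fld 0}
    (h : P.IsCritical (P.act (n + 1) ((P.L : ℂ) ^ 2 * μ) V.scale (P.scl θs) (P.scl θ))
      (P.scl x.1, P.scl x.2)) :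
    P.IsCritical (P.act n μ V (P.critOf n θs x.1) (P.critOf n θ x.2)) x := by
  rw [isCritical_act_iff, residStar_succ h1 hn, resid_succ h1 hn] at h
  have hc : (P.L : ℂ) ^ 2 * P.sclFactor ≠ 0 :=
    mul_ne_zero (pow_ne_zero _ P.L_ne_zero) sclFactor_ne_zero
  rw [isCritical_act_iff]
  exact ⟨(smul_eq_zero.1 h.1).resolve_left hc, (smul_eq_zero.1 h.2).resolve_left hc⟩

theorem ip_scl (j : ℤ) {k : ℕ} (f g : P.Fld k) :
    P.ip (j + 1) (P.scl f) (P.scl g) = ((P.L : ℂ) ^ 2)⁻¹ * P.ip j f g := by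
  rw [scl_eq, scl_eq, ip_smul_left, ip_smul_right, ← mul_assoc, ← sq, sclFactor_sq]
  simp only [ip]
  have hL := P.L_ne_zero
  rw [← L_zpow_succ j]
  field_simp

theorem actCheck_succ (n : ℕ) (μ : ℂ) (V : P.Quartic) (θs θ : P.Fld (n + 1)) (φs φ : P.Fld 0) :
    P.actCheck (n + 1) μ V θs θ φs φ =
      ((P.L : ℂ) ^ 2)⁻¹ * P.ip (-1) (θs - (P.Qn (n + 1)).mulVec φs)
        ((P.fQ (n + 1)).mulVec (θ - (P.Qn (n + 1)).mulVec φ)) +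
      P.ip n φs ((P.D n).mulVec φ) + V.eval n φs φ - μ * P.ip n φs φ := by
  have hL := P.L_ne_zero
  have hcast : ((n + 1 : ℕ) : ℤ) = (n : ℤ) + 1 := by push_cast; rfl
  have hsub : ∀ (θ : P.Fld (n + 1)) (φ : P.Fld 0),
      P.scl θ - (P.Qn (n + 1)).mulVec (P.scl φ) = P.scl (θ - (P.Qn (n + 1)).mulVec φ) := by
    intro θ φ
    simp only [scl_eq, Matrix.mulVec_smul, smul_sub]
  have hmul : ∀ {k l : ℕ} (M : Matrix (P.Lat k) (P.Lat l) ℂ) (f : P.Fld l),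
      M.mulVec (P.scl f) = P.scl (M.mulVec f) := fun M f => Matrix.mulVec_smul _ _ _
  have h0 := ip_scl (P := P) (-1) (θs - (P.Qn (n + 1)).mulVec φs)
    ((P.fQ (n + 1)).mulVec (θ - (P.Qn (n + 1)).mulVec φ))
  rw [neg_add_cancel] at h0
  rw [actCheck, act, hsub, hsub, hmul, h0, hcast, V.scale_eval, hmul, ip_scl, ip_scl, D_succ,
    Matrix.smul_mulVec, ip_smul_right]
  field_simp

/-- The recursion for the action. By `fQ_succ_sub` and `fQ_critOf_sub` all three quadratic forms
are pairings with the single field `θ - Qψ`. -/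
theorem actCheck_succ_critOf (h1 : 1 ≤ n) (hn : n + 1 ≤ P.N) (μ : ℂ) (V : P.Quartic)
    (θ : P.Fld (n + 1) × P.Fld (n + 1)) (φs φ : P.Fld 0) :
    P.actCheck (n + 1) μ V θ.1 θ.2 φs φ =
      P.blockTerm n θ (P.critOf n θ.1 φs) (P.critOf n θ.2 φ) +
        P.act n μ V (P.critOf n θ.1 φs) (P.critOf n θ.2 φ) φs φ := by
  have hQ : ∀ f g, P.ip 0 f ((P.Qadj n).mulVec g) = P.ip (-1) ((P.Q n).mulVec f) g := fun f g =>
    (P.ip_adj 0 (-1) (P.Q n) f g).symm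
  have hL := P.L_ne_zero
  rw [actCheck_succ, act, blockTerm, fQ_succ_sub h1 hn, fQ_critOf_sub hn, ip_smul_right,
    ip_smul_right, hQ, Qn_succ_mulVec, a_eq]
  simp only [ip_sub_left, Matrix.mulVec_sub]
  field_simp
  ring

end CriticalField

/-! ### The critical field equations -/

/-- For `n = 0` the effective action is the scaled action at scale one, because `𝔔_1 = a`. -/
theorem effAct_zero (μ : ℂ) (V : P.Quartic) (θ : P.Fld 1 × P.Fld 1) (ψs ψ : P.Fld 0) :
    P.effAct 0 μ V θ ψs ψ = P.actCheck 1 μ V θ.1 θ.2 ψs ψ := by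
  have hL := P.L_ne_zero
  have hfQ : P.fQ (0 + 1) = (P.a : ℂ) • (1 : Matrix (P.Lat 1) (P.Lat 1) ℂ) := by simp [fQ]
  have hQ : P.Qn (0 + 1) = P.Q 0 := Matrix.mul_one _
  have hD : P.D 0 = P.D0 := by simp [D]
  have h := actCheck_succ 0 μ V θ.1 θ.2 ψs ψ
  rw [hfQ, hQ, hD, Matrix.smul_mulVec, Matrix.one_mulVec, ip_smul_right, a_eq] at h
  rw [effAct, blockTerm, act0]
  refine Eq.trans ?_ h.symm
  push_cast
  field_simp
  ring

theorem IsCritical.comp_scl {k : ℕ} {f : P.Fld k → P.Fld k → ℂ} {x : P.Fld k × P.Fld k}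
    (h : P.IsCritical f (P.scl x.1, P.scl x.2)) :
    P.IsCritical (fun φs φ => f (P.scl φs) (P.scl φ)) x := by
  have hs : ∀ y : P.Fld k, HasFDerivAt (P.scl (k := k))
      (P.sclFactor • ContinuousLinearMap.id ℂ (P.Fld k)) y := fun y =>
    (hasFDerivAt_id y).const_smul P.sclFactor
  constructor
  · have := HasFDerivAt.comp x.1 (g := fun φs => f φs (P.scl x.2)) h.1 (hs x.1)
    rw [ContinuousLinearMap.zero_comp] at this
    exact this
  · have := HasFDerivAt.comp x.2 (g := fun φ => f (P.scl x.1) φ) h.2 (hs x.2)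
    rw [ContinuousLinearMap.zero_comp] at this
    exact this

theorem differentiable_blockTerm (n : ℕ) (θ : P.Fld (n + 1) × P.Fld (n + 1)) :
    Differentiable ℂ fun p : P.Fld n × P.Fld n => P.blockTerm n θ p.1 p.2 := by
  unfold blockTerm ip Matrix.mulVec dotProduct
  simp only [Pi.sub_apply]
  fun_prop

theorem block_act_add_smul_left (n : ℕ) (μ : ℂ) (V : P.Quartic)
    (θ : P.Fld (n + 1) × P.Fld (n + 1)) (ψs ψ h : P.Fld n) (φs φ : P.Fld 0) (t : ℂ) :
    P.blockTerm n θ (ψs + t • h) ψ + P.act n μ V (ψs + t • h) ψ φs φ =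
      P.blockTerm n θ ψs ψ + P.act n μ V ψs ψ φs φ +
        t * P.ip 0 h ((P.fQ n).mulVec (ψ - (P.Qn n).mulVec φ) -
          P.b • (P.Qadj n).mulVec (θ.2 - (P.Q n).mulVec ψ)) + t ^ 2 * 0 := by
  have hQ : ∀ f g, P.ip 0 f ((P.Qadj n).mulVec g) = P.ip (-1) ((P.Q n).mulVec f) g := fun f g =>
    (P.ip_adj 0 (-1) (P.Q n) f g).symm
  simp only [blockTerm, act, Matrix.mulVec_add, Matrix.mulVec_smul, ip_sub_left, ip_add_left,
    ip_smul_left, ip_sub_right 0 h, ip_smul_right 0 P.b h, hQ]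
  ring

theorem block_act_add_smul_right (n : ℕ) (μ : ℂ) (V : P.Quartic)
    (θ : P.Fld (n + 1) × P.Fld (n + 1)) (ψs ψ h : P.Fld n) (φs φ : P.Fld 0) (t : ℂ) :
    P.blockTerm n θ ψs (ψ + t • h) + P.act n μ V ψs (ψ + t • h) φs φ =
      P.blockTerm n θ ψs ψ + P.act n μ V ψs ψ φs φ +
        t * P.ip 0 h ((P.fQ n).mulVec (ψs - (P.Qn n).mulVec φs) -
          P.b • (P.Qadj n).mulVec (θ.1 - (P.Q n).mulVec ψs)) + t ^ 2 * 0 := by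
  have hQ : ∀ f g, P.ip 0 f ((P.Qadj n).mulVec g) = P.ip (-1) g ((P.Q n).mulVec f) := fun f g => by
    rw [ip_comm (-1)]
    exact (P.ip_adj 0 (-1) (P.Q n) f g).symm
  have hf : ∀ f, P.ip 0 f ((P.fQ n).mulVec h) = P.ip 0 h ((P.fQ n).mulVec f) := fun f =>
    ip_fQ_symm _ _ _ _
  have e : ψ + t • h - (P.Qn n).mulVec φ = (ψ - (P.Qn n).mulVec φ) + t • h := by abel
  have e' : θ.2 - (P.Q n).mulVec (ψ + t • h) = (θ.2 - (P.Q n).mulVec ψ) - t • (P.Q n).mulVec h := by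
    rw [Matrix.mulVec_add, Matrix.mulVec_smul]
    abel
  rw [blockTerm, blockTerm, act, act, e, e', Matrix.mulVec_add, Matrix.mulVec_smul, ip_add_right,
    ip_smul_right, hf, ip_sub_right (-1), ip_smul_right, ip_sub_right 0 h, ip_smul_right 0 P.b, hQ]
  ring

/-- The critical fields solve the critical field equations: the gradient of the action in the
background fields vanishes, so that only its explicit dependence on the fields contributes. -/
theorem isCritical_effAct {n : ℕ} (hn : n + 1 ≤ P.N) {μ : ℂ} {V : P.Quartic}
    {θ : P.Fld (n + 1) × P.Fld (n + 1)} {x : P.Fld 0 × P.Fld 0} {p : P.Fld n × P.Fld n}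
    (hp : p = (P.critOf n θ.1 x.1, P.critOf n θ.2 x.2))
    (hx : P.bg n μ V p = x) (hbg : DifferentiableAt ℂ (P.bg n μ V) p)
    (hc : P.IsCritical (P.act n μ V p.1 p.2) x) :
    P.IsCritical (fun ψs ψ => P.blockTerm n θ ψs ψ +
      P.act n μ V ψs ψ (P.bg n μ V (ψs, ψ)).1 (P.bg n μ V (ψs, ψ)).2) p := by
  let J : (P.Fld n × P.Fld n) × P.Fld 0 × P.Fld 0 → ℂ := fun q =>
    P.blockTerm n θ q.1.1 q.1.2 + P.act n μ V q.1.1 q.1.2 q.2.1 q.2.2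
  have hJ : Differentiable ℂ J :=
    ((differentiable_blockTerm n θ).comp differentiable_fst).add (differentiable_act n μ V)
  have hc' := (isCritical_act_iff n μ V p.1 p.2 x).1 hc
  have z0 : ∀ (j : ℤ) {k : ℕ} (h : P.Fld k), P.ip j h 0 = 0 := fun j k h => by simp [ip]
  -- all four partial derivatives of `J` vanish
  have hder : fderiv ℂ J (p, x) = 0 := by
    have d1 : ∀ h, fderiv ℂ J (p, x) ((h, 0), 0) = 0 := fun h => by
      refine fderiv_apply_of_line (c := 0) (hJ _) fun t => ?_
      have := block_act_add_smul_left n μ V θ p.1 p.2 h x.1 x.2 t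
      have e : (P.fQ n).mulVec (p.2 - (P.Qn n).mulVec x.2) -
          P.b • (P.Qadj n).mulVec (θ.2 - (P.Q n).mulVec p.2) = 0 := by
        rw [hp, sub_eq_zero]
        exact fQ_critOf_sub hn θ.2 x.2
      rw [e, z0] at this
      simpa [J] using this
    have d2 : ∀ h, fderiv ℂ J (p, x) ((0, h), 0) = 0 := fun h => by
      refine fderiv_apply_of_line (c := 0) (hJ _) fun t => ?_
      have := block_act_add_smul_right n μ V θ p.1 p.2 h x.1 x.2 t
      have e : (P.fQ n).mulVec (p.1 - (P.Qn n).mulVec x.1) -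
          P.b • (P.Qadj n).mulVec (θ.1 - (P.Q n).mulVec p.1) = 0 := by
        rw [hp, sub_eq_zero]
        exact fQ_critOf_sub hn θ.1 x.1
      rw [e, z0] at this
      simpa [J] using this
    have d3 : ∀ h, fderiv ℂ J (p, x) (0, (h, 0)) = 0 := fun h => by
      refine fderiv_apply_of_line (c := V.eval n h x.2) (hJ _) fun t => ?_
      have := act_add_smul_left n μ V p.1 p.2 x.1 x.2 h t
      rw [hc'.2, z0] at this
      simp [J, this]
      ring
    have d4 : ∀ h, fderiv ℂ J (p, x) (0, (0, h)) = 0 := fun h => by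
      refine fderiv_apply_of_line (c := V.eval n x.1 h) (hJ _) fun t => ?_
      have := act_add_smul_right n μ V p.1 p.2 x.1 x.2 h t
      rw [hc'.1, z0] at this
      simp [J, this]
      ring
    refine ContinuousLinearMap.ext fun v => ?_
    have hv : v = ((v.1.1, 0), 0) + ((0, v.1.2), 0) + (0, (v.2.1, 0)) + (0, (0, v.2.2)) := by
      ext <;> simp
    rw [hv, map_add, map_add, map_add, d1, d2, d3, d4]
    simp
  have hE : HasFDerivAt (fun q => J (q, P.bg n μ V q)) (0 : P.Fld n × P.Fld n →L[ℂ] ℂ) p := by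
    have h1 : HasFDerivAt (𝕜 := ℂ) J 0 (p, P.bg n μ V p) := by
      rw [hx, ← hder]
      exact (hJ _).hasFDerivAt
    have h2 := h1.comp p ((hasFDerivAt_id (𝕜 := ℂ) p).prodMk hbg.hasFDerivAt)
    simpa [Function.comp_def] using h2
  constructor
  · have h3 : HasFDerivAt (fun ψs : P.Fld n => (ψs, p.2))
        (ContinuousLinearMap.inl ℂ (P.Fld n) (P.Fld n)) p.1 := hasFDerivAt_prodMk_left _ _
    have := HasFDerivAt.comp p.1 (g := fun q => J (q, P.bg n μ V q)) hE h3
    simpa [Function.comp_def] using this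
  · have h3 : HasFDerivAt (fun ψ : P.Fld n => (p.1, ψ))
        (ContinuousLinearMap.inr ℂ (P.Fld n) (P.Fld n)) p.2 := hasFDerivAt_prodMk_right _ _
    have := HasFDerivAt.comp p.2 (g := fun q => J (q, P.bg n μ V q)) hE h3
    simpa [Function.comp_def] using this

end Setup

end BlockSpin

/-! ### Bounds from the norms with mass -/

namespace BlockSpin

namespace Setup

variable {P : Setup}

theorem le_ciSup_of_le_of_finite {ι : Type*} [Finite ι] {f : ι → ℝ} {c : ℝ} (i : ι) (h : c ≤ f i) :
    c ≤ ⨆ i, f i :=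
  h.trans (le_ciSup (Set.finite_range f).bddAbove i)

/-- Dropping the exponential weight, which is at least one, leaves the row and column sums. -/
theorem boundedBy_opNorm (j : ℤ) {m : ℝ} (hm : 0 ≤ m) {k : ℕ} (A : Matrix (P.Lat k) (P.Lat k) ℂ) :
    BoundedBy A (P.opNorm j m A) ∧ BoundedBy A.transpose (P.opNorm j m A) := by
  have hle : ∀ x y, ‖A x y‖ ≤ Real.exp (m * P.dist j x y) * ‖A x y‖ := fun x y =>
    le_mul_of_one_le_left (norm_nonneg _)
      (Real.one_le_exp (mul_nonneg hm (Real.sqrt_nonneg _)))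
  have h1 : ∀ x, ∑ y, ‖A x y‖ ≤ P.opNorm j m A := fun x =>
    (le_ciSup_of_le_of_finite x (Finset.sum_le_sum fun y _ => hle x y)).trans (le_max_left _ _)
  have h2 : ∀ y, ∑ x, ‖A x y‖ ≤ P.opNorm j m A := fun y =>
    (le_ciSup_of_le_of_finite y (Finset.sum_le_sum fun x _ => hle x y)).trans (le_max_right _ _)
  have h0 : 0 ≤ P.opNorm j m A := le_trans (Finset.sum_nonneg fun y _ => norm_nonneg _) (h1 0)
  exact ⟨BoundedBy.of_rows h0 h1, BoundedBy.of_rows h0 h2⟩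

theorem treeLen_nonneg (j : ℤ) {k r : ℕ} (u : Fin r → P.Lat k) : 0 ≤ P.treeLen j u := by
  refine Real.sInf_nonneg ?_
  rintro _ ⟨G, -, -, rfl⟩
  refine finsum_nonneg fun e => finsum_nonneg fun _ => ?_
  induction e with
  | _ x y => exact Real.sqrt_nonneg _

theorem rowBound_of_kerNorm (j : ℤ) {m : ℝ} (hm : 0 ≤ m) (f : (Fin 4 → P.Lat 0) → ℂ) (i : Fin 4)
    (e : P.Lat 0 → P.Lat 0 × P.Lat 0 × P.Lat 0 → Fin 4 → P.Lat 0)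
    (he : ∀ u, Function.Injective (e u)) (hi : ∀ u p, e u p i = u) :
    RowBound (fun u x y z => f (e u (x, y, z))) j (P.kerNorm j m f) := by
  intro u
  refine le_ciSup_of_le_of_finite i (le_ciSup_of_le_of_finite u ?_)
  refine mul_le_mul_of_nonneg_left ?_ (by positivity)
  set F : (Fin 4 → P.Lat 0) → ℝ := fun v =>
    if v i = u then ‖f v‖ * Real.exp (m * P.treeLen j v) else 0 with hF
  have hpos : ∀ v, 0 ≤ F v := by
    intro v
    simp only [hF]
    split_ifs <;> positivity
  calc ∑ x, ∑ y, ∑ z, ‖f (e u (x, y, z))‖ = ∑ p : P.Lat 0 × P.Lat 0 × P.Lat 0, ‖f (e u p)‖ := by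
        simp only [Fintype.sum_prod_type]
    _ ≤ ∑ p : P.Lat 0 × P.Lat 0 × P.Lat 0, F (e u p) := by
        refine Finset.sum_le_sum fun p _ => ?_
        simp only [hF, hi, if_true]
        exact le_mul_of_one_le_right (norm_nonneg _)
          (Real.one_le_exp (mul_nonneg hm (treeLen_nonneg j _)))
    _ = ∑ v ∈ Finset.univ.image (e u), F v := by
        rw [Finset.sum_image fun p _ q _ h => he u h]
    _ ≤ ∑ v, F v := Finset.sum_le_sum_of_subset_of_nonneg (Finset.subset_univ _) fun v _ _ => hpos v

theorem Quartic.rowBound_gradStar (V : P.Quartic) (j : ℤ) {m : ℝ} (hm : 0 ≤ m) :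
    RowBound V.ker j (V.norm j m) :=
  rowBound_of_kerNorm j hm (fun u : Fin 4 → P.Lat 0 => V.ker (u 0) (u 1) (u 2) (u 3)) 0
    (fun u p => ![u, p.1, p.2.1, p.2.2])
    (fun _ _ _ h => Prod.ext (congrFun h 1) (Prod.ext (congrFun h 2) (congrFun h 3)))
    fun _ _ => rfl

theorem Quartic.rowBound_grad (V : P.Quartic) (j : ℤ) {m : ℝ} (hm : 0 ≤ m) :
    RowBound (fun u x y z => V.ker x u y z) j (V.norm j m) :=
  rowBound_of_kerNorm j hm (fun u : Fin 4 → P.Lat 0 => V.ker (u 0) (u 1) (u 2) (u 3)) 1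
    (fun u p => ![p.1, u, p.2.1, p.2.2])
    (fun _ _ _ h => Prod.ext (congrFun h 0) (Prod.ext (congrFun h 2) (congrFun h 3)))
    fun _ _ => rfl

/-- Scaling does not increase the size of the kernel: it is multiplied by `L^{14}`, and the cell
volumes by `L^{-15}`. -/
theorem RowBound.scale {K : P.Lat 0 → P.Lat 0 → P.Lat 0 → P.Lat 0 → ℂ} {j : ℤ} {N : ℝ}
    (h : RowBound K j N) : RowBound (fun u x y z => (P.L : ℂ) ^ 14 * K u x y z) (j + 1) N := by
  intro u
  have hL : (1 : ℝ) ≤ P.L := by exact_mod_cast P.L_pos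
  have hL0 : (P.L : ℝ) ≠ 0 := by positivity
  have hz : (P.L : ℝ) ^ (-5 * j) = (P.L : ℝ) ^ (-5 * (j + 1)) * (P.L : ℝ) ^ 5 := by
    rw [← zpow_natCast, ← zpow_add₀ hL0]
    congr 1
    push_cast
    ring
  have h1 := h u
  rw [hz] at h1
  refine le_trans ?_ h1
  simp only [norm_mul, norm_pow, Complex.norm_natCast, ← Finset.mul_sum]
  rw [mul_pow, mul_assoc (((P.L : ℝ) ^ (-5 * (j + 1))) ^ 3), ← pow_mul]
  have : (P.L : ℝ) ^ 14 ≤ (P.L : ℝ) ^ (5 * 3) := pow_le_pow_right₀ hL (by norm_num)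
  gcongr

/-- The smallness conditions hold if `g` bounds the Green function at `μ = 0` and `N` the kernel. -/
theorem smallData_of_bounds {n : ℕ} (hn : n ≤ P.N) {μ : ℂ} {V : P.Quartic} {g N R : ℝ} (hg : 0 < g)
    (h1 : BoundedBy (P.green n 0) g) (h2 : BoundedBy (P.green n 0).transpose g)
    (hμ : ‖μ‖ * g ≤ 1 / 2) (hV : RowBound V.ker n N)
    (hV' : RowBound (fun u x y z => V.ker x u y z) n N) (hs : 2 * g * (3 * N) * R ^ 2 ≤ 1 / 2) :
    P.SmallData n μ V (2 * g) N R := by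
  have hA := P.isUnit_invGreen hn
  have hg0 : P.green n 0 = (P.invGreen n)⁻¹ := by simp [green, invGreen]
  rw [hg0] at h1 h2
  rw [Matrix.transpose_nonsing_inv] at h2
  have hAt := (Matrix.isUnit_transpose (P.invGreen n)).2 hA
  have hb := norm_le_mulVec_sub_smul hA h1 hg.le hμ
  have hb' := norm_le_mulVec_sub_smul hAt h2 hg.le hμ
  refine ⟨hn, isUnit_of_le_mulVec hb, by positivity, BoundedBy.inv_of_le_mulVec hb, ?_, hV, hV', hs⟩
  have ht : (P.green n μ).transpose =
      ((P.invGreen n).transpose - μ • (1 : Matrix (P.Lat 0) (P.Lat 0) ℂ))⁻¹ := by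
    rw [green, Matrix.transpose_nonsing_inv, Matrix.transpose_sub, Matrix.transpose_smul,
      Matrix.transpose_one]
    rfl
  rw [ht]
  exact BoundedBy.inv_of_le_mulVec hb'

/-! ### Field radii -/

theorem kappa_pos {v : ℝ} (hv : 0 < v) (ε δ : ℝ) (n : ℕ) : 0 < P.kappa v ε δ n :=
  div_pos (Real.rpow_pos_of_pos (by exact_mod_cast P.L_pos) _) (Real.rpow_pos_of_pos hv _)

theorem kappa_succ {v : ℝ} (ε δ : ℝ) (n : ℕ) :
    P.kappa v ε δ (n + 1) = (P.L : ℝ) ^ eta v δ * P.kappa v ε δ n := by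
  have hL : (0 : ℝ) < P.L := by exact_mod_cast P.L_pos
  rw [kappa, kappa, mul_div_assoc', ← Real.rpow_add hL]
  congr 2
  push_cast
  ring

/-- the factor by which the critical fields exceed `θ`, at most, in terms of `a` and the bound `g`
on the Green functions -/
noncomputable def critFactor (a g : ℝ) : ℝ := 2 + 32 * a * g

/-- a bound on `‖𝒱‖ κ² + |μ|` that makes the fixed point equations for the background fields
contractive -/
noncomputable def smallness (L : ℕ) (a g : ℝ) : ℝ :=
  min (1 / (2 * ((L : ℝ) ^ 2 + 1) * g)) (1 / (12 * g * (8 * a * g * critFactor a g) ^ 2 + 1))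

theorem smallness_pos (L : ℕ) (a : ℝ) {g : ℝ} (hg : 0 < g) : 0 < smallness L a g := by
  rw [smallness]
  positivity

theorem le_of_le_smallness {L : ℕ} {a g N κ M : ℝ} (hg : 0 < g) (hN : 0 ≤ N) (hM : 0 ≤ M)
    (h : N * κ ^ 2 + M ≤ smallness L a g) : M * g ≤ 1 / 2 ∧ (L : ℝ) ^ 2 * M * g ≤ 1 / 2 ∧
      2 * g * (3 * N) * (8 * a * g * critFactor a g * κ) ^ 2 ≤ 1 / 2 := by
  have h1 := h.trans (min_le_left _ _)
  have h2 := h.trans (min_le_right _ _)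
  have hNκ : 0 ≤ N * κ ^ 2 := by positivity
  set X := (8 * a * g * critFactor a g) ^ 2 with hX
  have hX0 : 0 ≤ X := sq_nonneg _
  rw [le_div_iff₀ (by positivity)] at h1 h2
  have hMg : 0 ≤ M * g := by positivity
  have hLMg : 0 ≤ (L : ℝ) ^ 2 * (M * g) := by positivity
  have hA : 0 ≤ N * κ ^ 2 * (2 * ((L : ℝ) ^ 2 + 1) * g) := by positivity
  have hB : 0 ≤ M * (12 * g * X + 1) := by positivity
  refine ⟨by nlinarith, by nlinarith, ?_⟩
  have e : 2 * g * (3 * N) * (8 * a * g * critFactor a g * κ) ^ 2 = 6 * (g * X * (N * κ ^ 2)) := by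
    rw [hX]
    ring
  rw [e]
  nlinarith

end Setup

end BlockSpin

/-! ### Assembling the estimates -/

namespace BlockSpin

namespace Setup

variable {P : Setup}

theorem scl_mem_polydisc {k : ℕ} {r : ℝ} {θ : P.Fld k × P.Fld k}
    (hθ : θ ∈ P.polydisc k (r / (P.L : ℝ) ^ (3 / 2 : ℝ))) :
    (P.scl θ.1, P.scl θ.2) ∈ P.polydisc k r := by
  have h : ∀ z : ℂ, ‖z‖ < r / (P.L : ℝ) ^ (3 / 2 : ℝ) → ‖P.sclFactor * z‖ < r := fun z hz => by
    rw [norm_mul, norm_sclFactor, mul_comm]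
    exact (lt_div_iff₀ L_pow_pos).1 hz
  exact ⟨fun x => h _ (hθ.1 x), fun x => h _ (hθ.2 x)⟩

theorem crit_of_one_le {n : ℕ} (h1 : 1 ≤ n) (μ : ℂ) (V : P.Quartic)
    (θ : P.Fld (n + 1) × P.Fld (n + 1)) : P.crit n μ V θ =
      (P.critOf n θ.1 (P.bgCheck (n + 1) μ V θ).1, P.critOf n θ.2 (P.bgCheck (n + 1) μ V θ).2) := by
  obtain ⟨k, rfl⟩ := Nat.exists_eq_add_of_le' h1
  rfl

theorem effAct_of_one_le {n : ℕ} (h1 : 1 ≤ n) (μ : ℂ) (V : P.Quartic)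
    (θ : P.Fld (n + 1) × P.Fld (n + 1)) : P.effAct n μ V θ = fun ψs ψ => P.blockTerm n θ ψs ψ +
      P.act n μ V ψs ψ (P.bg n μ V (ψs, ψ)).1 (P.bg n μ V (ψs, ψ)).2 := by
  obtain ⟨k, rfl⟩ := Nat.exists_eq_add_of_le' h1
  rfl

theorem scl_bgCheck (n : ℕ) (μ : ℂ) (V : P.Quartic) (θ : P.Fld n × P.Fld n) :
    (P.scl (P.bgCheck n μ V θ).1, P.scl (P.bgCheck n μ V θ).2) =
      P.bg n ((P.L : ℂ) ^ 2 * μ) V.scale (P.scl θ.1, P.scl θ.2) :=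
  Prod.ext (scl_unscl _) (scl_unscl _)

theorem norm_bgCheck_le {n : ℕ} {μ : ℂ} {V : P.Quartic} {θ : P.Fld n × P.Fld n} {C : ℝ}
    (h : ‖P.bg n ((P.L : ℂ) ^ 2 * μ) V.scale (P.scl θ.1, P.scl θ.2)‖ ≤
      C * ‖(P.scl θ.1, P.scl θ.2)‖) : ‖P.bgCheck n μ V θ‖ ≤ C * ‖θ‖ := by
  have hc : 0 < ‖P.sclFactor‖ := norm_pos_iff.2 sclFactor_ne_zero
  have e1 : (P.scl (P.bgCheck n μ V θ).1, P.scl (P.bgCheck n μ V θ).2) =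
      P.sclFactor • P.bgCheck n μ V θ := rfl
  have e2 : (P.scl θ.1, P.scl θ.2) = P.sclFactor • θ := rfl
  rw [← scl_bgCheck, e1, e2, norm_smul, norm_smul, mul_left_comm] at h
  exact le_of_mul_le_mul_left h hc

theorem analyticOnNhd_bgCheck {n : ℕ} {μ : ℂ} {V : P.Quartic} {r : ℝ}
    (h : AnalyticOnNhd ℂ (P.bg n ((P.L : ℂ) ^ 2 * μ) V.scale) (P.polydisc n r)) :
    AnalyticOnNhd ℂ (P.bgCheck n μ V) (P.polydisc n (r / (P.L : ℝ) ^ (3 / 2 : ℝ))) := by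
  have hs : AnalyticOnNhd ℂ (fun θ : P.Fld n × P.Fld n => P.sclFactor • θ) Set.univ :=
    (P.sclFactor • ContinuousLinearMap.id ℂ (P.Fld n × P.Fld n)).analyticOnNhd _
  have hu : AnalyticOnNhd ℂ (fun x : P.Fld 0 × P.Fld 0 => P.sclFactor⁻¹ • x) Set.univ :=
    (P.sclFactor⁻¹ • ContinuousLinearMap.id ℂ (P.Fld 0 × P.Fld 0)).analyticOnNhd _
  have h1 := hu.comp (h.comp (hs.mono (Set.subset_univ _)) fun θ hθ => scl_mem_polydisc hθ)
    fun _ _ => Set.mem_univ _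
  have e : P.bgCheck n μ V = fun θ => P.sclFactor⁻¹ •
      P.bg n ((P.L : ℂ) ^ 2 * μ) V.scale (P.sclFactor • θ) :=
    funext fun θ => Prod.ext (unscl_eq _) (unscl_eq _)
  rw [e]
  exact h1

theorem norm_crit_le {n : ℕ} (h1 : 1 ≤ n) (hn : n + 1 ≤ P.N) {μ : ℂ} {V : P.Quartic}
    {θ : P.Fld (n + 1) × P.Fld (n + 1)} {g : ℝ}
    (h : ‖P.bgCheck (n + 1) μ V θ‖ ≤ 8 * P.a * g * ‖θ‖) :
    ‖P.crit n μ V θ‖ ≤ critFactor P.a g * ‖θ‖ := by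
  have hc : ∀ (t : P.Fld (n + 1)) (x : P.Fld 0), ‖t‖ ≤ ‖θ‖ → ‖x‖ ≤ ‖P.bgCheck (n + 1) μ V θ‖ →
      ‖P.critOf n t x‖ ≤ critFactor P.a g * ‖θ‖ := fun t x ht hx => by
    have := norm_critOf_le hn t x
    rw [critFactor]
    linarith
  rw [crit_of_one_le h1]
  exact norm_prod_le_iff.2 ⟨hc _ _ (norm_fst_le θ) (norm_fst_le _),
    hc _ _ (norm_snd_le θ) (norm_snd_le _)⟩

theorem analyticOnNhd_crit {n : ℕ} {μ : ℂ} {V : P.Quartic} {s : Set (P.Fld (n + 1) × P.Fld (n + 1))}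
    (h : AnalyticOnNhd ℂ (P.bgCheck (n + 1) μ V) s) : AnalyticOnNhd ℂ (P.crit n μ V) s := by
  cases n with
  | zero => exact h
  | succ k =>
    intro θ hθ
    have hlin : ∀ f : P.Fld (k + 1 + 1) × P.Fld 0, AnalyticAt ℂ
        (fun q : P.Fld (k + 1 + 1) × P.Fld 0 => P.critOf (k + 1) q.1 q.2) f := by
      intro f
      refine contDiff_omega_iff_analyticOnNhd.1 ?_ f (Set.mem_univ _)
      unfold critOf Matrix.mulVec dotProduct
      simp only [Pi.add_apply, Pi.smul_apply]
      fun_prop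
    have hb := h θ hθ
    exact ((hlin _).comp (f := fun θ : P.Fld (k + 1 + 1) × P.Fld (k + 1 + 1) =>
        (θ.1, (P.bgCheck (k + 1 + 1) μ V θ).1))
        (analyticAt_fst.prod (analyticAt_fst.comp hb))).prod
      ((hlin _).comp (f := fun θ : P.Fld (k + 1 + 1) × P.Fld (k + 1 + 1) =>
        (θ.2, (P.bgCheck (k + 1 + 1) μ V θ).2))
        (analyticAt_snd.prod (analyticAt_snd.comp hb)))

/-- For `L` large the radius `κ(n+1) / L^{3/2}`, enlarged by a fixed factor `C`, is at most `κ(n)`,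
since `η < 7/8`. -/
theorem mul_kappa_succ_le {v ε δ : ℝ} (hv : 0 < v) {C : ℝ} (hL : C ^ 2 ≤ P.L)
    (hη : eta v δ ≤ 7 / 8) (n : ℕ) :
    C * (P.kappa v ε δ (n + 1) / (P.L : ℝ) ^ (3 / 2 : ℝ)) ≤ P.kappa v ε δ n := by
  have hL1 : (1 : ℝ) ≤ P.L := by exact_mod_cast P.L_pos
  have hL0 : (0 : ℝ) < P.L := by linarith
  have hC' : C ≤ (P.L : ℝ) ^ (1 / 2 : ℝ) := by
    rw [← Real.sqrt_eq_rpow]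
    exact Real.le_sqrt_of_sq_le hL
  have h1 : C * (P.L : ℝ) ^ eta v δ ≤ (P.L : ℝ) ^ (3 / 2 : ℝ) := by
    calc C * (P.L : ℝ) ^ eta v δ ≤ (P.L : ℝ) ^ (1 / 2 : ℝ) * (P.L : ℝ) ^ eta v δ := by gcongr
      _ = (P.L : ℝ) ^ (1 / 2 + eta v δ) := (Real.rpow_add hL0 _ _).symm
      _ ≤ (P.L : ℝ) ^ (3 / 2 : ℝ) := Real.rpow_le_rpow_of_exponent_le hL1 (by linarith)
  rw [kappa_succ, ← mul_div_assoc, div_le_iff₀ L_pow_pos]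
  have := mul_le_mul_of_nonneg_right h1 (P.kappa_pos hv ε δ n).le
  linarith

end Setup

end BlockSpin

open Setup

theorem proposition3p3 :
    ∃ (ρ : ℕ → ℝ → ℝ → ℝ) (L₀ : ℝ → ℝ → ℝ), (∀ L a Γ, 0 < ρ L a Γ) ∧
      ∀ (P : Setup) (m v ε δ : ℝ) (n : ℕ) (μ : ℂ) (V : P.Quartic),
        0 ≤ m → 0 < v → v < 1 → 0 < ε → 0 < δ → δ < 1 →
        3 / 4 + 8 * ε < Real.log v / Real.log δ →
        Real.log v / Real.log δ < 9 / 8 - ε →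
        n + 1 ≤ P.N →
        V.norm n (2 * m) * P.kappa v ε δ (n + 1) ^ 2 + ‖μ‖ ≤ ρ P.L P.a (P.greenSize m n) →
        -- the background fields in question exist on the polydiscs of radius `κ(n)`, `κ(n+1)`
        (1 ≤ n → P.IsBackground n μ V (P.kappa v ε δ n) (P.bg n μ V)) ∧
        P.IsBackground (n + 1) ((P.L : ℂ) ^ 2 * μ) V.scale (P.kappa v ε δ (n + 1))
          (P.bg (n + 1) ((P.L : ℂ) ^ 2 * μ) V.scale) ∧
        -- analyticity
        AnalyticOnNhd ℂ (P.crit n μ V)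
          (P.polydisc (n + 1) (P.kappa v ε δ (n + 1) / (P.L : ℝ) ^ (3 / 2 : ℝ))) ∧
        ∀ θ ∈ P.polydisc (n + 1) (P.kappa v ε δ (n + 1) / (P.L : ℝ) ^ (3 / 2 : ℝ)),
          -- the critical field equations
          P.IsCritical (P.effAct n μ V θ) (P.crit n μ V θ) ∧
          (1 ≤ n →
            P.crit n μ V θ ∈ P.bgDomain n μ V ∧
            (L₀ P.a (P.greenSize m n) ≤ P.L →
              P.crit n μ V θ ∈ P.polydisc n (P.kappa v ε δ n)) ∧
            -- the composition rule
            P.bgCheck (n + 1) μ V θ = P.bg n μ V (P.crit n μ V θ) ∧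
            -- the recursion for the action
            P.actCheck (n + 1) μ V θ.1 θ.2
                (P.bgCheck (n + 1) μ V θ).1 (P.bgCheck (n + 1) μ V θ).2 =
              P.blockTerm n θ (P.crit n μ V θ).1 (P.crit n μ V θ).2 +
              P.act n μ V (P.crit n μ V θ).1 (P.crit n μ V θ).2
                (P.bgCheck (n + 1) μ V θ).1 (P.bgCheck (n + 1) μ V θ).2) := by
  refine ⟨fun L a Γ => smallness L a (1 + |Γ|), fun a Γ => critFactor a (1 + |Γ|) ^ 2,
    fun L a Γ => smallness_pos L a (by positivity), ?_⟩
  intro P m v ε δ n μ V hm hv _ hε _ _ hlow hup hn hsmall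
  have hn' : n ≤ P.N := by omega
  have ha := P.a_pos
  have h2m : 0 ≤ 2 * m := by linarith
  -- a strictly positive bound on the Green functions at both scales
  set g : ℝ := 1 + |P.greenSize m n| with hg
  have hg0 : 0 < g := by positivity
  have hgG : P.greenSize m n ≤ g := by linarith [le_abs_self (P.greenSize m n)]
  set C := critFactor P.a g with hC
  have hC1 : 1 ≤ C := by
    have : 0 ≤ 32 * P.a * g := by positivity
    rw [hC, critFactor]
    linarith
  set κ := P.kappa v ε δ (n + 1) with hκ
  have hκ0 : 0 < κ := P.kappa_pos hv ε δ (n + 1)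
  -- the background fields are at most `8ag` times the external fields, which are at most `C κ(n+1)`
  set R := 8 * P.a * g * C * κ with hR
  have hN := (V.rowBound_gradStar n h2m).nonneg
  obtain ⟨hμ, hμ', hs⟩ := le_of_le_smallness hg0 hN (norm_nonneg μ) hsmall
  have hb := boundedBy_opNorm n h2m (P.green n 0)
  have hb' := boundedBy_opNorm (n + 1) h2m (P.green (n + 1) 0)
  have hm1 : P.opNorm n (2 * m) (P.green n 0) ≤ g := (le_max_left _ _).trans hgG
  have hm2 : P.opNorm (n + 1) (2 * m) (P.green (n + 1) 0) ≤ g := (le_max_right _ _).trans hgG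
  have S : P.SmallData n μ V (2 * g) (V.norm n (2 * m)) R :=
    smallData_of_bounds hn' hg0 (hb.1.mono hm1) (hb.2.mono hm1) hμ (V.rowBound_gradStar n h2m)
      (V.rowBound_grad n h2m) hs
  have S' : P.SmallData (n + 1) ((P.L : ℂ) ^ 2 * μ) V.scale (2 * g) (V.norm n (2 * m)) R := by
    refine smallData_of_bounds hn hg0 (hb'.1.mono hm2) (hb'.2.mono hm2) ?_ ?_ ?_ hs
    · rwa [norm_mul, norm_pow, Complex.norm_natCast]
    · rw [Nat.cast_succ]
      exact (V.rowBound_gradStar n h2m).scale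
    · rw [Nat.cast_succ]
      exact (V.rowBound_grad n h2m).scale
  have hag : 0 < 8 * P.a * g := by positivity
  obtain ⟨B', hB'⟩ := S'.isBackground_bg hκ0 (by
    rw [hR]
    have : 8 * P.a * g * κ ≤ 8 * P.a * g * κ * C := le_mul_of_one_le_right (by positivity) hC1
    linarith)
  have hCκ : 0 < C * κ := by positivity
  -- at scale `n` background fields are needed beyond `κ(n)`: on a polydisc that contains the critical
  -- fields whatever `L` is
  obtain ⟨B, hB⟩ := S.isBackground_bg hCκ (by rw [hR]; linarith)
  have hL1 : (1 : ℝ) ≤ P.L := by exact_mod_cast P.L_pos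
  have hη0 : 0 ≤ eta v δ := by
    rw [eta]
    linarith
  have hη : eta v δ ≤ 7 / 8 := by
    rw [eta]
    linarith
  have hκle : P.kappa v ε δ n ≤ C * κ := by
    have h1 : P.kappa v ε δ n ≤ κ := by
      rw [hκ, kappa_succ]
      exact le_mul_of_one_le_left (P.kappa_pos hv ε δ n).le (Real.one_le_rpow hL1 hη0)
    nlinarith
  have hanalytic := analyticOnNhd_bgCheck B'.analytic
  refine ⟨fun _ => (S.isBackground_bg (P.kappa_pos hv ε δ n) ?_).1, B',
    analyticOnNhd_crit hanalytic, fun θ hθ => ?_⟩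
  · rw [hR]
    have := mul_le_mul_of_nonneg_left hκle hag.le
    linarith
  have hθs := scl_mem_polydisc hθ
  have hcrit := B'.critical _ hθs
  rw [← scl_bgCheck] at hcrit
  have hφ : ‖P.bgCheck (n + 1) μ V θ‖ ≤ 8 * P.a * g * ‖θ‖ :=
    norm_bgCheck_le ((hB' _ hθs).trans_eq (by ring))
  have hθn : ‖θ‖ < κ / (P.L : ℝ) ^ (3 / 2 : ℝ) := by
    rwa [polydisc_eq_ball, mem_ball_zero_iff] at hθ
  have hθκ : ‖θ‖ < κ := hθn.trans_le
    (div_le_self hκ0.le (Real.one_le_rpow hL1 (by norm_num)))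
  rcases Nat.eq_zero_or_pos n with rfl | h1
  · refine ⟨?_, fun h => absurd h (by norm_num)⟩
    have e : P.effAct 0 μ V θ = fun ψs ψ => P.actCheck 1 μ V θ.1 θ.2 ψs ψ :=
      funext fun ψs => funext fun ψ => effAct_zero μ V θ ψs ψ
    rw [e]
    exact IsCritical.comp_scl hcrit
  have hψ := norm_crit_le h1 hn hφ
  have hψr : ‖P.crit n μ V θ‖ < C * (κ / (P.L : ℝ) ^ (3 / 2 : ℝ)) :=
    hψ.trans_lt (mul_lt_mul_of_pos_left hθn (by linarith))
  have hψmem : P.crit n μ V θ ∈ P.polydisc n (C * κ) := by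
    rw [polydisc_eq_ball, mem_ball_zero_iff]
    exact hψ.trans_lt (mul_lt_mul_of_pos_left hθκ (by linarith))
  have hcrit' : P.IsCritical (P.act n μ V (P.crit n μ V θ).1 (P.crit n μ V θ).2)
      (P.bgCheck (n + 1) μ V θ) := by
    rw [crit_of_one_le h1]
    exact isCritical_act_critOf h1 hn hcrit
  -- both sides are critical points in the ball of radius `R`
  have hcomp : P.bgCheck (n + 1) μ V θ = P.bg n μ V (P.crit n μ V θ) := by
    refine S.critical_unique ?_ ?_ hcrit' (B.critical _ hψmem)
    · refine hφ.trans ?_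
      rw [hR, mul_assoc _ C]
      exact mul_le_mul_of_nonneg_left (by nlinarith) hag.le
    · have h3 := hB _ hψmem
      rw [polydisc_eq_ball, mem_ball_zero_iff] at hψmem
      have h4 := mul_le_mul_of_nonneg_left hψmem.le hag.le
      rw [hR]
      linarith
  refine ⟨?_, fun _ => ⟨⟨_, _, B, hψmem⟩, fun hL => ?_, hcomp, ?_⟩⟩
  · rw [effAct_of_one_le h1]
    exact isCritical_effAct hn (crit_of_one_le h1 μ V θ) hcomp.symm
      (B.analytic _ hψmem).differentiableAt hcrit'
  · rw [polydisc_eq_ball, mem_ball_zero_iff]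
    exact hψr.trans_le (mul_kappa_succ_le hv hL hη n)
  · rw [crit_of_one_le h1]
    exact actCheck_succ_critOf h1 hn μ V θ _ _
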